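/- Let $\mathbb{F}_q$ be a finite field with $q$ elements and $V$ an $\mathbb{F}_q$-vector space of finite dimension $r\ge 1$. Let $S_V$ be the symmetric algebra of $V$ over $\mathbb{F}_q$ with its usual grading, $K_V$ its field of quotients, and $R_V\subset K_V$ the $\mathbb{F}_q$-subalgebra generated by the reciprocals $\frac1v$ for all $v\in V\setminus\{0\}$, graded so that every $\frac1v$ has degree $1$. Set $P_V:=\operatorname{Proj} S_V$ and $Q_V:=\operatorname{Proj} R_V$. Let $G:=\operatorname{Aut}_{\mathbb{F}_q}(V)$, let $G'\subset G$ be the subgroup of automorphisms of determinant $1$, and let $U$ be a maximal unipotent subgroup of $G$ (a subgroup maximal among those all of whose elements are unipotent). By functoriality these groups act on $P_V$ and $Q_V$. For a subgroup $H\subset G$ acting on $X=P_V$ or $Q_V$, the quotient $X\to X/H$ is the $H$-invariant morphism whose underlying topological space is the quotient of $X$ by $H$ and whose structure sheaf is the sheaf of $H$-invariants in the direct image of $\mathcal{O}_X$. The weighted projective space of weights $d_1,\ldots,d_r\ge1$ is $\operatorname{Proj}\mathbb{F}_q[T_1,\ldots,T_r]$ with $T_i$ of degree $d_i$. Then, with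 all isomorphisms over $\mathbb{F}_q$: (a) $Q_V/U\cong\mathbb{P}^{r-1}_{\mathbb{F}_q}$, and the projection $Q_V\to Q_V/U$ is finite and flat of degree $q^{r(r-1)/2}$. The other quotients are weighted projective spaces of the following weights: (b) $P_V/U$ has weights $1,q,\ldots,q^{r-1}$. (c) $Q_V/G$ has weights $q-1,q^2-1,\ldots,q^r-1$. (d) $P_V/G$ has weights $q^r-1,q^r-q,\ldots,q^r-q^{r-1}$. (e) $Q_V/G'$ has weights $q-1,\ldots,q^{r-1}-1,\frac{q^r-1}{q-1}$. (f) $P_V/G'$ has weights $\frac{q^r-1}{q-1},q^r-q,\ldots,q^r-q^{r-1}$. -/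

import Mathlib

open CategoryTheory AlgebraicGeometry
open scoped DirectSum

universe u

/-! ### Gradings by powers of a generating submodule -/

section PowGrading

variable {F A K L : Type u} [Field F] [CommRing A] [Algebra F A] [Field K] [Algebra F K] [Field L]
  [Algebra K L] [Algebra F L] [IsScalarTower F K L]
  {M : Submodule F A} {ψ : A →ₐ[F] K} {φ : A →ₐ[F] L} {t : L}

lemma map_of_mem_pow (hφ : ∀ m ∈ M, φ m = algebraMap K L (ψ m) * t) (n : ℕ) (a : A)
    (ha : a ∈ M ^ n) : φ a = algebraMap K L (ψ a) * t ^ n := by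
  induction ha using Submodule.pow_induction_on_left' with
  | algebraMap r => simp [← IsScalarTower.algebraMap_apply]
  | add x y i _ _ hx hy => rw [map_add, hx, hy, map_add, map_add, add_mul]
  | mem_mul m hm i x _ ih => rw [map_mul, ih, hφ m hm, map_mul, map_mul, pow_succ]; ring

lemma eq_zero_of_map_eq_zero (hφ : ∀ m ∈ M, φ m = algebraMap K L (ψ m) * t)
    (hψ : Function.Injective ψ) (ht : Transcendental K t) (a : ⨁ n : ℕ, ↥(M ^ n))
    (ha : φ (DirectSum.coeAddMonoidHom (fun n : ℕ => M ^ n) a) = 0) : a = 0 := by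
  classical
  have key : φ (DirectSum.coeAddMonoidHom (fun n : ℕ => M ^ n) a) =
      Polynomial.aeval t (∑ n ∈ DFinsupp.support (β := fun n : ℕ => ↥(M ^ n)) a,
        Polynomial.monomial n (ψ (a n : A))) := by
    rw [DirectSum.coeAddMonoidHom_eq_dfinsuppSum, DFinsupp.sum, map_sum, map_sum]
    refine Finset.sum_congr rfl fun n _ => ?_
    rw [map_of_mem_pow hφ n _ (a n).2, Polynomial.aeval_monomial]
  rw [key] at ha
  have h0 := (transcendental_iff.mp ht) _ ha
  ext n
  have h1 := congrArg (fun p => Polynomial.coeff p n) h0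
  simp only [Polynomial.finsetSum_coeff, Polynomial.coeff_monomial, Finset.sum_ite_eq',
    Polynomial.coeff_zero, DFinsupp.mem_support_toFun] at h1
  by_cases hn : a n = 0
  · simp [hn]
  · have h2 : ψ (a n : A) = 0 := by simpa [hn] using h1
    simpa using hψ (h2.trans (map_zero ψ).symm)

lemma pow_iSup_surjective (hM : Algebra.adjoin F (M : Set A) = ⊤) (x : A) :
    ∃ a : ⨁ n : ℕ, ↥(M ^ n), DirectSum.coeAddMonoidHom (fun n : ℕ => M ^ n) a = x := by
  have hx : x ∈ Algebra.adjoin F (M : Set A) := hM ▸ Algebra.mem_top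
  induction hx using Algebra.adjoin_induction with
  | mem x hx =>
    exact ⟨DirectSum.of (fun n : ℕ => ↥(M ^ n)) 1 ⟨x, by simpa using hx⟩, by simp⟩
  | algebraMap r =>
    exact ⟨DirectSum.of (fun n : ℕ => ↥(M ^ n)) 0
      ⟨algebraMap F A r, by simp [Submodule.mem_one]⟩, by simp⟩
  | add x y _ _ hx hy =>
    obtain ⟨a, rfl⟩ := hx
    obtain ⟨b, rfl⟩ := hy
    exact ⟨a + b, map_add _ _ _⟩
  | mul x y _ _ hx hy =>
    obtain ⟨a, rfl⟩ := hx
    obtain ⟨b, rfl⟩ := hy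
    have : SetLike.GradedMonoid (fun n : ℕ => M ^ n) := Submodule.nat_power_gradedMonoid M
    exact ⟨a * b, map_mul (DirectSum.coeAlgHom (fun n : ℕ => M ^ n)) a b⟩

/-- The powers of a generating submodule `M` form a grading as soon as there is an algebra map
to a field which multiplies the elements of `M` by a transcendental element `t`. -/
@[reducible]
noncomputable def powGradedAlgebra (hM : Algebra.adjoin F (M : Set A) = ⊤)
    (hφ : ∀ m ∈ M, φ m = algebraMap K L (ψ m) * t)
    (hψ : Function.Injective ψ) (ht : Transcendental K t) :
    GradedAlgebra (fun n : ℕ => M ^ n) where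
  toGradedMonoid := Submodule.nat_power_gradedMonoid M
  toDecomposition := DirectSum.IsInternal.chooseDecomposition _
    ⟨(injective_iff_map_eq_zero _).mpr fun a ha =>
      eq_zero_of_map_eq_zero hφ hψ ht a (by rw [ha, map_zero]), pow_iSup_surjective hM⟩

lemma map_mem_pow {e : A →ₐ[F] A} (he : ∀ m ∈ M, e m ∈ M) (n : ℕ) (a : A) (ha : a ∈ M ^ n) :
    e a ∈ M ^ n := by
  have h : (M ^ n).map e.toLinearMap ≤ M ^ n := by
    rw [Submodule.map_pow]
    exact pow_le_pow_left' (Submodule.map_le_iff_le_comap.mpr he) n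
  exact h (Submodule.mem_map_of_mem ha)

end PowGrading

/-! ### The rings `S_V`, `K_V` and `R_V` -/

section Rings

variable (F V : Type u) [Field F] [AddCommGroup V] [Module F V]

/-- The symmetric algebra `S_V`. -/
abbrev SymRing : Type u := SymmetricAlgebra F V

/-- The field of quotients `K_V` of `S_V`. -/
def SymField : Type u := FractionRing (SymRing F V)

noncomputable instance : Field (SymField F V) := inferInstanceAs (Field (FractionRing (SymRing F V)))

noncomputable instance : Algebra F (SymField F V) :=
  inferInstanceAs (Algebra F (FractionRing (SymRing F V)))

noncomputable instance : Algebra (SymRing F V) (SymField F V) :=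
  inferInstanceAs (Algebra (SymRing F V) (FractionRing (SymRing F V)))

instance : IsScalarTower F (SymRing F V) (SymField F V) :=
  inferInstanceAs (IsScalarTower F (SymRing F V) (FractionRing (SymRing F V)))

instance : IsFractionRing (SymRing F V) (SymField F V) :=
  inferInstanceAs (IsFractionRing (SymRing F V) (FractionRing (SymRing F V)))

variable {F V} in
/-- The image of a vector `v` in `K_V`. -/
noncomputable def vec (v : V) : SymField F V :=
  algebraMap (SymRing F V) (SymField F V) (SymmetricAlgebra.ι F V v)

/-- The set of all reciprocals `1/v` in `K_V`, for nonzero `v` in `V`. -/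
def recipSet : Set (SymField F V) := {x | ∃ v : V, v ≠ 0 ∧ x = (vec v)⁻¹}

/-- The `F`-subalgebra `R_V` of `K_V` generated by all `1/v` for nonzero `v` in `V`. -/
noncomputable def recipAlg : Subalgebra F (SymField F V) := Algebra.adjoin F (recipSet F V)

/-- The ring `R_V`. -/
abbrev RecipRing : Type u := ↥(recipAlg F V)

/-- The grading on `S_V`: the part of degree `n` is spanned by the products of `n` vectors. -/
noncomputable def symGrading (n : ℕ) : Submodule F (SymRing F V) :=
  LinearMap.range (SymmetricAlgebra.ι F V) ^ n

/-- The grading on `R_V`, with all degrees multiplied by `-1` so that they are nonnegative: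
the part of degree `n` is spanned by the products of `n` reciprocals `1/v`. -/
noncomputable def recipGrading (n : ℕ) : Submodule F (RecipRing F V) :=
  Submodule.span F ((↑) ⁻¹' recipSet F V : Set (RecipRing F V)) ^ n

lemma adjoin_range_ι :
    Algebra.adjoin F (LinearMap.range (SymmetricAlgebra.ι F V) : Set (SymRing F V)) = ⊤ := by
  refine Algebra.eq_top_iff.mpr fun x => ?_
  induction x using SymmetricAlgebra.induction with
  | algebraMap r => exact Subalgebra.algebraMap_mem _ r
  | ι x => exact Algebra.subset_adjoin (LinearMap.mem_range_self _ x)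
  | mul a b ha hb => exact mul_mem ha hb
  | add a b ha hb => exact add_mem ha hb

/-- The map from `S_V` to `K_V(X)` that sends every vector `v` to `v * t`. -/
noncomputable def scaleSym (t : RatFunc (SymField F V)) :
    SymRing F V →ₐ[F] RatFunc (SymField F V) :=
  SymmetricAlgebra.lift
    { toFun := fun v => algebraMap (SymField F V) _ (vec v) * t
      map_add' := fun v w => by simp [vec, add_mul]
      map_smul' := fun c v => by
        simp only [vec, map_smul, RingHom.id_apply, Algebra.smul_def, map_mul, mul_assoc]
        rw [← IsScalarTower.algebraMap_apply, ← IsScalarTower.algebraMap_apply] }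

lemma scaleSym_ι (t : RatFunc (SymField F V)) :
    ∀ m ∈ LinearMap.range (SymmetricAlgebra.ι F V), scaleSym F V t m =
      algebraMap (SymField F V) _ (IsScalarTower.toAlgHom F (SymRing F V) (SymField F V) m) * t := by
  rintro _ ⟨v, rfl⟩
  simp [scaleSym, vec]

lemma injective_toSymField :
    Function.Injective (IsScalarTower.toAlgHom F (SymRing F V) (SymField F V)) :=
  IsFractionRing.injective (SymRing F V) (SymField F V)

noncomputable instance symGradedAlgebra : GradedAlgebra (symGrading F V) :=
  powGradedAlgebra (adjoin_range_ι F V) (scaleSym_ι F V RatFunc.X) (injective_toSymField F V)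
    RatFunc.transcendental_X

lemma transcendental_X_inv : Transcendental (SymField F V) (RatFunc.X : RatFunc (SymField F V))⁻¹ :=
  fun h => RatFunc.transcendental_X (by simpa using h.inv)

lemma scaleSym_injective : Function.Injective (scaleSym F V (RatFunc.X)⁻¹) := by
  refine (injective_iff_map_eq_zero _).mpr fun x hx => ?_
  obtain ⟨a, rfl⟩ := pow_iSup_surjective (adjoin_range_ι F V) x
  rw [eq_zero_of_map_eq_zero (scaleSym_ι F V _) (injective_toSymField F V)
    (transcendental_X_inv F V) a hx, map_zero]

/-- The map from `R_V` to `K_V(X)` that sends every `1/v` to `1/v * X`. -/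
noncomputable def scaleRecip : RecipRing F V →ₐ[F] RatFunc (SymField F V) :=
  (IsFractionRing.liftAlgHom (K := SymField F V) (scaleSym_injective F V)).comp (recipAlg F V).val

lemma scaleRecip_recip :
    ∀ m ∈ Submodule.span F ((↑) ⁻¹' recipSet F V : Set (RecipRing F V)), scaleRecip F V m =
      algebraMap (SymField F V) _ ((recipAlg F V).val m) * RatFunc.X := by
  intro m hm
  induction hm using Submodule.span_induction with
  | mem m hm =>
    obtain ⟨v, -, hv⟩ := hm
    have h := scaleSym_ι F V (RatFunc.X)⁻¹ _ (LinearMap.mem_range_self _ v)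
    simp only [IsScalarTower.coe_toAlgHom'] at h
    simp [scaleRecip, hv, vec, h, mul_comm]
  | zero => simp
  | add x y _ _ hx hy => simp only [map_add, hx, hy, add_mul]
  | smul c x _ hx =>
    simp only [hx, Algebra.smul_def, map_mul, mul_assoc, AlgHom.commutes]
    rw [← IsScalarTower.algebraMap_apply]

lemma adjoin_span_recip : Algebra.adjoin F
    (Submodule.span F ((↑) ⁻¹' recipSet F V : Set (RecipRing F V)) : Set (RecipRing F V)) = ⊤ := by
  rw [Algebra.adjoin_span]
  exact Algebra.adjoin_adjoin_coe_preimage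

noncomputable instance recipGradedAlgebra : GradedAlgebra (recipGrading F V) :=
  powGradedAlgebra (adjoin_span_recip F V) (scaleRecip_recip F V) Subtype.val_injective
    RatFunc.transcendental_X

end Rings

/-! ### The functorial actions of `Aut(V)` -/

section Actions

variable {F V : Type u} [Field F] [AddCommGroup V] [Module F V]

/-- The `F`-algebra automorphism of `S_V` extending an automorphism of `V`. -/
noncomputable def symEquiv (g : V ≃ₗ[F] V) : SymRing F V ≃ₐ[F] SymRing F V :=
  AlgEquiv.ofAlgHom
    (SymmetricAlgebra.lift (SymmetricAlgebra.ι F V ∘ₗ g.toLinearMap))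
    (SymmetricAlgebra.lift (SymmetricAlgebra.ι F V ∘ₗ g.symm.toLinearMap))
    (by ext v; simp) (by ext v; simp)

lemma symEquiv_ι (g : V ≃ₗ[F] V) (v : V) :
    symEquiv g (SymmetricAlgebra.ι F V v) = SymmetricAlgebra.ι F V (g v) := by
  simp [symEquiv]

/-- The induced automorphism of `K_V`. -/
noncomputable def fieldEquiv (g : V ≃ₗ[F] V) : SymField F V ≃ₐ[F] SymField F V :=
  IsFractionRing.algEquivOfAlgEquiv (symEquiv g)

lemma fieldEquiv_inv_vec (g : V ≃ₗ[F] V) (v : V) : fieldEquiv g (vec v)⁻¹ = (vec (g v))⁻¹ := by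
  simp [fieldEquiv, vec, symEquiv_ι]

lemma fieldEquiv_mem_recipSet (g : V ≃ₗ[F] V) {x : SymField F V} (hx : x ∈ recipSet F V) :
    fieldEquiv g x ∈ recipSet F V := by
  obtain ⟨v, hv, rfl⟩ := hx
  exact ⟨g v, by simpa using hv, fieldEquiv_inv_vec g v⟩

lemma fieldEquiv_mem (g : V ≃ₗ[F] V) (x : RecipRing F V) :
    fieldEquiv g (x : SymField F V) ∈ recipAlg F V := by
  have h : recipAlg F V ≤ (recipAlg F V).comap (fieldEquiv g).toAlgHom :=
    Algebra.adjoin_le fun y hy => Algebra.subset_adjoin (fieldEquiv_mem_recipSet g hy)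
  exact h x.2

lemma fieldEquiv_symm (g : V ≃ₗ[F] V) : (fieldEquiv g).symm = fieldEquiv g.symm := rfl

/-- The automorphism of `R_V` induced by an automorphism `g` of `V`, sending `1/v` to
`1/g(v)`. -/
noncomputable def recipEquiv (g : V ≃ₗ[F] V) : RecipRing F V ≃ₐ[F] RecipRing F V :=
  AlgEquiv.ofAlgHom
    (((fieldEquiv g).toAlgHom.comp (recipAlg F V).val).codRestrict _ (fieldEquiv_mem g))
    (((fieldEquiv g.symm).toAlgHom.comp (recipAlg F V).val).codRestrict _ (fieldEquiv_mem g.symm))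
    (by ext x; exact (fieldEquiv g).apply_symm_apply x)
    (by ext x; exact (fieldEquiv g).symm_apply_apply x)

lemma recipEquiv_coe (g : V ≃ₗ[F] V) (x : RecipRing F V) :
    (recipEquiv g x : SymField F V) = fieldEquiv g x := rfl

lemma symEquiv_mem (g : V ≃ₗ[F] V) (n : ℕ) (a : SymRing F V) (ha : a ∈ symGrading F V n) :
    symEquiv g a ∈ symGrading F V n := by
  refine map_mem_pow (e := (symEquiv g).toAlgHom) ?_ n a ha
  rintro _ ⟨v, rfl⟩
  exact ⟨g v, (symEquiv_ι g v).symm⟩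

lemma recipEquiv_mem (g : V ≃ₗ[F] V) (n : ℕ) (a : RecipRing F V) (ha : a ∈ recipGrading F V n) :
    recipEquiv g a ∈ recipGrading F V n := by
  refine map_mem_pow (e := (recipEquiv g).toAlgHom) (fun m hm => ?_) n a ha
  induction hm using Submodule.span_induction with
  | mem m hm =>
    refine Submodule.subset_span ?_
    have h := fieldEquiv_mem_recipSet g hm
    rwa [← recipEquiv_coe] at h
  | zero => rw [map_zero]; exact zero_mem _
  | add x y _ _ hx hy => rw [map_add]; exact add_mem hx hy
  | smul c x _ hx => rw [map_smul]; exact Submodule.smul_mem _ c hx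

end Actions

/-! ### Projective schemes over a field -/

section ProjSchemes

variable {F A : Type u} [Field F] [CommRing A] [Algebra F A]

/-- The structure morphism from `Proj` of a graded `F`-algebra to `Spec F`. -/
noncomputable def projToSpec (𝒜 : ℕ → Submodule F A) [GradedAlgebra 𝒜] :
    Proj 𝒜 ⟶ Spec (CommRingCat.of F) :=
  Proj.toSpecZero 𝒜 ≫ Spec.map (CommRingCat.ofHom (algebraMap F (𝒜 0)))

/-- A degree-preserving automorphism of a graded algebra maps the irrelevant ideal onto itself. -/
lemma irrelevant_le_map_of_equiv (𝒜 : ℕ → Submodule F A) [GradedAlgebra 𝒜] (e : A ≃ₐ[F] A)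
    (f : GradedRingHom 𝒜 𝒜) (hf : ∀ a, f a = e a)
    (he' : ∀ (n : ℕ) (a : A), a ∈ 𝒜 n → e.symm a ∈ 𝒜 n) :
    HomogeneousIdeal.irrelevant 𝒜 ≤ (HomogeneousIdeal.irrelevant 𝒜).map f := by
  refine (HomogeneousIdeal.irrelevant_le (𝒜 := 𝒜)).mpr fun i hi x hx => ?_
  have h := Ideal.mem_map_of_mem f
    (HomogeneousIdeal.mem_irrelevant_of_mem 𝒜 hi (he' i x hx) :
      e.symm x ∈ (HomogeneousIdeal.irrelevant 𝒜).toIdeal)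
  rw [hf, e.apply_symm_apply] at h
  exact h

/-- The morphism `Proj A ⟶ Proj A` induced by a degree-preserving automorphism of `A`. -/
noncomputable def projOfEquiv (𝒜 : ℕ → Submodule F A) [GradedAlgebra 𝒜] (e : A ≃ₐ[F] A)
    (he : ∀ (n : ℕ) (a : A), a ∈ 𝒜 n → e a ∈ 𝒜 n)
    (he' : ∀ (n : ℕ) (a : A), a ∈ 𝒜 n → e.symm a ∈ 𝒜 n) : Proj 𝒜 ⟶ Proj 𝒜 :=
  Proj.map (𝒜 := 𝒜) (ℬ := 𝒜) { (e : A →+* A) with map_mem := fun {n a} h => he n a h }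
    (irrelevant_le_map_of_equiv 𝒜 e _ (fun _ => rfl) he')

end ProjSchemes

section Varieties

variable (F V : Type u) [Field F] [AddCommGroup V] [Module F V]

/-- The variety `P_V`. -/
noncomputable abbrev PVar : Scheme.{u} := Proj (symGrading F V)

/-- The variety `Q_V`. -/
noncomputable abbrev QVar : Scheme.{u} := Proj (recipGrading F V)

variable {F V}

/-- The automorphism of `P_V` induced by an automorphism of `V`. -/
noncomputable def PVarAct (g : V ≃ₗ[F] V) : PVar F V ⟶ PVar F V :=
  projOfEquiv (symGrading F V) (symEquiv g) (symEquiv_mem g) (symEquiv_mem g.symm)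

/-- The automorphism of `Q_V` induced by an automorphism of `V`. -/
noncomputable def QVarAct (g : V ≃ₗ[F] V) : QVar F V ⟶ QVar F V :=
  projOfEquiv (recipGrading F V) (recipEquiv g) (recipEquiv_mem g) (recipEquiv_mem g.symm)

end Varieties

/-- Let `a : G → End(X)` be a group acting on a scheme `X`, and `H` a subgroup of `G`. The morphism
`π : X ⟶ Y` exhibits `Y` as the quotient `X/H` if it is `H`-invariant, if the underlying
topological space of `Y` is the set of `H`-orbits in `X` with the quotient topology, and if the
functions on an open `W` in `Y` are precisely the `H`-invariant functions on its preimage. -/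
structure IsQuotientBy {G : Type u} [Group G] {X Y : Scheme.{u}} (a : G → (X ⟶ X)) (H : Subgroup G)
    (π : X ⟶ Y) : Prop where
  invariant : ∀ g ∈ H, a g ≫ π = π
  isQuotientMap : Topology.IsQuotientMap π
  exists_of_eq : ∀ x y : X, π x = π y → ∃ g ∈ H, a g x = y
  app_injective : ∀ W : Y.Opens, Function.Injective (π.app W)
  exists_app_eq : ∀ (W : Y.Opens) (s : Γ(X, π ⁻¹ᵁ W)),
    (∀ (g : G) (hg : g ∈ H), (a g).appLE (π ⁻¹ᵁ W) (π ⁻¹ᵁ W)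
      (by rw [← Scheme.Hom.comp_preimage, invariant g hg]) s = s) →
    ∃ t : Γ(Y, W), π.app W t = s

/-- A subgroup of `Aut(V)` is unipotent if all its elements are unipotent. -/
def IsUnipotentSubgroup {F V : Type u} [Field F] [AddCommGroup V] [Module F V]
    (H : Subgroup (V ≃ₗ[F] V)) : Prop :=
  ∀ g ∈ H, IsNilpotent (g.toLinearMap - LinearMap.id : Module.End F V)

/-- The subgroup of automorphisms of `V` of determinant `1`. -/
noncomputable def detOneSubgroup (F V : Type u) [Field F] [AddCommGroup V] [Module F V] :
    Subgroup (V ≃ₗ[F] V) :=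
  (LinearEquiv.det : (V ≃ₗ[F] V) →* Fˣ).ker

noncomputable instance weightedPolyGraded (F : Type u) [Field F] {r : ℕ} (w : Fin r → ℕ) :
    GradedAlgebra (MvPolynomial.weightedHomogeneousSubmodule F w) :=
  MvPolynomial.weightedGradedAlgebra F w

/-- The weighted projective space over `F` of weights `w 0, …, w (r - 1)`, all of which are
assumed to be positive when this is used. -/
noncomputable abbrev WeightedProj (F : Type u) [Field F] {r : ℕ} (w : Fin r → ℕ) : Scheme.{u} :=
  Proj (MvPolynomial.weightedHomogeneousSubmodule F w)

noncomputable instance polyGraded (F : Type u) [Field F] (r : ℕ) :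
    GradedAlgebra (MvPolynomial.homogeneousSubmodule (Fin r) F) :=
  MvPolynomial.gradedAlgebra

/-- The projective space of dimension `r - 1` over `F`, with homogeneous coordinates indexed
by `Fin r`. -/
noncomputable abbrev ProjSpace (F : Type u) [Field F] (r : ℕ) : Scheme.{u} :=
  Proj (MvPolynomial.homogeneousSubmodule (Fin r) F)

/-!
All six quotients are computed by one principle. Let a finite group `H` act on a graded domain `A`,
with field of fractions `K`, and let `y` be homogeneous `H`-invariant elements of `A`, as many as
the transcendence degree of `K`. If `A` is integral over the subring generated by `y`, then `y` is
algebraically independent, so this subring is a polynomial ring and integrally closed. If moreover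
`y` generates the field of invariants of `H` in `K`, then every invariant in `A` is integral over
the subring and in its field of fractions, hence the ring of invariants is the polynomial ring in
`y` (`GeneratesInvariants.isInvariantRing`). Finally `Proj` of the ring of invariants is the
quotient of `Proj A` by `H` (`ProjQuotient.isQuotientBy`): integrality gives a closed surjective
map, `H` acts transitively on the primes over a given prime, and taking invariants commutes with
homogeneous localization at an invariant element.

For the general linear group, `y` consists of the Dickson invariants, the nontrivial coefficients
of the polynomial whose roots are all `v` in `V`; this polynomial is `q`-additive, as its product
with the Moore determinant of a basis is the expansion of a larger Moore determinant. For `R_V`,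
one takes the polynomial whose roots are all `1/v`, with `v ≠ 0`, and which has the reversed
coefficients. The field `K_V` is a splitting field of these polynomials over the field generated by
`y`, and its Galois group acts on the roots by linear automorphisms of `V`
(`Moore.mem_of_forall_fixed`). For the special linear group, the invariant which is the product of
all nonzero vectors (or of their reciprocals) is replaced by its `(q - 1)`-st root up to sign, the
Moore determinant (or its inverse). An automorphism of `V` multiplies it by its determinant.

A maximal unipotent subgroup is the unitriangular group of a basis `b`
(`Flag.exists_eq_unitriangular`), because a `p`-group acting linearly on a nonzero space over `F`
fixes a nonzero vector. The invariants are the products of all `w`, respectively the sums of all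
`1/w`, where `w` runs through the coset of `b i` modulo the span of the previous basis vectors. An
explicit spanning family of `A` over these invariants has as many elements as the group. For `R_V`,
it is found with the relation `1/v * 1/w = 1/(v - w) * (1/w - 1/v)`. Comparing both numbers with the
degree of the field extension shows that `y` generates the field of invariants, and that the family
is a basis (`linearIndependent_and_mem_of_card_le`). As this basis is homogeneous and the invariants
in `R_V` have degree one, it yields bases of the charts of `Q_V` over those of projective space, so
that the quotient map is finite and flat, of degree the number of basis elements
(`ProjQuotient.isFinite_flat_finrank`).
-/

/-! ### Functoriality of `Proj` -/

namespace ProjFunctor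

open HomogeneousLocalization

variable {F A B : Type u} [Field F] [CommRing A] [Algebra F A] [CommRing B] [Algebra F B]
  {𝒜 : ℕ → Submodule F A} {ℬ : ℕ → Submodule F B}

lemma apply_mem (f : ℬ →+*ᵍ 𝒜) {i : ℕ} {s : B} (hs : s ∈ ℬ i) : f s ∈ 𝒜 i := f.2 hs

variable [GradedAlgebra 𝒜] [GradedAlgebra ℬ]

/-- The condition under which a graded homomorphism `f` induces a morphism defined on all of
`Proj`: every point lies in a basic open set `D₊(f s)` for a homogeneous `s` of positive degree. -/
def PreservesRelevant (f : ℬ →+*ᵍ 𝒜) : Prop :=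
  ∀ x : Proj 𝒜, ∃ s : Σ i : ℕ+, ℬ i, x ∈ Proj.basicOpen 𝒜 (f s.2)

variable (f : ℬ →+*ᵍ 𝒜)

/-- The chart `D₊(f s)` of `Proj 𝒜`. -/
noncomputable def chart (s : Σ i : ℕ+, ℬ i) :
    Spec (CommRingCat.of (Away 𝒜 (f (s.2 : B)))) ⟶ Proj 𝒜 :=
  Proj.awayι 𝒜 (f s.2) (apply_mem f s.2.2) s.1.pos

instance (s : Σ i : ℕ+, ℬ i) : IsOpenImmersion (chart f s) :=
  inferInstanceAs (IsOpenImmersion (Proj.awayι 𝒜 (f s.2) (apply_mem f s.2.2) s.1.pos))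

/-- The open cover of `Proj 𝒜` by the basic open sets `D₊(f s)`. -/
noncomputable def cover (hf : PreservesRelevant f) : (Proj 𝒜).OpenCover where
  I₀ := Σ i : ℕ+, ℬ i
  X s := Spec (CommRingCat.of (Away 𝒜 (f (s.2 : B))))
  f s := chart f s
  mem₀ := by
    rw [Scheme.presieve₀_mem_precoverage_iff]
    refine ⟨fun x => ?_, fun s => inferInstanceAs (IsOpenImmersion (chart f s))⟩
    obtain ⟨s, hs⟩ := hf x
    rw [← Proj.opensRange_awayι 𝒜 (f s.2) (apply_mem f s.2.2) s.1.pos] at hs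
    exact ⟨s, hs⟩

lemma away_map_comp_awayMap {i j : ℕ} {s t u : B} (hs : s ∈ ℬ i) (ht : t ∈ ℬ j) (hu : u = s * t)
    (hu' : f u = f s * f t) :
    (Away.map f u).comp (awayMap ℬ ht hu) =
      (awayMap 𝒜 (apply_mem f ht) hu').comp (Away.map f s) := by
  subst hu
  ext x
  obtain ⟨n, a, ha, rfl⟩ := x.mk_surjective _ hs
  simp only [RingHom.comp_apply, Away.map_mk]
  rw [awayMap_mk, awayMap_mk, Away.map_mk]
  simp [Away.val_mk]

/-- On an overlap `D₊(f (s * t))`, the chart map of `s` is the chart map of `s * t`. -/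
lemma specMap_awayMap_comp {i j k : ℕ} {s t u : B} (hs : s ∈ ℬ i) (hi : 0 < i) (ht : t ∈ ℬ j)
    (hu : u = s * t) (hu' : f u = f s * f t) (hk : k = i + j) (hu'' : u ∈ ℬ k) (hk' : 0 < k) :
    Spec.map (CommRingCat.ofHom (awayMap 𝒜 (apply_mem f ht) hu')) ≫
      Spec.map (CommRingCat.ofHom (Away.map f s)) ≫ Proj.awayι ℬ s hs hi =
    Spec.map (CommRingCat.ofHom (Away.map f u)) ≫ Proj.awayι ℬ u hu'' hk' := by
  subst hk
  rw [← Proj.SpecMap_awayMap_awayι ℬ hs hi ht hu, ← Category.assoc, ← Category.assoc,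
    ← Spec.map_comp, ← Spec.map_comp, ← CommRingCat.ofHom_comp, ← CommRingCat.ofHom_comp,
    away_map_comp_awayMap f hs ht hu hu']

lemma glue_condition {i j : ℕ} {s t : B} (hs : s ∈ ℬ i) (hi : 0 < i) (ht : t ∈ ℬ j) (hj : 0 < j) :
    Limits.pullback.fst (Proj.awayι 𝒜 (f s) (apply_mem f hs) hi)
          (Proj.awayι 𝒜 (f t) (apply_mem f ht) hj) ≫
        Spec.map (CommRingCat.ofHom (Away.map f s)) ≫ Proj.awayι ℬ s hs hi =
      Limits.pullback.snd (Proj.awayι 𝒜 (f s) (apply_mem f hs) hi)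
          (Proj.awayι 𝒜 (f t) (apply_mem f ht) hj) ≫
        Spec.map (CommRingCat.ofHom (Away.map f t)) ≫ Proj.awayι ℬ t ht hj := by
  rw [← Proj.pullbackAwayιIso_hom_SpecMap_awayMap_left 𝒜 (apply_mem f hs) hi (apply_mem f ht) hj
      (map_mul f s t),
    ← Proj.pullbackAwayιIso_hom_SpecMap_awayMap_right 𝒜 (apply_mem f hs) hi (apply_mem f ht) hj
      (map_mul f s t),
    Category.assoc, Category.assoc,
    specMap_awayMap_comp f hs hi ht rfl (map_mul f s t) rfl (SetLike.mul_mem_graded hs ht)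
      (hi.trans_le (i.le_add_right j)),
    specMap_awayMap_comp f ht hj hs (mul_comm s t) ((map_mul f s t).trans (mul_comm _ _))
      (add_comm i j) (SetLike.mul_mem_graded hs ht) (hi.trans_le (i.le_add_right j))]

/-- The restriction of the morphism `Proj 𝒜 ⟶ Proj ℬ` to the chart `D₊(f s)`. -/
noncomputable def chartMap (s : Σ i : ℕ+, ℬ i) :
    Spec (CommRingCat.of (Away 𝒜 (f (s.2 : B)))) ⟶ Proj ℬ :=
  Spec.map (CommRingCat.ofHom (Away.map f (s.2 : B))) ≫ Proj.awayι ℬ (s.2 : B) s.2.2 s.1.pos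

lemma chart_glue (s t : Σ i : ℕ+, ℬ i) :
    Limits.pullback.fst (chart f s) (chart f t) ≫ chartMap f s =
      Limits.pullback.snd (chart f s) (chart f t) ≫ chartMap f t :=
  glue_condition f s.2.2 s.1.pos t.2.2 t.1.pos

variable (hf : PreservesRelevant f)

/-- The morphism `Proj 𝒜 ⟶ Proj ℬ` induced by a graded homomorphism `f`. In contrast to
`Proj.map`, it is only required that the sets `D₊(f s)` cover `Proj 𝒜`. -/
noncomputable def projMap : Proj 𝒜 ⟶ Proj ℬ :=
  (cover f hf).glueMorphisms (chartMap f) (chart_glue f)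

lemma awayι_comp_map {i : ℕ} (hi : 0 < i) {s : B} (hs : s ∈ ℬ i) :
    Proj.awayι 𝒜 (f s) (apply_mem f hs) hi ≫ projMap f hf =
      Spec.map (CommRingCat.ofHom (Away.map f s)) ≫ Proj.awayι ℬ s hs hi :=
  (cover f hf).ι_glueMorphisms (chartMap f) (chart_glue f) (⟨⟨i, hi⟩, s, hs⟩ : Σ i : ℕ+, ℬ i)

lemma away_map_isLocalizationElem {i j : ℕ} {s t : B} (hs : s ∈ ℬ i) (ht : t ∈ ℬ j) :
    Away.map f s (Away.isLocalizationElem hs ht) =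
      Away.isLocalizationElem (apply_mem f hs) (apply_mem f ht) := by
  rw [Away.isLocalizationElem, Away.isLocalizationElem, Away.map_mk]
  ext
  simp [Away.val_mk]

/-- The preimage of `D₊(t)` is `D₊(f t)`, also for those `t` that are not used in the cover. -/
lemma map_preimage_basicOpen {j : ℕ} {t : B} (ht : t ∈ ℬ j) (hj : 0 < j) :
    projMap f hf ⁻¹ᵁ Proj.basicOpen ℬ t = Proj.basicOpen 𝒜 (f t) := by
  ext x
  obtain ⟨s, hs⟩ := hf x
  have hs' := hs
  rw [← Proj.opensRange_awayι 𝒜 (f s.2) (apply_mem f s.2.2) s.1.pos] at hs'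
  obtain ⟨y, rfl⟩ := hs'
  have h1 := Proj.awayι_preimage_basicOpen 𝒜 (apply_mem f s.2.2) s.1.pos (apply_mem f ht) hj
  have h2 := Proj.awayι_preimage_basicOpen ℬ s.2.2 s.1.pos ht hj
  have h3 : Proj.awayι 𝒜 (f s.2) (apply_mem f s.2.2) s.1.pos ⁻¹ᵁ projMap f hf ⁻¹ᵁ
      Proj.basicOpen ℬ t = Proj.awayι 𝒜 (f s.2) (apply_mem f s.2.2) s.1.pos ⁻¹ᵁ
        Proj.basicOpen 𝒜 (f t) := by
    rw [h1, ← Scheme.Hom.comp_preimage, awayι_comp_map f hf s.1.pos s.2.2,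
      Scheme.Hom.comp_preimage, h2,
      ← away_map_isLocalizationElem f s.2.2 ht]
    rfl
  exact iff_of_eq (congrArg (fun U => y ∈ U) h3)

lemma mem_map_iff {j : ℕ} {t : B} (ht : t ∈ ℬ j) (x : Proj 𝒜) :
    t ∈ (projMap f hf x).asHomogeneousIdeal ↔ f t ∈ x.asHomogeneousIdeal := by
  have key {j : ℕ} {t : B} (ht : t ∈ ℬ j) (hj : 0 < j) :
      t ∈ (projMap f hf x).asHomogeneousIdeal ↔ f t ∈ x.asHomogeneousIdeal := by
    have h : x ∈ projMap f hf ⁻¹ᵁ Proj.basicOpen ℬ t ↔ x ∈ Proj.basicOpen 𝒜 (f t) := by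
      rw [map_preimage_basicOpen f hf ht hj]
    exact not_iff_not.mp h
  -- In degree zero multiply with an element of positive degree that does not vanish at the point.
  obtain ⟨s, hs⟩ := hf x
  have hs0 := not_iff_not.mpr (key s.2.2 s.1.pos)
  have hs1 := hs0.mpr hs
  have h := key (SetLike.mul_mem_graded s.2.2 ht) (s.1.pos.trans_le (Nat.le_add_right _ _))
  rw [map_mul] at h
  have p1 := (projMap f hf x).isPrime.mul_mem_iff_mem_or_mem (x := s.2.1) (y := t)
  have p2 := x.isPrime.mul_mem_iff_mem_or_mem (x := f s.2.1) (y := f t)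
  exact ((p1.trans (or_iff_right hs1)).symm.trans h).trans (p2.trans (or_iff_right hs))

/-- On points, the induced morphism is the contraction of homogeneous primes. -/
lemma asHomogeneousIdeal_map (x : Proj 𝒜) :
    (projMap f hf x).asHomogeneousIdeal = x.asHomogeneousIdeal.comap f := by
  refine HomogeneousIdeal.ext (Ideal.ext fun b => ?_)
  refine ((projMap f hf x).asHomogeneousIdeal.isHomogeneous.mem_iff).trans
    (Iff.trans ?_ (x.asHomogeneousIdeal.comap f).isHomogeneous.mem_iff.symm)
  exact forall_congr' fun i => mem_map_iff f hf (SetLike.coe_mem _) x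

end ProjFunctor

/-! ### Sections over an affine chart of a quotient -/

section Chart

variable {R S : Type u} [CommRing R] [CommRing S] {φ : R →+* S} {X Y : Scheme.{u}} {π : X ⟶ Y}
  {j : Spec (.of R) ⟶ Y} {c : Spec (.of S) ⟶ X}

lemma appLE_bijective_of_isOpenImmersion {U Y : Scheme.{u}} (j : U ⟶ Y) [IsOpenImmersion j]
    {W : Y.Opens} (hW : W = j.opensRange) (h : ⊤ ≤ j ⁻¹ᵁ W) :
    Function.Bijective (j.appLE W ⊤ h) := by
  have h1 : IsIso (j.app W) := j.isIso_app W hW.le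
  have h2 : j ⁻¹ᵁ W = ⊤ := top_le_iff.mp h
  have h3 : IsIso (j.appLE W ⊤ h) := by
    rw [Scheme.Hom.appLE]
    have : IsIso (U.presheaf.map (homOfLE h).op) := by
      have : IsIso (homOfLE h) := ⟨homOfLE h2.le, Subsingleton.elim _ _, Subsingleton.elim _ _⟩
      infer_instance
    infer_instance
  exact ConcreteCategory.bijective_of_isIso _

/-- A commutative square of schemes, on global sections of its source. -/
lemma appLE_comp_appLE_of_square {U V X Y : Scheme.{u}} {c : U ⟶ X} {π : X ⟶ Y} {m : U ⟶ V}
    {j : V ⟶ Y} (hw : c ≫ π = m ≫ j) {W : Y.Opens} {W' : X.Opens} (h : W' ≤ π ⁻¹ᵁ W)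
    (hW : ⊤ ≤ j ⁻¹ᵁ W) (hW' : ⊤ ≤ c ⁻¹ᵁ W') :
    π.appLE W W' h ≫ c.appLE W' ⊤ hW' = j.appLE W ⊤ hW ≫ m.appTop := by
  have key {x y : U ⟶ Y} (hxy : x = y) (hx : ⊤ ≤ x ⁻¹ᵁ W) (hy : ⊤ ≤ y ⁻¹ᵁ W) :
      x.appLE W ⊤ hx = y.appLE W ⊤ hy := by subst hxy; rfl
  have hm : m.appTop = m.appLE ⊤ ⊤ le_top := Scheme.Hom.app_eq_appLE m
  rw [hm]
  exact (Scheme.Hom.appLE_comp_appLE _ _ _ _ _ _ _).trans ((key hw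
    (hW'.trans (c.preimage_mono h)) (hw ▸ hW'.trans (c.preimage_mono h))).trans
    (Scheme.Hom.appLE_comp_appLE _ _ _ _ _ _ _).symm)

/-- In charts `Spec S` of `X` and `Spec R` of `Y`, the pullback of functions along `π` is `φ`. -/
lemma chart_square (hw : c ≫ π = Spec.map (CommRingCat.ofHom φ) ≫ j)
    {W : Y.Opens} (hW : ⊤ ≤ j ⁻¹ᵁ W) (hW' : ⊤ ≤ c ⁻¹ᵁ π ⁻¹ᵁ W) (t : Γ(Y, W)) :
    (Scheme.ΓSpecIso _).hom (c.appLE (π ⁻¹ᵁ W) ⊤ hW' (π.app W t)) =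
      φ ((Scheme.ΓSpecIso _).hom (j.appLE W ⊤ hW t)) := by
  have h1 : π.app W ≫ c.appLE (π ⁻¹ᵁ W) ⊤ hW' =
      j.appLE W ⊤ hW ≫ (Spec.map (CommRingCat.ofHom φ)).appTop := by
    rw [Scheme.Hom.app_eq_appLE]
    exact appLE_comp_appLE_of_square hw le_rfl hW hW'
  have h2 := Scheme.ΓSpecIso_naturality (CommRingCat.ofHom φ)
  have h3 : π.app W ≫ c.appLE (π ⁻¹ᵁ W) ⊤ hW' ≫ (Scheme.ΓSpecIso (.of S)).hom =
      j.appLE W ⊤ hW ≫ (Scheme.ΓSpecIso (.of R)).hom ≫ CommRingCat.ofHom φ := by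
    rw [← h2, ← Category.assoc, h1, Category.assoc]
  exact congrArg (fun m => m.hom t) h3

variable [IsOpenImmersion j] [IsOpenImmersion c]

lemma app_injective_of_chart (hw : c ≫ π = Spec.map (CommRingCat.ofHom φ) ≫ j)
    (hφ : Function.Injective φ) {W : Y.Opens} (hj : W = j.opensRange)
    (hc : π ⁻¹ᵁ W = c.opensRange) : Function.Injective (π.app W) := by
  have hW : ⊤ ≤ j ⁻¹ᵁ W := by rw [hj]; simp
  have hW' : ⊤ ≤ c ⁻¹ᵁ π ⁻¹ᵁ W := by rw [hc]; simp
  intro t t' h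
  refine (appLE_bijective_of_isOpenImmersion j hj hW).1 ?_
  refine (ConcreteCategory.bijective_of_isIso (Scheme.ΓSpecIso (.of R)).hom).1 (hφ ?_)
  exact (chart_square hw hW hW' t).symm.trans
    ((congrArg _ (congrArg _ h)).trans (chart_square hw hW hW' t'))

/-- If the endomorphisms `a i` of `X` are given by `e i` in a chart `Spec S`, and the image of
`φ : R → S` contains all common fixed points of the `e i`, then functions fixed by the `a i` come
from `Y`. -/
lemma exists_app_eq_of_chart (hw : c ≫ π = Spec.map (CommRingCat.ofHom φ) ≫ j)
    {W : Y.Opens} (hj : W = j.opensRange) (hc : π ⁻¹ᵁ W = c.opensRange)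
    {ι : Type*} (a : ι → (X ⟶ X)) (e : ι → S →+* S)
    (ha : ∀ i, c ≫ a i = Spec.map (CommRingCat.ofHom (e i)) ≫ c)
    (hφ : ∀ x, (∀ i, e i x = x) → ∃ y, φ y = x)
    (h : ∀ i, π ⁻¹ᵁ W ≤ a i ⁻¹ᵁ π ⁻¹ᵁ W) (s : Γ(X, π ⁻¹ᵁ W))
    (hs : ∀ i, (a i).appLE (π ⁻¹ᵁ W) (π ⁻¹ᵁ W) (h i) s = s) : ∃ t, π.app W t = s := by
  have hW : ⊤ ≤ j ⁻¹ᵁ W := by rw [hj]; simp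
  have hW' : ⊤ ≤ c ⁻¹ᵁ π ⁻¹ᵁ W := by rw [hc]; simp
  obtain ⟨y, hy⟩ := hφ ((Scheme.ΓSpecIso (.of S)).hom (c.appLE (π ⁻¹ᵁ W) ⊤ hW' s)) fun i => by
    have h1 : (a i).appLE (π ⁻¹ᵁ W) (π ⁻¹ᵁ W) (h i) ≫ c.appLE (π ⁻¹ᵁ W) ⊤ hW' =
        c.appLE (π ⁻¹ᵁ W) ⊤ hW' ≫ (Spec.map (CommRingCat.ofHom (e i))).appTop :=
      appLE_comp_appLE_of_square (ha i) (h i) hW' hW'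
    have h2 := Scheme.ΓSpecIso_naturality (CommRingCat.ofHom (e i))
    have h3 : (a i).appLE (π ⁻¹ᵁ W) (π ⁻¹ᵁ W) (h i) ≫ c.appLE (π ⁻¹ᵁ W) ⊤ hW' ≫
        (Scheme.ΓSpecIso (.of S)).hom =
        c.appLE (π ⁻¹ᵁ W) ⊤ hW' ≫ (Scheme.ΓSpecIso (.of S)).hom ≫ CommRingCat.ofHom (e i) := by
      rw [← h2, ← Category.assoc, h1, Category.assoc]
    have h4 := congrArg (fun m => m.hom s) h3
    refine Eq.trans h4.symm ?_
    exact congrArg (fun z => (Scheme.ΓSpecIso (.of S)).hom (c.appLE (π ⁻¹ᵁ W) ⊤ hW' z)) (hs i)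
  obtain ⟨y', rfl⟩ := (ConcreteCategory.bijective_of_isIso (Scheme.ΓSpecIso (.of R)).hom).2 y
  obtain ⟨t, rfl⟩ := (appLE_bijective_of_isOpenImmersion j hj hW).2 y'
  refine ⟨t, (appLE_bijective_of_isOpenImmersion c hc hW').1 ?_⟩
  refine (ConcreteCategory.bijective_of_isIso (Scheme.ΓSpecIso (.of S)).hom).1 ?_
  exact (chart_square hw hW hW' t).trans hy

end Chart

/-! ### Sections over arbitrary open sets of a quotient -/

section Gluing

variable {X Y : Scheme.{u}} {π : X ⟶ Y}

/-- Injectivity of the pullback of functions can be checked on a basis `D` of the topology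
of `Y`. -/
lemma app_injective_of_basis {ι : Type u} (D : ι → Y.Opens)
    (hD : ∀ (W : Y.Opens) (y : Y), y ∈ W → ∃ i, y ∈ D i ∧ D i ≤ W)
    (hinj : ∀ i, Function.Injective (π.app (D i))) (W : Y.Opens) :
    Function.Injective (π.app W) := by
  intro t t' h
  refine TopCat.Sheaf.eq_of_locally_eq' Y.sheaf (fun i : {i // D i ≤ W} => D i.1) W
    (fun i => homOfLE i.2) ?_ t t' ?_
  · intro y hy
    obtain ⟨i, hi, hi'⟩ := hD W y hy
    exact TopologicalSpace.Opens.mem_iSup.mpr ⟨⟨i, hi'⟩, hi⟩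
  · intro i
    refine hinj i.1 ?_
    have h1 (t : Γ(Y, W)) := congrArg (fun m => m.hom t) (π.naturality (homOfLE i.2).op)
    exact (h1 t).trans ((congrArg _ h).trans (h1 t').symm)

/-- Descent of invariant functions can be checked on a basis `D` of the topology of `Y`: the local
functions on `Y` are unique, so they glue. -/
lemma exists_app_eq_of_basis {ι κ : Type u} (D : ι → Y.Opens)
    (hD : ∀ (W : Y.Opens) (y : Y), y ∈ W → ∃ i, y ∈ D i ∧ D i ≤ W)
    (hinj : ∀ i, Function.Injective (π.app (D i))) (a : κ → (X ⟶ X))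
    (h : ∀ k (W : Y.Opens), π ⁻¹ᵁ W ≤ a k ⁻¹ᵁ π ⁻¹ᵁ W)
    (hex : ∀ i (s : Γ(X, π ⁻¹ᵁ D i)),
      (∀ k, (a k).appLE (π ⁻¹ᵁ D i) (π ⁻¹ᵁ D i) (h k _) s = s) → ∃ t, π.app (D i) t = s)
    (W : Y.Opens) (s : Γ(X, π ⁻¹ᵁ W))
    (hs : ∀ k, (a k).appLE (π ⁻¹ᵁ W) (π ⁻¹ᵁ W) (h k _) s = s) : ∃ t, π.app W t = s := by
  have hres {V : Y.Opens} (hV : V ≤ W) (k : κ) :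
      (a k).appLE (π ⁻¹ᵁ V) (π ⁻¹ᵁ V) (h k _)
        (X.presheaf.map (homOfLE (π.preimage_mono hV)).op s) =
      X.presheaf.map (homOfLE (π.preimage_mono hV)).op s := by
    have h1 : X.presheaf.map (homOfLE (π.preimage_mono hV)).op ≫
        (a k).appLE (π ⁻¹ᵁ V) (π ⁻¹ᵁ V) (h k _) =
        (a k).appLE (π ⁻¹ᵁ W) (π ⁻¹ᵁ W) (h k _) ≫
          X.presheaf.map (homOfLE (π.preimage_mono hV)).op := by
      rw [Scheme.Hom.map_appLE, Scheme.Hom.appLE_map]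
    have h2 := congrArg (fun m => m.hom s) h1
    exact h2.trans (congrArg (X.presheaf.map (homOfLE (π.preimage_mono hV)).op) (hs k))
  choose t ht using fun i : {i // D i ≤ W} => hex i.1 _ (hres i.2)
  have nat {V V' : Y.Opens} (hV : V ≤ V') (t : Γ(Y, V')) :
      π.app V (Y.presheaf.map (homOfLE hV).op t) =
        X.presheaf.map (homOfLE (π.preimage_mono hV)).op (π.app V' t) :=
    congrArg (fun m => m.hom t) (π.naturality (homOfLE hV).op)
  have resres {V V' V'' : X.Opens} (h1 : V ≤ V') (h2 : V' ≤ V'') (t : Γ(X, V'')) :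
      X.presheaf.map (homOfLE h1).op (X.presheaf.map (homOfLE h2).op t) =
        X.presheaf.map (homOfLE (h1.trans h2)).op t := by
    rw [← CommRingCat.comp_apply, ← Functor.map_comp]
    rfl
  have hcov : W ≤ iSup fun i : {i // D i ≤ W} => D i.1 := by
    intro y hy
    obtain ⟨i, hi, hi'⟩ := hD W y hy
    exact TopologicalSpace.Opens.mem_iSup.mpr ⟨⟨i, hi'⟩, hi⟩
  obtain ⟨t₀, ht₀, -⟩ := TopCat.Sheaf.existsUnique_gluing' Y.sheaf
    (fun i : {i // D i ≤ W} => D i.1) W (fun i => homOfLE i.2) hcov t (fun i i' => by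
      refine app_injective_of_basis D hD hinj _ ?_
      refine (nat inf_le_left (t i)).trans (Eq.trans ?_ (nat inf_le_right (t i')).symm)
      rw [ht, ht, resres, resres])
  refine ⟨t₀, ?_⟩
  refine TopCat.Sheaf.eq_of_locally_eq' X.sheaf (fun i : {i // D i ≤ W} => π ⁻¹ᵁ D i.1) (π ⁻¹ᵁ W)
    (fun i => homOfLE (π.preimage_mono i.2)) ?_ _ _ ?_
  · intro x hx
    obtain ⟨i, hi⟩ := TopologicalSpace.Opens.mem_iSup.mp (hcov hx)
    exact TopologicalSpace.Opens.mem_iSup.mpr ⟨i, hi⟩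
  · intro i
    refine (nat i.2 t₀).symm.trans (Eq.trans ?_ (ht i))
    exact congrArg _ (ht₀ i)

end Gluing

/-! ### The quotient of `Proj` by a finite group -/

section GradedProducts

open Polynomial

lemma prod_mem_graded_card {ι A : Type*} [CommRing A] {σ : Type*} [SetLike σ A]
    {𝒜 : ℕ → σ} [SetLike.GradedMonoid 𝒜] {d : ℕ} (s : Finset ι) (a : ι → A)
    (ha : ∀ i ∈ s, a i ∈ 𝒜 d) : ∏ i ∈ s, a i ∈ 𝒜 (s.card * d) := by
  classical
  induction s using Finset.induction_on with
  | empty => simpa using SetLike.one_mem_graded 𝒜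
  | insert i s hi ih =>
    rw [Finset.prod_insert hi, Finset.card_insert_of_notMem hi, add_mul, one_mul, add_comm]
    exact SetLike.mul_mem_graded (ha i (s.mem_insert_self i))
      (ih fun j hj => ha j (Finset.mem_insert_of_mem hj))

/-- The coefficients of a product of linear factors with homogeneous roots are homogeneous. -/
lemma coeff_prod_X_sub_C_mem {ι A : Type*} [CommRing A] {σ : Type*} [SetLike σ A]
    [AddSubgroupClass σ A] {𝒜 : ℕ → σ} [SetLike.GradedMonoid 𝒜] {d k : ℕ} (s : Finset ι)
    (a : ι → A) (ha : ∀ i ∈ s, a i ∈ 𝒜 d) (hk : k ≤ s.card) :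
    (∏ i ∈ s, (X - C (a i))).coeff k ∈ 𝒜 ((s.card - k) * d) := by
  have h : ∏ i ∈ s, (X - C (a i)) = ∏ i ∈ s, (X + C (-a i)) := by simp [sub_eq_add_neg]
  rw [h, Finset.prod_X_add_C_coeff s _ hk]
  refine sum_mem fun t ht => ?_
  rw [Finset.mem_powersetCard] at ht
  rw [← ht.2]
  exact prod_mem_graded_card t _ fun i hi => neg_mem (ha i (ht.1 hi))

end GradedProducts

namespace ProjQuotient

open HomogeneousLocalization ProjFunctor
open scoped Pointwise

variable {F A B : Type u} [Field F] [CommRing A] [Algebra F A] [CommRing B] [Algebra F B]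
  {𝒜 : ℕ → Submodule F A} {ℬ : ℕ → Submodule F B}
  (f : ℬ →+*ᵍ 𝒜) {G : Type u} [Group G] (E : G →* (A ≃ₐ[F] A)) (H : Subgroup G)

/-- `f` identifies `B` with the ring of invariants of `H` in `A`. -/
def IsInvariantRing : Prop := ∀ a : A, (∀ g ∈ H, E g a = a) ↔ a ∈ Set.range f

variable {f E H}

section Action

/-- The action of a subgroup of `G` on `A`. -/
@[reducible]
def subgroupAction (E : G →* (A ≃ₐ[F] A)) (H : Subgroup G) : MulSemiringAction H A :=
  MulSemiringAction.compHom A (E.comp H.subtype)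

lemma isInvariant (hfix : IsInvariantRing f E H) :
    letI := subgroupAction E H
    letI := (f : B →+* A).toAlgebra
    Algebra.IsInvariant B A H :=
  let := subgroupAction E H
  let := (f : B →+* A).toAlgebra
  ⟨fun a ha => (hfix a).mp fun g hg => ha ⟨g, hg⟩⟩

lemma isIntegral [Finite H] (hfix : IsInvariantRing f E H) :
    letI := (f : B →+* A).toAlgebra
    Algebra.IsIntegral B A :=
  let := subgroupAction E H
  let := (f : B →+* A).toAlgebra
  let := isInvariant hfix
  Algebra.IsInvariant.isIntegral B A H

variable [GradedAlgebra 𝒜] [GradedAlgebra ℬ]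

/-- An injective graded homomorphism reflects the degree of homogeneous elements. -/
lemma mem_of_apply_mem {f : ℬ →+*ᵍ 𝒜} (hinj : Function.Injective f) {n : ℕ} {b : B}
    (h : f b ∈ 𝒜 n) : b ∈ ℬ n := by
  classical
  have h1 : f (DirectSum.decompose ℬ b n : B) = f b := by
    rw [f.map_directSumDecompose, DirectSum.decompose_of_mem_same 𝒜 h]
  rw [← hinj h1]
  exact SetLike.coe_mem _

/-- The inclusion of the ring of invariants of a finite group defines a morphism on all of
`Proj A`. -/
lemma preservesRelevant [Finite H] (hinj : Function.Injective f)
    (hE : ∀ g n, ∀ a ∈ 𝒜 n, E g a ∈ 𝒜 n) (hfix : IsInvariantRing f E H) :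
    PreservesRelevant f := by
  classical
  let := subgroupAction E H
  let := (f : B →+* A).toAlgebra
  let := isInvariant hfix
  cases nonempty_fintype H
  intro x
  by_contra! hx
  refine x.not_irrelevant_le ?_
  refine (HomogeneousIdeal.irrelevant_le (𝒜 := 𝒜)).mpr fun i hi a ha => ?_
  -- The lower coefficients of the characteristic polynomial of `a` are invariants of positive
  -- degree, so they vanish at `x` and hence so does a power of `a`.
  have : Nontrivial A :=
    ⟨1, 0, fun h => (Ideal.ne_top_iff_one _).mp x.isPrime.ne_top (h ▸ zero_mem _)⟩
  set n := Fintype.card H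
  have hdeg : (MulSemiringAction.charpoly H a).natDegree = n := by
    rw [MulSemiringAction.charpoly_eq, Polynomial.natDegree_prod_of_monic _ _
      fun g _ => Polynomial.monic_X_sub_C _]
    simp [n]
  have hmem : ∀ k < n, (MulSemiringAction.charpoly H a).coeff k ∈ x.asHomogeneousIdeal := by
    intro k hk
    obtain ⟨b, hb⟩ := Algebra.IsInvariant.isInvariant (A := B) (G := H)
      ((MulSemiringAction.charpoly H a).coeff k) (MulSemiringAction.smul_coeff_charpoly a k)
    have h1 : (MulSemiringAction.charpoly H a).coeff k ∈ 𝒜 ((n - k) * i) :=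
      coeff_prod_X_sub_C_mem Finset.univ _ (fun g _ => hE g.1 i a ha) (by simpa using hk.le)
    change f b = _ at hb
    rw [← hb] at h1 ⊢
    have h2 := hx ⟨⟨(n - k) * i, Nat.mul_pos (Nat.sub_pos_of_lt hk) hi⟩, b,
      mem_of_apply_mem hinj h1⟩
    rwa [Proj.mem_basicOpen, not_not] at h2
  have h0 := MulSemiringAction.eval_charpoly H a
  rw [Polynomial.eval_eq_sum_range, hdeg, Finset.sum_range_succ] at h0
  have hlead : (MulSemiringAction.charpoly H a).coeff n = 1 := by
    rw [← hdeg]; exact MulSemiringAction.monic_charpoly H a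
  rw [hlead, one_mul] at h0
  refine x.isPrime.mem_of_pow_mem n ?_
  rw [eq_neg_of_add_eq_zero_right h0]
  exact neg_mem (sum_mem fun k hk => Ideal.mul_mem_right _ _ (hmem k (Finset.mem_range.mp hk)))

end Action

variable [GradedAlgebra 𝒜]

/-- Points with the same image are conjugate, as `H` acts transitively on the primes of `A` over a
prime of the ring of invariants. -/
lemma exists_smul_eq_of_map_eq [Finite H] (hfix : IsInvariantRing f E H)
    (x y : Proj 𝒜) (hxy : ∀ b : B, f b ∈ x.asHomogeneousIdeal ↔ f b ∈ y.asHomogeneousIdeal) :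
    ∃ g ∈ H, ∀ a : A, a ∈ y.asHomogeneousIdeal ↔ E g a ∈ x.asHomogeneousIdeal := by
  let := subgroupAction E H
  let := (f : B →+* A).toAlgebra
  let := isInvariant hfix
  have hcomm : SMulCommClass H B A := ⟨fun g b a => by
    have h1 := (hfix (f b)).mpr ⟨b, rfl⟩ g.1 g.2
    change E g.1 (f b * a) = f b * E g.1 a
    rw [map_mul, h1]⟩
  have hxp := x.isPrime
  have hyp := y.isPrime
  obtain ⟨g, hg⟩ := Algebra.IsInvariant.exists_smul_of_under_eq B A H
    x.asHomogeneousIdeal.toIdeal y.asHomogeneousIdeal.toIdeal (Ideal.ext hxy)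
  refine ⟨g⁻¹.1, g⁻¹.2, fun a => ?_⟩
  have h1 : a ∈ y.asHomogeneousIdeal.toIdeal ↔ a ∈ g • x.asHomogeneousIdeal.toIdeal := by rw [hg]
  rw [Ideal.mem_pointwise_smul_iff_inv_smul_mem] at h1
  exact h1

variable [GradedAlgebra ℬ]

lemma isClosedMap_and_surjective [Finite H] (hf : PreservesRelevant f)
    (hinj : Function.Injective f) (hfix : IsInvariantRing f E H) :
    IsClosedMap (projMap f hf) ∧ Function.Surjective (projMap f hf) := by
  let := (f : B →+* A).toAlgebra
  let := isIntegral hfix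
  -- Going up, followed by passing to the homogeneous core.
  have key (I : HomogeneousIdeal 𝒜) (y : Proj ℬ) (h : ∀ b, f b ∈ I → b ∈ y.asHomogeneousIdeal) :
      ∃ x : Proj 𝒜, I ≤ x.asHomogeneousIdeal ∧ projMap f hf x = y := by
    have hyp := y.isPrime
    obtain ⟨Q, hQ, hQp, hQy⟩ := Ideal.exists_ideal_over_prime_of_isIntegral
      y.asHomogeneousIdeal.toIdeal I.toIdeal h
    have hQy' (b : B) : f b ∈ Q ↔ b ∈ y.asHomogeneousIdeal.toIdeal := by
      rw [← hQy]; rfl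
    have hcore (b : B) : f b ∈ Q.homogeneousCore 𝒜 ↔ b ∈ y.asHomogeneousIdeal := by
      refine ⟨fun hb => (hQy' b).mp (Ideal.toIdeal_homogeneousCore_le 𝒜 Q hb), fun hb => ?_⟩
      refine ((Q.homogeneousCore 𝒜).isHomogeneous.mem_iff).mpr fun i => ?_
      rw [← f.map_directSumDecompose]
      refine Ideal.mem_homogeneousCore_of_homogeneous_of_mem
        ⟨i, apply_mem f (SetLike.coe_mem _)⟩ ((hQy' _).mpr ?_)
      exact y.asHomogeneousIdeal.isHomogeneous i hb
    let x : ProjectiveSpectrum 𝒜 :=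
      { asHomogeneousIdeal := Q.homogeneousCore 𝒜
        isPrime := hQp.homogeneousCore
        not_irrelevant_le := fun hle => y.not_irrelevant_le
          ((HomogeneousIdeal.irrelevant_le (𝒜 := ℬ)).mpr fun i hi b hb => (hcore b).mp
            (hle (HomogeneousIdeal.mem_irrelevant_of_mem 𝒜 hi (apply_mem f hb)))) }
    refine ⟨x, ?_, ?_⟩
    · intro a ha
      refine ((Q.homogeneousCore 𝒜).isHomogeneous.mem_iff).mpr fun i => ?_
      exact Ideal.mem_homogeneousCore_of_homogeneous_of_mem ⟨i, SetLike.coe_mem _⟩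
        (hQ (I.isHomogeneous i ha))
    · refine ProjectiveSpectrum.ext ?_
      refine (asHomogeneousIdeal_map f hf x).trans (HomogeneousIdeal.ext (Ideal.ext hcore))
  refine ⟨fun Z hZ => ?_, fun y => ?_⟩
  · have hZ' : ProjectiveSpectrum.zeroLocus 𝒜 (ProjectiveSpectrum.vanishingIdeal Z : Set A) = Z :=
      (ProjectiveSpectrum.zeroLocus_vanishingIdeal_eq_closure 𝒜 Z).trans hZ.closure_eq
    have himg : projMap f hf '' Z = ProjectiveSpectrum.zeroLocus ℬ
        (f ⁻¹' (ProjectiveSpectrum.vanishingIdeal Z : Set A)) := by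
      ext y
      constructor
      · rintro ⟨x, hx, rfl⟩ b hb
        have h1 : f b ∈ x.asHomogeneousIdeal :=
          (ProjectiveSpectrum.mem_vanishingIdeal _ _).mp hb x hx
        have h2 := asHomogeneousIdeal_map f hf x
        exact h2.ge h1
      · intro hy
        obtain ⟨x, hx, hxy⟩ := key (ProjectiveSpectrum.vanishingIdeal Z) y hy
        exact ⟨x, hZ'.le hx, hxy⟩
    rw [himg]
    exact ProjectiveSpectrum.isClosed_zeroLocus ℬ _
  · obtain ⟨x, -, hx⟩ := key ⊥ y fun b hb => by
      have h0 : f b = 0 := hb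
      rw [hinj (h0.trans (map_zero f).symm)]
      exact zero_mem _
    exact ⟨x, hx⟩

section Sections

/-- The homomorphism between degree-zero localizations induced by a graded homomorphism, with
an arbitrary name for the image of the denominator. -/
noncomputable def awayMapOfEq {C : Type u} [CommRing C] [Algebra F C] {𝒞 : ℕ → Submodule F C}
    [GradedAlgebra 𝒞] (e : 𝒞 →+*ᵍ 𝒜) {t : C} {s : A} (h : e t = s) : Away 𝒞 t →+* Away 𝒜 s :=
  h ▸ Away.map e t

lemma awayMapOfEq_mk {e : 𝒜 →+*ᵍ 𝒜} {s t : A} (h : e t = s) {d : ℕ} (ht : t ∈ 𝒜 d) (n : ℕ) (a : A)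
    (ha : a ∈ 𝒜 (n • d)) :
    awayMapOfEq e h (Away.mk 𝒜 ht n a ha) =
      Away.mk 𝒜 (h ▸ apply_mem e ht) n (e a) (apply_mem e ha) := by
  subst h
  exact Away.map_mk e t ht n a ha

lemma awayι_comp_projMap_of_eq {e : 𝒜 →+*ᵍ 𝒜}
    (he : HomogeneousIdeal.irrelevant 𝒜 ≤ (HomogeneousIdeal.irrelevant 𝒜).map e) {s t : A}
    (h : e t = s) {d : ℕ} (hd : 0 < d) (ht : t ∈ 𝒜 d) (hs : s ∈ 𝒜 d) :
    Proj.awayι 𝒜 s hs hd ≫ Proj.map e he =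
      Spec.map (CommRingCat.ofHom (awayMapOfEq e h)) ≫ Proj.awayι 𝒜 t ht hd := by
  subst h
  exact Proj.awayι_comp_map e he hd t ht

variable [IsDomain A]

/-- The map from `D₊(f s)` to `D₊(s)` is injective on functions. -/
lemma away_map_injective (hinj : Function.Injective f) {d : ℕ} {s : B} (hs : s ∈ ℬ d) :
    Function.Injective (Away.map f s) := by
  refine (injective_iff_map_eq_zero _).mpr fun z hz => ?_
  obtain ⟨n, b, hb, rfl⟩ := z.mk_surjective _ hs
  rw [Away.map_mk] at hz
  have h1 := congrArg HomogeneousLocalization.val hz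
  rw [Away.val_mk, HomogeneousLocalization.val_zero, Localization.mk_eq_mk',
    IsLocalization.mk'_eq_zero_iff] at h1
  obtain ⟨⟨_, k, rfl⟩, hm⟩ := h1
  have h2 : s ^ k * b = 0 := hinj (by simpa using hm)
  ext
  rw [Away.val_mk, HomogeneousLocalization.val_zero, Localization.mk_eq_mk',
    IsLocalization.mk'_eq_zero_iff]
  exact ⟨⟨_, k, rfl⟩, h2⟩

/-- An invariant fraction with denominator `f s` has an invariant numerator. -/
lemma exists_away_map_eq (hinj : Function.Injective f) (hfix : IsInvariantRing f E H)
    (e : H → (𝒜 →+*ᵍ 𝒜)) (heE : ∀ g a, e g a = E g a) {d : ℕ} {s : B} (hs : s ∈ ℬ d)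
    (hes : ∀ g, e g (f s) = f s)
    (z : Away 𝒜 (f s)) (hz : ∀ g, awayMapOfEq (e g) (hes g) z = z) :
    ∃ y, Away.map f s y = z := by
  by_cases hs0 : f s = 0
  -- If the denominator is zero, then so is the localization.
  · have : Subsingleton (Away 𝒜 (f s)) :=
      HomogeneousLocalization.subsingleton _ ⟨1, by simpa using hs0⟩
    exact ⟨0, Subsingleton.elim _ _⟩
  obtain ⟨n, a, ha, rfl⟩ := z.mk_surjective _ (apply_mem f hs)
  have hle : Submonoid.powers (f s) ≤ nonZeroDivisors A :=
    powers_le_nonZeroDivisors_of_noZeroDivisors hs0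
  have hinv (g : H) : E g a = a := by
    have h1 := congrArg HomogeneousLocalization.val (hz g)
    rw [awayMapOfEq_mk, Away.val_mk, Away.val_mk, Localization.mk_eq_mk',
      IsLocalization.mk'_eq_iff_eq] at h1
    have h2 := IsLocalization.injective (Localization.Away (f s)) hle h1
    rw [← heE]
    exact mul_left_cancel₀ (pow_ne_zero n hs0) h2
  obtain ⟨b, rfl⟩ := (hfix a).mp fun g hg => hinv ⟨g, hg⟩
  exact ⟨Away.mk ℬ hs n b (mem_of_apply_mem hinj ha), Away.map_mk f s hs n b _⟩

end Sections

end ProjQuotient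

/-! ### The quotient morphism of schemes -/

namespace ProjQuotient

open HomogeneousLocalization ProjFunctor

variable {F A B : Type u} [Field F] [CommRing A] [Algebra F A] [CommRing B] [Algebra F B]
  {𝒜 : ℕ → Submodule F A} {ℬ : ℕ → Submodule F B} [GradedAlgebra 𝒜] [GradedAlgebra ℬ]
  {f : ℬ →+*ᵍ 𝒜} {G : Type u} [Group G] {E : G →* (A ≃ₐ[F] A)} {H : Subgroup G}

lemma projMap_comp_projToSpec (hf : PreservesRelevant f)
    (hF : ∀ c, f (algebraMap F B c) = algebraMap F A c) :
    projMap f hf ≫ projToSpec ℬ = projToSpec 𝒜 := by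
  refine (cover f hf).hom_ext _ _ fun s => ?_
  change Proj.awayι 𝒜 (f (s.2 : B)) (apply_mem f s.2.2) s.1.pos ≫ _ =
    Proj.awayι 𝒜 (f (s.2 : B)) (apply_mem f s.2.2) s.1.pos ≫ _
  rw [← Category.assoc, awayι_comp_map f hf s.1.pos s.2.2, projToSpec, projToSpec, Category.assoc,
    Proj.awayι_toSpecZero_assoc, Proj.awayι_toSpecZero_assoc, ← Spec.map_comp, ← Spec.map_comp,
    ← Spec.map_comp]
  congr 1
  ext c
  simp only [CommRingCat.hom_comp, CommRingCat.hom_ofHom, RingHom.comp_apply]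
  have h1 : Away.map f (s.2 : B) (fromZeroRingHom ℬ _ (algebraMap F (ℬ 0) c)) =
      fromZeroRingHom 𝒜 _ (algebraMap F (𝒜 0) c) := by
    refine (HomogeneousLocalization.map_mk _ _ _).trans ?_
    ext
    simp [fromZeroRingHom, hF]
    rfl
  exact congrArg _ h1

/-- The graded endomorphism underlying a degree-preserving automorphism. -/
def gradedHom (he : ∀ g n, ∀ a ∈ 𝒜 n, E g a ∈ 𝒜 n) (g : G) : 𝒜 →+*ᵍ 𝒜 :=
  { (E g : A →+* A) with map_mem := fun {n a} h => he g n a h }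

/-- If `f` identifies `B` with the invariants of a finite group `H` of automorphisms of a graded
domain `A`, then `Proj A ⟶ Proj B` is the quotient by `H`. -/
theorem isQuotientBy [IsDomain A] [Finite H] (hf : PreservesRelevant f)
    (hinj : Function.Injective f) (hfix : IsInvariantRing f E H)
    (he : ∀ g n, ∀ a ∈ 𝒜 n, E g a ∈ 𝒜 n) (he' : ∀ g n, ∀ a ∈ 𝒜 n, (E g).symm a ∈ 𝒜 n) :
    IsQuotientBy (fun g => projOfEquiv 𝒜 (E g) (he g) (he' g)) H (projMap f hf) := by
  have hes (g : H) (b : B) : gradedHom he g.1 (f b) = f b := (hfix (f b)).mpr ⟨b, rfl⟩ g.1 g.2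
  have hchart (g : H) {d : ℕ} (hd : 0 < d) {s : B} (hs : s ∈ ℬ d) :
      Proj.awayι 𝒜 (f s) (apply_mem f hs) hd ≫ projOfEquiv 𝒜 (E g.1) (he g.1) (he' g.1) =
        Spec.map (CommRingCat.ofHom (awayMapOfEq (gradedHom he g.1) (hes g s))) ≫
          Proj.awayι 𝒜 (f s) (apply_mem f hs) hd :=
    awayι_comp_projMap_of_eq (e := gradedHom he g.1)
      (irrelevant_le_map_of_equiv 𝒜 (E g.1) (gradedHom he g.1) (fun _ => rfl) (he' g.1))
      (hes g s) hd (apply_mem f hs) (apply_mem f hs)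
  have hinvariant (g : G) (hg : g ∈ H) :
      projOfEquiv 𝒜 (E g) (he g) (he' g) ≫ projMap f hf = projMap f hf := by
    refine (cover f hf).hom_ext _ _ fun s => ?_
    have h1 := hchart ⟨g, hg⟩ s.1.pos s.2.2
    have h2 := awayι_comp_map f hf s.1.pos s.2.2
    change Proj.awayι 𝒜 (f (s.2 : B)) (apply_mem f s.2.2) s.1.pos ≫ _ =
      Proj.awayι 𝒜 (f (s.2 : B)) (apply_mem f s.2.2) s.1.pos ≫ _
    rw [← Category.assoc, h1, Category.assoc, h2, ← Category.assoc, ← Spec.map_comp]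
    congr 2
    rw [← CommRingCat.ofHom_comp]
    congr 1
    ext z
    obtain ⟨n, b, hb, rfl⟩ := z.mk_surjective _ s.2.2
    rw [RingHom.comp_apply, Away.map_mk, awayMapOfEq_mk, Away.val_mk, Away.val_mk,
      hes ⟨g, hg⟩ b]
  obtain ⟨hclosed, hsurj⟩ := isClosedMap_and_surjective hf hinj hfix
  have hopens {d : ℕ} (hd : 0 < d) {s : B} (hs : s ∈ ℬ d) :
      projMap f hf ⁻¹ᵁ Proj.basicOpen ℬ s =
        (Proj.awayι 𝒜 (f s) (apply_mem f hs) hd).opensRange := by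
    rw [map_preimage_basicOpen f hf hs hd, Proj.opensRange_awayι]
  -- The sets `D₊(s)` with `s` of positive degree form a basis of the topology of `Proj B`.
  let D : (Σ i : ℕ+, ℬ i) → (Proj ℬ).Opens := fun s => Proj.basicOpen ℬ (s.2 : B)
  have hD (W : (Proj ℬ).Opens) (y : Proj ℬ) (hy : y ∈ W) : ∃ s, y ∈ D s ∧ D s ≤ W := by
    obtain ⟨_, ⟨_, ⟨b, rfl⟩, rfl⟩, hb, hbW⟩ := (Proj.isBasis_basicOpen ℬ).exists_subset_of_mem_open
      hy W.isOpen
    obtain ⟨x, rfl⟩ := hsurj y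
    obtain ⟨s, hs⟩ := hf x
    rw [← map_preimage_basicOpen f hf s.2.2 s.1.pos] at hs
    have hb' : projMap f hf x ∈ Proj.basicOpen ℬ b := hb
    rw [Proj.basicOpen_eq_iSup_proj, TopologicalSpace.Opens.mem_iSup] at hb'
    obtain ⟨i, hi⟩ := hb'
    refine ⟨⟨⟨i + s.1, Nat.add_pos_right i s.1.pos⟩, GradedRing.proj ℬ i b * s.2,
      SetLike.mul_mem_graded (SetLike.coe_mem _) s.2.2⟩, ?_, ?_⟩
    · change _ ∈ Proj.basicOpen ℬ (GradedRing.proj ℬ i b * (s.2 : B))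
      rw [Proj.basicOpen_mul]
      exact ⟨hi, hs⟩
    · change Proj.basicOpen ℬ (GradedRing.proj ℬ i b * (s.2 : B)) ≤ W
      rw [Proj.basicOpen_mul]
      refine inf_le_left.trans (le_trans ?_ hbW)
      rw [Proj.basicOpen_eq_iSup_proj ℬ b]
      exact le_iSup (fun i => Proj.basicOpen ℬ (GradedRing.proj ℬ i b)) i
  have hDinj (s : Σ i : ℕ+, ℬ i) : Function.Injective ((projMap f hf).app (D s)) :=
    app_injective_of_chart (awayι_comp_map f hf s.1.pos s.2.2) (away_map_injective hinj s.2.2)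
      (Proj.opensRange_awayι ℬ (s.2 : B) s.2.2 s.1.pos).symm (hopens s.1.pos s.2.2)
  have hle (g : H) (W : (Proj ℬ).Opens) : projMap f hf ⁻¹ᵁ W ≤
      projOfEquiv 𝒜 (E g.1) (he g.1) (he' g.1) ⁻¹ᵁ projMap f hf ⁻¹ᵁ W := by
    rw [← Scheme.Hom.comp_preimage, hinvariant g.1 g.2]
  refine ⟨hinvariant, hclosed.isQuotientMap (projMap f hf).continuous hsurj, ?_,
    app_injective_of_basis D hD hDinj, ?_⟩
  · intro x y hxy
    have hx := asHomogeneousIdeal_map f hf x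
    have hy := asHomogeneousIdeal_map f hf y
    rw [hxy] at hx
    have hxy' := hx.symm.trans hy
    obtain ⟨g, hg, h⟩ := exists_smul_eq_of_map_eq hfix x y fun b =>
      iff_of_eq (congrArg (fun I : HomogeneousIdeal ℬ => b ∈ I) hxy')
    exact ⟨g, hg, ProjectiveSpectrum.ext (HomogeneousIdeal.ext (Ideal.ext fun a => (h a).symm))⟩
  · intro W s hs
    refine exists_app_eq_of_basis D hD hDinj
      (fun g : H => projOfEquiv 𝒜 (E g.1) (he g.1) (he' g.1)) hle ?_ W s fun g => hs g.1 g.2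
    intro d t ht
    exact exists_app_eq_of_chart (awayι_comp_map f hf d.1.pos d.2.2)
      (Proj.opensRange_awayι ℬ (d.2 : B) d.2.2 d.1.pos).symm (hopens d.1.pos d.2.2) _ _
      (fun g => hchart g d.1.pos d.2.2)
      (exists_away_map_eq hinj hfix (fun g => gradedHom he g.1) (fun _ _ => rfl) d.2.2
        (fun g => hes g d.2)) _ t ht

end ProjQuotient

/-! ### Finite flat quotients of `Proj` -/

namespace ProjQuotient

open HomogeneousLocalization ProjFunctor

variable {F A B : Type u} [Field F] [CommRing A] [Algebra F A] [CommRing B] [Algebra F B]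
  {𝒜 : ℕ → Submodule F A} {ℬ : ℕ → Submodule F B} [GradedAlgebra 𝒜] [GradedAlgebra ℬ]
  {f : ℬ →+*ᵍ 𝒜} {ι : Type*} [Fintype ι] {e : ι → A} {d : ι → ℕ}

/-- If homogeneous elements `e i` span `A` over `B`, then any homogeneous element is a combination
of the `e i` with homogeneous coefficients of the expected degree. -/
lemma exists_homogeneous_coeff (he : ∀ i, e i ∈ 𝒜 (d i))
    (hspan : ∀ a : A, ∃ b : ι → B, a = ∑ i, f (b i) * e i) {n : ℕ} {a : A} (ha : a ∈ 𝒜 n) :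
    ∃ b : ι → B, (∀ i, b i ∈ ℬ (n - d i)) ∧ (∀ i, n < d i → b i = 0) ∧
      a = ∑ i, f (b i) * e i := by
  classical
  obtain ⟨b, hb⟩ := hspan a
  refine ⟨fun i => if d i ≤ n then (DirectSum.decompose ℬ (b i) (n - d i) : B) else 0,
    fun i => ?_, fun i hi => if_neg (not_le.mpr hi), ?_⟩
  · dsimp only
    split_ifs
    · exact SetLike.coe_mem _
    · exact zero_mem _
  · have h1 : a = ∑ i, (DirectSum.decompose 𝒜 (f (b i) * e i) n : A) := by
      rw [← DirectSum.decompose_of_mem_same 𝒜 ha]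
      conv_lhs => rw [hb]
      rw [DirectSum.decompose_sum, DFinsupp.finsetSum_apply, AddSubmonoidClass.coe_finsetSum]
    rw [h1]
    refine Finset.sum_congr rfl fun i _ => ?_
    dsimp only
    split_ifs with h
    · rw [DirectSum.coe_decompose_mul_of_right_mem_of_le 𝒜 (he i) h, f.map_directSumDecompose]
    · rw [DirectSum.coe_decompose_mul_of_right_mem_of_not_le 𝒜 (he i) h, map_zero, zero_mul]

/-- The homogeneous basis elements, divided by powers of a denominator of degree one. -/
noncomputable def awayBasisFun (he : ∀ i, e i ∈ 𝒜 (d i)) {s : A} (hs : s ∈ 𝒜 1) (i : ι) :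
    Away 𝒜 s :=
  Away.mk 𝒜 hs (d i) (e i) (by simpa using he i)

/-- Over a chart `D₊(s)` with `s` of degree one, the fractions `e i / (f s) ^ d i` span. -/
lemma awayBasisFun_span (he : ∀ i, e i ∈ 𝒜 (d i))
    (hspan : ∀ a : A, ∃ b : ι → B, a = ∑ i, f (b i) * e i) {s : B} (hs : s ∈ ℬ 1)
    (z : Away 𝒜 (f s)) :
    ∃ c : ι → Away ℬ s, z = ∑ i, Away.map f s (c i) * awayBasisFun he (apply_mem f hs) i := by
  obtain ⟨n, a, ha, rfl⟩ := z.mk_surjective _ (apply_mem f hs)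
  obtain ⟨b, hb, hb0, hab⟩ := exists_homogeneous_coeff he hspan (n := n) (by simpa using ha)
  refine ⟨fun i => Away.mk ℬ hs (n - d i) (b i) (by simpa using hb i), ?_⟩
  apply HomogeneousLocalization.val_injective
  rw [← HomogeneousLocalization.algebraMap_apply, ← HomogeneousLocalization.algebraMap_apply,
    map_sum]
  simp only [HomogeneousLocalization.algebraMap_apply, HomogeneousLocalization.val_mul,
    awayBasisFun, Away.map_mk, Away.val_mk, Localization.mk_eq_mk', ← IsLocalization.mk'_mul]
  subst hab
  have hterm (i : ι) : IsLocalization.mk' (Localization (Submonoid.powers (f s)))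
      (f (b i) * e i) ((⟨f s ^ (n - d i), _, rfl⟩ : Submonoid.powers (f s)) * ⟨f s ^ d i, _, rfl⟩) =
      IsLocalization.mk' (Localization (Submonoid.powers (f s))) (f (b i) * e i)
        (⟨f s ^ n, _, rfl⟩ : Submonoid.powers (f s)) := by
    by_cases h : d i ≤ n
    · congr 1
      ext
      simp [← pow_add, Nat.sub_add_cancel h]
    · simp [hb0 i (not_le.mp h)]
  rw [Finset.sum_congr rfl fun i _ => hterm i]
  rw [IsLocalization.mk'_eq_mul_mk'_one, map_sum, Finset.sum_mul]
  exact Finset.sum_congr rfl fun i _ => (IsLocalization.mk'_eq_mul_mk'_one _ _).symm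

/-- Over a chart `D₊(s)` with `s` of degree one, the fractions `e i / (f s) ^ d i` are linearly
independent. -/
lemma awayBasisFun_independent [IsDomain A] (hinj : Function.Injective f) (he : ∀ i, e i ∈ 𝒜 (d i))
    (hind : ∀ b : ι → B, ∑ i, f (b i) * e i = 0 → ∀ i, b i = 0) {s : B} (hs : s ∈ ℬ 1)
    (hs0 : s ≠ 0) (c : ι → Away ℬ s)
    (hc : ∑ i, Away.map f s (c i) * awayBasisFun he (apply_mem f hs) i = 0) (i : ι) : c i = 0 := by
  choose n b hb hcb using fun i => (c i).mk_surjective _ hs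
  have hfs : f s ≠ 0 := fun h => hs0 (hinj (h.trans (map_zero f).symm))
  have hle : Submonoid.powers (f s) ≤ nonZeroDivisors A :=
    powers_le_nonZeroDivisors_of_noZeroDivisors hfs
  let L := Localization (Submonoid.powers (f s))
  -- Clear denominators with a common power of `f s`.
  let N := ∑ i, (n i + d i)
  have hN (i : ι) : n i + d i ≤ N := Finset.single_le_sum (f := fun i => n i + d i)
    (fun _ _ => Nat.zero_le _) (Finset.mem_univ i)
  have hterm (i : ι) : algebraMap A L (f s ^ N) *
      (Away.map f s (c i) * awayBasisFun he (apply_mem f hs) i).val =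
      algebraMap A L (f (s ^ (N - (n i + d i)) * b i) * e i) := by
    rw [← hcb, HomogeneousLocalization.val_mul, Away.map_mk, Away.val_mk, awayBasisFun, Away.val_mk,
      Localization.mk_eq_mk', ← IsLocalization.mk'_mul, IsLocalization.mul_mk'_eq_mk'_of_mul,
      IsLocalization.mk'_eq_iff_eq_mul, ← map_mul]
    congr 1
    have h1 : f s ^ N = f s ^ (N - (n i + d i)) * (f s ^ n i * f s ^ d i) := by
      rw [← pow_add, ← pow_add, Nat.sub_add_cancel (hN i)]
    change f s ^ N * (f (b i) * e i) =
      f (s ^ (N - (n i + d i)) * b i) * e i * (f s ^ n i * f s ^ d i)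
    rw [h1, map_mul, map_pow]
    ring
  have h0 : ∑ i, f (s ^ (N - (n i + d i)) * b i) * e i = 0 := by
    refine IsLocalization.injective L hle ?_
    rw [map_sum, map_zero]
    simp_rw [← hterm]
    rw [← Finset.mul_sum]
    have h2 : ∑ i, (Away.map f s (c i) * awayBasisFun he (apply_mem f hs) i).val = 0 :=
      (map_sum (algebraMap (Away 𝒜 (f s)) L) _ _).symm.trans
        ((congrArg _ hc).trans (map_zero _))
    rw [h2, mul_zero]
  have h3 := hind _ h0 i
  have h4 : f (b i) = 0 := by
    have h5 := congrArg f h3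
    rw [map_mul, map_pow, map_zero] at h5
    exact (mul_eq_zero.mp h5).resolve_left (pow_ne_zero _ hfs)
  have h6 : b i = 0 := hinj (h4.trans (map_zero f).symm)
  rw [← hcb i]
  ext
  rw [Away.val_mk, h6, HomogeneousLocalization.val_zero, Localization.mk_zero]

/-- A property of morphisms that is local on the target can be checked after pullback to the members
of an open cover. -/
lemma of_isPullback_openCover {P : MorphismProperty Scheme.{u}} (hP : IsZariskiLocalAtTarget P)
    {X Y : Scheme.{u}} {p : X ⟶ Y} (𝒰 : Y.OpenCover) {X' : 𝒰.I₀ → Scheme.{u}}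
    {i : ∀ k, X' k ⟶ X} {p' : ∀ k, X' k ⟶ 𝒰.X k}
    (h : ∀ k, IsPullback (i k) (p' k) p (𝒰.f k)) (h' : ∀ k, P (p' k)) : P p := by
  refine (IsZariskiLocalAtTarget.iff_of_openCover (P := P) 𝒰).mpr fun k => ?_
  refine (MorphismProperty.cancel_left_of_respectsIso P (h k).isoPullback.hom _).mp ?_
  rw [Scheme.Cover.pullbackHom]
  erw [(h k).isoPullback_hom_snd]
  exact h' k

/-- The rank of the morphism of affine schemes given by a ring extension with a basis. -/
lemma finrank_SpecMap_of_basis {R S : Type u} [CommRing R] [CommRing S] (φ : R →+* S)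
    (bas : letI := φ.toAlgebra; Module.Basis ι R S) (z : PrimeSpectrum R) :
    (Spec.map (CommRingCat.ofHom φ)).finrank z = Fintype.card ι := by
  algebraize [φ]
  have := Module.Free.of_basis bas
  have := Module.Finite.of_basis bas
  have := z.nontrivial
  refine (Scheme.Hom.finrank_SpecMap_algebraMap R S z).trans ?_
  rw [Module.rankAtStalk_eq_finrank_of_free, Module.finrank_eq_card_basis bas]
  rfl

/-- If `A` has a finite basis over `B` consisting of homogeneous elements, and the irrelevant ideal
of `B` is generated in degree one, then `Proj A ⟶ Proj B` is finite and flat of constant degree,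
the cardinality of the basis. -/
theorem isFinite_flat_finrank [IsDomain A] (hf : PreservesRelevant f) (hinj : Function.Injective f)
    (he : ∀ i, e i ∈ 𝒜 (d i))
    (hspan : ∀ a : A, ∃ b : ι → B, a = ∑ i, f (b i) * e i)
    (hind : ∀ b : ι → B, ∑ i, f (b i) * e i = 0 → ∀ i, b i = 0)
    {κ : Type u} (s : κ → B) (hs : ∀ k, s k ∈ ℬ 1) (hs0 : ∀ k, s k ≠ 0)
    (hirr : (HomogeneousIdeal.irrelevant ℬ).toIdeal ≤ Ideal.span (Set.range s)) :
    IsFinite (projMap f hf) ∧ Flat (projMap f hf) ∧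
      ∀ y, (projMap f hf).finrank y = Fintype.card ι := by
  have hpull (k : κ) : IsPullback (Proj.awayι 𝒜 (f (s k)) (apply_mem f (hs k)) one_pos)
      (Spec.map (CommRingCat.ofHom (Away.map f (s k)))) (projMap f hf)
      (Proj.awayι ℬ (s k) (hs k) one_pos) := by
    refine (IsOpenImmersion.isPullback _ _ _ _ (awayι_comp_map f hf one_pos (hs k)) ?_).flip
    rw [Proj.opensRange_awayι, map_preimage_basicOpen f hf (hs k) one_pos, Proj.opensRange_awayι]
  have hlocal (k : κ) :
      letI := (Away.map f (s k)).toAlgebra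
      ∃ _ : Module.Basis ι (Away ℬ (s k)) (Away 𝒜 (f (s k))), True := by
    let := (Away.map f (s k)).toAlgebra
    refine ⟨Module.Basis.mk (v := awayBasisFun he (apply_mem f (hs k))) ?_ ?_, trivial⟩
    · rw [Fintype.linearIndependent_iff]
      exact fun c hc => awayBasisFun_independent hinj he hind (hs k) (hs0 k) c hc
    · rintro z -
      obtain ⟨c, rfl⟩ := awayBasisFun_span he hspan (hs k) z
      exact sum_mem fun i _ => Submodule.smul_mem _ (c i) (Submodule.subset_span ⟨i, rfl⟩)
  have hfin (k : κ) : (Away.map f (s k)).Finite := by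
    let := (Away.map f (s k)).toAlgebra
    obtain ⟨bas, -⟩ := hlocal k
    exact Module.Finite.of_basis bas
  have hflat (k : κ) : (Away.map f (s k)).Flat := by
    let := (Away.map f (s k)).toAlgebra
    obtain ⟨bas, -⟩ := hlocal k
    have := Module.Free.of_basis bas
    change Module.Flat _ _
    infer_instance
  let 𝒰 := (Proj.affineOpenCoverOfIrrelevantLESpan ℬ s hs (fun _ => one_pos) hirr).openCover
  have hF : IsFinite (projMap f hf) :=
    -- Instance search does not find that finiteness is local on the target.
    of_isPullback_openCover (P := @IsFinite)
      (@HasAffineProperty.instIsZariskiLocalAtTarget _ _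
        IsFinite.instHasAffinePropertyAndIsAffineFiniteCarrierObjOppositeOpensCarrierCarrierCommRingCatPresheafOpOpensTopHomAppTop)
      𝒰 hpull fun k => (IsFinite.SpecMap_iff _).mpr (hfin k)
  have hFl : Flat (projMap f hf) :=
    of_isPullback_openCover (P := @Flat) (HasRingHomProperty.instIsZariskiLocalAtTarget @Flat) 𝒰
      hpull fun k => Flat.SpecMap_iff.mpr (hflat k)
  refine ⟨hF, hFl, fun y => ?_⟩
  obtain ⟨k, z, rfl⟩ := 𝒰.exists_eq y
  refine (Scheme.Hom.finrank_of_isPullback _ _ _ _ (hpull k) z).symm.trans ?_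
  exact finrank_SpecMap_of_basis _ (hlocal k).choose z

end ProjQuotient

/-! ### Maximal unipotent subgroups -/

namespace Flag

variable {F V : Type u} [Field F] [AddCommGroup V] [Module F V] {r : ℕ}

/-- An endomorphism that is unitriangular with respect to `b` moves the vectors of each step of the
flag of `b` by vectors in the previous step. -/
lemma apply_sub_mem (b : Module.Basis (Fin r) F V) {φ : V →ₗ[F] V}
    (hφ : ∀ i, φ (b i) - b i ∈ b.flag i.castSucc) (k : Fin r) {v : V} (hv : v ∈ b.flag k.succ) :
    φ v - v ∈ b.flag k.castSucc := by
  have h : b.flag k.succ ≤ (b.flag k.castSucc).comap (φ - LinearMap.id) := by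
    rw [b.flag_le_iff]
    exact fun i hi => b.flag_mono (Fin.castSucc_le_castSucc_iff.mpr
      (Fin.castSucc_lt_succ_iff.mp hi)) (hφ i)
  exact h hv

lemma apply_mem (b : Module.Basis (Fin r) F V) {φ : V →ₗ[F] V}
    (hφ : ∀ i, φ (b i) - b i ∈ b.flag i.castSucc) (k : Fin (r + 1)) {v : V} (hv : v ∈ b.flag k) :
    φ v ∈ b.flag k := by
  induction k using Fin.cases with
  | zero =>
    rw [b.flag_zero, Submodule.mem_bot] at hv
    rw [hv, map_zero]
    exact zero_mem _
  | succ k =>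
    have h := b.flag_mono k.castSucc_lt_succ.le (apply_sub_mem b hφ k hv)
    simpa using add_mem h hv

/-- A unitriangular endomorphism is unipotent: `φ - 1` moves the flag down by one step. -/
lemma isNilpotent_sub_id (b : Module.Basis (Fin r) F V) {φ : V →ₗ[F] V}
    (hφ : ∀ i, φ (b i) - b i ∈ b.flag i.castSucc) :
    IsNilpotent (φ - LinearMap.id : Module.End F V) := by
  have h (k : Fin (r + 1)) :
      ∀ v ∈ b.flag k, ((φ - LinearMap.id : Module.End F V) ^ (k : ℕ)) v = 0 := by
    induction k using Fin.induction with
    | zero => simp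
    | succ k ih =>
      intro v hv
      rw [Fin.val_succ, pow_succ, Module.End.mul_apply]
      exact ih _ (apply_sub_mem b hφ k hv)
  refine ⟨r, LinearMap.ext fun v => ?_⟩
  simpa using h (Fin.last r) v (by simp)

/-- The group of automorphisms that are unitriangular with respect to the basis `b`. -/
def unitriangular [Module.Finite F V] (b : Module.Basis (Fin r) F V) :
    Subgroup (V ≃ₗ[F] V) where
  carrier := {g | ∀ i, g (b i) - b i ∈ b.flag i.castSucc}
  one_mem' := fun i => by simp
  mul_mem' := fun {g h} hg hh i => by
    have h1 : (g * h) (b i) - b i = (g (h (b i) - b i)) + (g (b i) - b i) := by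
      rw [LinearEquiv.mul_apply, map_sub, sub_add_sub_cancel]
    rw [h1]
    exact add_mem (apply_mem b (φ := g.toLinearMap) hg _ (hh i)) (hg i)
  inv_mem' := fun {g} hg i => by
    have hmap : (b.flag i.castSucc).map g.toLinearMap = b.flag i.castSucc := by
      refine Submodule.eq_of_le_of_finrank_eq (Submodule.map_le_iff_le_comap.mpr
        fun v hv => apply_mem b (φ := g.toLinearMap) hg _ hv) ?_
      exact LinearEquiv.finrank_map_eq g _
    have h1 := hg i
    rw [← hmap] at h1
    obtain ⟨w, hw, hgw⟩ := h1
    have h2 : g⁻¹ (b i) - b i = -w := by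
      apply g.injective
      rw [map_sub, map_neg, ← LinearEquiv.mul_apply, mul_inv_cancel, LinearEquiv.coe_one, id_eq]
      rw [← neg_sub]
      exact congrArg _ hgw.symm
    rw [h2]
    exact neg_mem hw

lemma isUnipotentSubgroup_unitriangular [Module.Finite F V] (b : Module.Basis (Fin r) F V) :
    IsUnipotentSubgroup (unitriangular b) :=
  fun g hg => isNilpotent_sub_id b (φ := g.toLinearMap) hg

/-- In characteristic `p`, unipotence of `g` gives
`g ^ p ^ m - 1 = (g - 1) ^ p ^ m = 0` for large `m`. -/
lemma isPGroup_of_isUnipotentSubgroup {p : ℕ} [Fact p.Prime] [CharP F p] [Nontrivial V]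
    {H : Subgroup (V ≃ₗ[F] V)} (hH : IsUnipotentSubgroup H) : IsPGroup p H := by
  intro g
  obtain ⟨m, hm⟩ := hH g.1 g.2
  refine ⟨m, Subtype.ext (LinearEquiv.ext fun v => ?_)⟩
  have : CharP (Module.End F V) p :=
    charP_of_injective_algebraMap (algebraMap F (Module.End F V)).injective p
  have h1 : ((g.1.toLinearMap - LinearMap.id : Module.End F V) + 1) ^ p ^ m = 1 := by
    rw [add_pow_char_pow_of_commute p m (Commute.one_right _), one_pow,
      pow_eq_zero_of_le (Nat.lt_pow_self (Fact.out : p.Prime).one_lt).le hm, zero_add]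
  have h2 : (g.1.toLinearMap - LinearMap.id : Module.End F V) + 1 =
      LinearEquiv.automorphismGroup.toLinearMapMonoidHom g.1 := by
    ext
    simp
  rw [h2, ← map_pow] at h1
  exact LinearMap.congr_fun h1 v

/-- A unipotent group over a finite field stabilizing a proper subspace `W` fixes a nonzero vector
of `V / W`, since a `p`-group has more than one fixed point there. -/
lemma exists_notMem_apply_sub_mem [Finite F] [Module.Finite F V] {H : Subgroup (V ≃ₗ[F] V)}
    (hH : IsUnipotentSubgroup H) {W : Submodule F V} (hW : W ≠ ⊤)
    (hs : ∀ g ∈ H, ∀ w ∈ W, g w ∈ W) : ∃ v ∉ W, ∀ g ∈ H, g v - v ∈ W := by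
  obtain ⟨p, _⟩ := CharP.exists F
  have hp : Fact p.Prime := ⟨CharP.char_is_prime F p⟩
  have : Finite V := Module.finite_of_finite F
  have : Nontrivial (V ⧸ W) := Submodule.Quotient.nontrivial_iff.mpr hW
  have : Nontrivial V := W.mkQ_surjective.nontrivial
  have : Finite (V ⧸ W) := .of_surjective _ W.mkQ_surjective
  let act : MulAction H (V ⧸ W) :=
    { smul := fun g x => W.mapQ W g.1.toLinearMap (fun w hw => hs g.1 g.2 w hw) x
      one_smul := fun x => by
        obtain ⟨v, rfl⟩ := W.mkQ_surjective x
        rfl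
      mul_smul := fun g h x => by
        obtain ⟨v, rfl⟩ := W.mkQ_surjective x
        rfl }
  have hcard : p ∣ Nat.card (V ⧸ W) := by
    have h1 : p ∣ Nat.card F := by
      have := Fintype.ofFinite F
      obtain ⟨n, -, hn⟩ := FiniteField.card F p
      rw [Nat.card_eq_fintype_card, hn]
      exact dvd_pow_self _ n.ne_zero
    rw [Module.natCard_eq_pow_finrank (K := F)]
    exact h1.trans (dvd_pow_self _ (Module.finrank_pos (R := F) (M := V ⧸ W)).ne')
  obtain ⟨x, hx, hx0⟩ := (isPGroup_of_isUnipotentSubgroup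
    hH).exists_fixed_point_of_prime_dvd_card_of_fixed_point (V ⧸ W) hcard (a := 0)
      (fun g => map_zero (W.mapQ W g.1.toLinearMap (fun w hw => hs g.1 g.2 w hw)))
  obtain ⟨v, rfl⟩ := W.mkQ_surjective x
  refine ⟨v, fun hv => hx0 ((Submodule.Quotient.mk_eq_zero W).mpr hv).symm, fun g hg => ?_⟩
  exact (Submodule.Quotient.eq W).mp (hx ⟨g, hg⟩)

/-- A unipotent group is unitriangular with respect to some linearly independent family of each
length, which is built by successively lifting fixed vectors of quotients of `V`. -/
lemma exists_linearIndependent_apply_sub_mem [Finite F] [Module.Finite F V]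
    {H : Subgroup (V ≃ₗ[F] V)} (hH : IsUnipotentSubgroup H) {n : ℕ}
    (hn : n ≤ Module.finrank F V) :
    ∃ v : Fin n → V, LinearIndependent F v ∧
      ∀ g ∈ H, ∀ i, g (v i) - v i ∈ Submodule.span F (v '' {j | j < i}) := by
  induction n with
  | zero => exact ⟨Fin.elim0, linearIndependent_empty_type, fun _ _ i => i.elim0⟩
  | succ n ih =>
    obtain ⟨v, hv, hvH⟩ := ih (Nat.le_of_succ_le hn)
    let W := Submodule.span F (Set.range v)
    have hW : W ≠ ⊤ := fun h => by
      have h1 := finrank_span_eq_card hv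
      rw [show Submodule.span F (Set.range v) = ⊤ from h, finrank_top, Fintype.card_fin] at h1
      omega
    have hs : ∀ g ∈ H, ∀ w ∈ W, g w ∈ W := by
      intro g hg
      have h1 : W ≤ W.comap g.toLinearMap := by
        refine Submodule.span_le.mpr ?_
        rintro _ ⟨i, rfl⟩
        have h2 := Submodule.span_mono (Set.image_subset_range v _) (hvH g hg i)
        simpa using add_mem h2 (Submodule.subset_span ⟨i, rfl⟩)
      exact fun w hw => h1 hw
    obtain ⟨x, hx, hxH⟩ := exists_notMem_apply_sub_mem hH hW hs
    refine ⟨Fin.snoc v x, hv.finSnoc hx, fun g hg i => ?_⟩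
    induction i using Fin.lastCases with
    | last =>
      rw [Fin.snoc_last]
      refine Submodule.span_mono ?_ (hxH g hg)
      rintro _ ⟨j, rfl⟩
      exact ⟨j.castSucc, j.castSucc_lt_last, Fin.snoc_castSucc ..⟩
    | cast i =>
      rw [Fin.snoc_castSucc]
      refine Submodule.span_mono ?_ (hvH g hg i)
      rintro _ ⟨j, hj, rfl⟩
      exact ⟨j.castSucc, Fin.castSucc_lt_castSucc_iff.mpr hj, Fin.snoc_castSucc ..⟩

/-- A maximal unipotent subgroup is the group of unitriangular matrices for some basis. -/
theorem exists_eq_unitriangular [Finite F] [Module.Finite F V] (hr : Module.finrank F V = r)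
    (hr1 : 1 ≤ r) {U : Subgroup (V ≃ₗ[F] V)} (hU : Maximal IsUnipotentSubgroup U) :
    ∃ b : Module.Basis (Fin r) F V, U = unitriangular b := by
  obtain ⟨v, hv, hvH⟩ := exists_linearIndependent_apply_sub_mem hU.prop hr.ge
  have : NeZero r := ⟨by omega⟩
  let b := basisOfLinearIndependentOfCardEqFinrank hv (by simpa using hr.symm)
  have hb : ⇑b = v := coe_basisOfLinearIndependentOfCardEqFinrank ..
  refine ⟨b, hU.eq_of_le (isUnipotentSubgroup_unitriangular b) fun g hg i => ?_⟩
  have h := hvH g hg i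
  rw [← hb] at h
  simpa [Module.Basis.flag] using h

lemma finrank_flag (b : Module.Basis (Fin r) F V) (k : Fin (r + 1)) :
    Module.finrank F (b.flag k) = k := by
  have h : b.flag k = Submodule.span F (Set.range (b ∘ Fin.castLE (Nat.lt_succ_iff.mp k.2))) := by
    rw [Module.Basis.flag]
    congr 1
    ext v
    constructor
    · rintro ⟨i, hi, rfl⟩
      exact ⟨⟨i, hi⟩, rfl⟩
    · rintro ⟨i, rfl⟩
      exact ⟨_, i.2, rfl⟩
  rw [h, finrank_span_eq_card (b.linearIndependent.comp _ (Fin.castLE_injective _)),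
    Fintype.card_fin]

section Coset

variable [Finite V]

/-- The vectors of the `i`-th step of the flag with leading coefficient one. -/
noncomputable def coset (b : Module.Basis (Fin r) F V) (i : Fin r) : Finset V :=
  (Set.toFinite {w | w - b i ∈ b.flag i.castSucc}).toFinset

lemma mem_coset {b : Module.Basis (Fin r) F V} {i : Fin r} {w : V} :
    w ∈ coset b i ↔ w - b i ∈ b.flag i.castSucc := by
  simp [coset]

lemma self_mem_coset (b : Module.Basis (Fin r) F V) (i : Fin r) : b i ∈ coset b i := by
  simp [mem_coset]

lemma ne_zero_of_mem_coset {b : Module.Basis (Fin r) F V} {i : Fin r} {w : V}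
    (hw : w ∈ coset b i) : w ≠ 0 := by
  rintro rfl
  simp [mem_coset] at hw

lemma card_coset (b : Module.Basis (Fin r) F V) (i : Fin r) :
    (coset b i).card = Nat.card F ^ (i : ℕ) := by
  have h : (coset b i) = (Set.toFinite (b.flag i.castSucc : Set V)).toFinset.map
      (addLeftEmbedding (b i)) := by
    ext w
    simp only [mem_coset, Finset.mem_map, Set.Finite.mem_toFinset, addLeftEmbedding_apply]
    exact ⟨fun h => ⟨_, h, by abel⟩, by rintro ⟨v, hv, rfl⟩; simpa using hv⟩
  have : Module.Finite F V := .of_basis b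
  rw [h, Finset.card_map, ← Set.ncard_eq_toFinset_card, ← Nat.card_coe_set_eq]
  refine (Module.natCard_eq_pow_finrank (K := F) (V := b.flag i.castSucc)).trans ?_
  rw [finrank_flag, Fin.val_castSucc]

lemma apply_mem_coset {b : Module.Basis (Fin r) F V} [Module.Finite F V] {g : V ≃ₗ[F] V}
    (hg : g ∈ unitriangular b) {i : Fin r} {w : V} (hw : w ∈ coset b i) : g w ∈ coset b i := by
  rw [mem_coset] at hw ⊢
  have h := add_mem (apply_mem b (φ := g.toLinearMap) hg _ hw) (hg i)
  simpa using h

/-- The images of the basis vectors under a unitriangular automorphism can be prescribed freely in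
the cosets. -/
lemma exists_mem_unitriangular [Module.Finite F V] (b : Module.Basis (Fin r) F V)
    (c : ∀ i, coset b i) : ∃ g ∈ unitriangular b, ∀ i, g (b i) = c i := by
  let φ : V →ₗ[F] V := b.constr F fun i => (c i : V)
  have hφ (i) : φ (b i) = c i := b.constr_basis F _ i
  have h (i) : φ (b i) - b i ∈ b.flag i.castSucc := by
    rw [hφ]
    exact mem_coset.mp (c i).2
  have hu : IsUnit φ := by
    have h1 := (isNilpotent_sub_id b h).isUnit_add_one
    rwa [show (φ - LinearMap.id : Module.End F V) + 1 = φ from sub_add_cancel φ _] at h1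
  exact ⟨LinearEquiv.ofBijective φ ((Module.End.isUnit_iff _).mp hu), h, hφ⟩

lemma card_pi_coset (b : Module.Basis (Fin r) F V) :
    Nat.card (∀ i, coset b i) = Nat.card F ^ (r * (r - 1) / 2) := by
  rw [Nat.card_pi]
  simp only [Nat.card_eq_fintype_card, Fintype.card_coe, card_coset]
  rw [Finset.prod_pow_eq_pow_sum, Fin.sum_univ_eq_sum_range (fun i => i), Finset.sum_range_id]

/-- A lower bound for the order of the unitriangular group. -/
lemma card_pi_coset_le_card_unitriangular [Module.Finite F V] (b : Module.Basis (Fin r) F V) :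
    Nat.card (∀ i, coset b i) ≤ Nat.card (unitriangular b) := by
  choose g hg hgb using exists_mem_unitriangular b
  have : Finite (V ≃ₗ[F] V) := Finite.of_injective _ DFunLike.coe_injective
  refine Nat.card_le_card_of_injective (fun c => (⟨g c, hg c⟩ : unitriangular b)) fun c c' h => ?_
  have h1 : g c = g c' := congrArg Subtype.val h
  exact funext fun i => Subtype.ext (by rw [← hgb, h1, hgb])

end Coset

end Flag

/-! ### Moore determinants and Dickson polynomials -/

namespace Moore

open Polynomial

section Roots

variable {F K V : Type*} [Field F] [Field K] [Algebra F K] [AddCommGroup V] [Module F V] {n : ℕ}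

/-- The factors of the Moore determinant do not vanish. -/
lemma det_moore_factor_ne_zero {x : Fin n → K} (hx : LinearIndependent F x) (i : Fin n)
    (c : Fin i → F) : x i - ∑ j, c j • x (j.castLE i.is_lt.le) ≠ 0 := by
  intro h
  refine hx.notMem_span_image (s := {j | j < i}) (x := i) (lt_irrefl i) ?_
  rw [sub_eq_zero.mp h]
  exact sum_mem fun j _ => Submodule.smul_mem _ _ (Submodule.subset_span ⟨_, j.2, rfl⟩)

lemma linearIndependent_comp (b : Module.Basis (Fin n) F V) {φ : V →ₗ[F] K}
    (hφ : Function.Injective φ) : LinearIndependent F fun i => φ (b i) :=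
  b.linearIndependent.map' φ (LinearMap.ker_eq_bot.mpr hφ)

/-- The monic polynomial whose roots are the elements of (the image of) `V`. -/
noncomputable def dicksonPoly [Fintype V] (φ : V →ₗ[F] K) : K[X] := ∏ v, (X - C (φ v))

lemma dickson_monic [Fintype V] (φ : V →ₗ[F] K) : (dicksonPoly φ).Monic :=
  monic_prod_of_monic _ _ fun _ _ => monic_X_sub_C _

lemma natDegree_dickson [Fintype V] (φ : V →ₗ[F] K) :
    (dicksonPoly φ).natDegree = Fintype.card V := by
  rw [dicksonPoly, natDegree_prod_of_monic _ _ fun c _ => monic_X_sub_C _]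
  simp

lemma coeff_card_dickson [Fintype V] (φ : V →ₗ[F] K) :
    (dicksonPoly φ).coeff (Fintype.card V) = 1 := by
  rw [← natDegree_dickson φ]
  exact dickson_monic φ

/-- Inverting the roots of a polynomial reverses its coefficients. -/
lemma coeff_prod_X_sub_C_inv {ι : Type*} (s : Finset ι) (a : ι → K) (ha : ∀ i ∈ s, a i ≠ 0)
    {k : ℕ} (hk : k ≤ s.card) :
    (∏ i ∈ s, (X - C (a i))).coeff 0 * (∏ i ∈ s, (X - C (a i)⁻¹)).coeff k =
      (∏ i ∈ s, (X - C (a i))).coeff (s.card - k) := by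
  classical
  have hrev : (∏ i ∈ s, (X - C (a i))).reverse =
      C ((∏ i ∈ s, (X - C (a i))).coeff 0) * ∏ i ∈ s, (X - C (a i)⁻¹) := by
    clear hk
    induction s using Finset.induction_on with
    | empty => simpa using reverse_C (1 : K)
    | insert i s hi ih =>
      have hi0 : a i ≠ 0 := ha i (Finset.mem_insert_self _ _)
      have h1 : (X - C (a i)).reverse = C (-a i) * (X - C (a i)⁻¹) := by
        ext k
        rw [coeff_reverse, natDegree_X_sub_C, coeff_C_mul]
        match k with
        | 0 => simp [revAt_le, hi0]
        | 1 => simp [revAt_le]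
        | k + 2 =>
          rw [← revAtFun_eq, revAtFun, if_neg (by omega)]
          simp [coeff_X]
      rw [Finset.prod_insert hi, Finset.prod_insert hi, reverse_mul_of_domain, h1,
        ih fun j hj => ha j (Finset.mem_insert_of_mem hj), mul_coeff_zero, C_mul]
      simp only [coeff_sub, coeff_X_zero, coeff_C_zero, zero_sub]
      ring
  have hdeg : (∏ i ∈ s, (X - C (a i))).natDegree = s.card := by
    rw [natDegree_prod_of_monic _ _ fun c _ => monic_X_sub_C _]
    simp
  rw [← coeff_C_mul, ← hrev, coeff_reverse, hdeg, revAt_le hk]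

end Roots

variable {F K : Type*} [Fintype F] [Field K] {n : ℕ}

variable (F) in
/-- The Moore matrix of `x`, with rows `x i, x i ^ q, x i ^ q ^ 2, …`, where `q` is the order
of `F`. -/
def moore (x : Fin n → K) : Matrix (Fin n) (Fin n) K :=
  .of fun i j => x i ^ Fintype.card F ^ (j : ℕ)

variable (F) in
/-- The coefficients in the expansion along the last row of the Moore determinant of a family
extending `x` by one element. -/
noncomputable def mooreCoeff (x : Fin n → K) (j : Fin (n + 1)) : K :=
  (-1) ^ (n + j : ℕ) * (Matrix.of fun i k => x i ^ Fintype.card F ^ (j.succAbove k : ℕ)).det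

variable (F) in
/-- The Moore determinant of a family extending `x` by one element, as a polynomial in this
element. -/
noncomputable def moorePoly (x : Fin n → K) : K[X] :=
  ∑ j, C (mooreCoeff F x j) * X ^ Fintype.card F ^ (j : ℕ)

lemma eval_moorePoly (x : Fin n → K) (y : K) :
    (moorePoly F x).eval y = (moore F (Fin.snoc x y : Fin (n + 1) → K)).det := by
  rw [Matrix.det_succ_row _ (Fin.last n), moorePoly, eval_finsetSum]
  refine Finset.sum_congr rfl fun j _ => ?_
  have h : (moore F (Fin.snoc x y : Fin (n + 1) → K)).submatrix (Fin.last n).succAbove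
      j.succAbove = .of fun i k => x i ^ Fintype.card F ^ (j.succAbove k : ℕ) := by
    ext i k
    simp [moore]
  rw [h]
  simp only [mooreCoeff, moore, Matrix.of_apply, Fin.snoc_last, Fin.val_last, eval_mul, eval_C,
    eval_pow, eval_X]
  ring

lemma eval_moorePoly_self (x : Fin n → K) (i : Fin n) : (moorePoly F x).eval (x i) = 0 := by
  rw [eval_moorePoly]
  refine Matrix.det_zero_of_row_eq i.castSucc_lt_last.ne ?_
  ext j
  simp [moore]

lemma coeff_moorePoly_eq_zero (x : Fin n → K) {k : ℕ}
    (hk : ∀ j : Fin (n + 1), k ≠ Fintype.card F ^ (j : ℕ)) : (moorePoly F x).coeff k = 0 := by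
  rw [moorePoly, finsetSum_coeff]
  exact Finset.sum_eq_zero fun j _ => by rw [coeff_C_mul, coeff_X_pow, if_neg (hk j), mul_zero]

lemma mooreCoeff_last (x : Fin n → K) : mooreCoeff F x (Fin.last n) = (moore F x).det := by
  simp [mooreCoeff, moore, ← two_mul]

variable [Field F]

lemma coeff_moorePoly (x : Fin n → K) (j : Fin (n + 1)) :
    (moorePoly F x).coeff (Fintype.card F ^ (j : ℕ)) = mooreCoeff F x j := by
  rw [moorePoly, finsetSum_coeff, Finset.sum_eq_single j]
  · simp
  · intro k _ hk
    rw [coeff_C_mul, coeff_X_pow, if_neg, mul_zero]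
    exact fun h => hk (Fin.ext (Nat.pow_right_injective Fintype.one_lt_card h).symm)
  · simp

variable [Algebra F K]

lemma frobenius_pow_apply (j : ℕ) (y : K) :
    (FiniteField.frobeniusAlgHom F K ^ j) y = y ^ Fintype.card F ^ j := by
  induction j with
  | zero => simp
  | succ j ih => rw [pow_succ', AlgHom.mul_apply, ih, FiniteField.frobeniusAlgHom_apply, ← pow_mul,
      pow_succ]

/-- All exponents of `moorePoly` are powers of the order of `F`, so evaluating it is `F`-linear. -/
lemma eval_moorePoly_sum (x : Fin n → K) {ι : Type*} (s : Finset ι) (c : ι → F) (z : ι → K) :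
    (moorePoly F x).eval (∑ i ∈ s, c i • z i) = ∑ i ∈ s, c i • (moorePoly F x).eval (z i) := by
  simp only [moorePoly, eval_finsetSum, eval_mul, eval_C, eval_pow, eval_X, Finset.smul_sum]
  rw [Finset.sum_comm]
  refine Finset.sum_congr rfl fun j _ => ?_
  rw [← frobenius_pow_apply, map_sum, Finset.mul_sum]
  refine Finset.sum_congr rfl fun i _ => ?_
  rw [map_smul, frobenius_pow_apply, mul_smul_comm]

/-- The lowest coefficient is the determinant of the Frobenius twist of the Moore matrix. -/
lemma mooreCoeff_zero (x : Fin n → K) :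
    mooreCoeff F x 0 = (-1) ^ n * (moore F x).det ^ Fintype.card F := by
  have h : (Matrix.of fun i k => x i ^ Fintype.card F ^ ((0 : Fin (n + 1)).succAbove k : ℕ)) =
      (FiniteField.frobeniusAlgHom F K).mapMatrix (moore F x) := by
    ext i k
    simp [moore, pow_succ, pow_mul]
  rw [mooreCoeff, h, ← AlgHom.map_det]
  simp

/-- The roots of `moorePoly F x` are the `F`-linear combinations of `x`. -/
theorem moorePoly_eq {x : Fin n → K} (hx : LinearIndependent F x) :
    moorePoly F x = C (moore F x).det * ∏ c : Fin n → F, (X - C (∑ i, c i • x i)) := by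
  classical
  set N := Fintype.card F ^ n
  have hN : Fintype.card (Fin n → F) = N := by simp [N]
  have hinj : Function.Injective fun c : Fin n → F => ∑ i, c i • x i :=
    fun c c' h => funext (Fintype.linearIndependent_iffₛ.mp hx c c' h)
  set Q := ∏ c : Fin n → F, (X - C (∑ i, c i • x i))
  have hQm : Q.Monic := monic_prod_of_monic _ _ fun c _ => monic_X_sub_C _
  have hQd : Q.natDegree = N := by
    rw [natDegree_prod_of_monic _ _ fun c _ => monic_X_sub_C _]
    simp only [natDegree_X_sub_C, Finset.sum_const, Finset.card_univ, hN, smul_eq_mul, mul_one]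
  have hlt : (moorePoly F x - C (moore F x).det * Q).degree <
      (Finset.univ.image fun c : Fin n → F => ∑ i, c i • x i).card := by
    rw [Finset.card_image_of_injective _ hinj, Finset.card_univ, hN, degree_lt_iff_coeff_zero]
    intro m hm
    rw [coeff_sub, coeff_C_mul]
    obtain rfl | hm := hm.eq_or_lt
    · have h1 := coeff_moorePoly (F := F) x (Fin.last n)
      rw [Fin.val_last, mooreCoeff_last] at h1
      rw [h1, ← hQd, hQm.coeff_natDegree, mul_one, sub_self]
    · rw [coeff_eq_zero_of_natDegree_lt (hQd.trans_lt hm), coeff_moorePoly_eq_zero, mul_zero,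
        sub_zero]
      exact fun j => ((Nat.pow_le_pow_right Fintype.card_pos (Fin.is_le j)).trans_lt hm).ne'
  refine eq_of_degree_sub_lt_of_eval_finset_eq _ hlt fun y hy => ?_
  obtain ⟨c, -, rfl⟩ := Finset.mem_image.mp hy
  rw [eval_moorePoly_sum, Finset.sum_eq_zero fun i _ => by rw [eval_moorePoly_self, smul_zero],
    eval_mul, eval_prod, Finset.prod_eq_zero (Finset.mem_univ c)
      (by rw [eval_sub, eval_X, eval_C, sub_self]), mul_zero]

/-- The Moore determinant is a product of linear combinations of `x`, one from each line. -/
theorem det_moore_eq_prod {x : Fin n → K} (hx : LinearIndependent F x) :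
    (moore F x).det =
      ∏ i : Fin n, ∏ c : Fin i → F, (x i - ∑ j, c j • x (j.castLE i.is_lt.le)) := by
  induction n with
  | zero => simp
  | succ n ih =>
    have h0 : LinearIndependent F (Fin.init x) := hx.comp _ (Fin.castSucc_injective n)
    have h1 := ih h0
    conv_lhs => rw [← Fin.snoc_init_self x]
    rw [← eval_moorePoly, moorePoly_eq h0,
      eval_mul, eval_C, eval_prod, Fin.prod_univ_castSucc]
    congr 1
    exact Finset.prod_congr rfl fun c _ => by rw [eval_sub, eval_X, eval_C]; rfl

lemma det_moore_ne_zero {x : Fin n → K} (hx : LinearIndependent F x) : (moore F x).det ≠ 0 := by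
  rw [det_moore_eq_prod hx]
  exact Finset.prod_ne_zero_iff.mpr fun i _ => Finset.prod_ne_zero_iff.mpr fun c _ =>
    det_moore_factor_ne_zero hx i c

lemma map_det_moore (σ : K ≃ₐ[F] K) (x : Fin n → K) :
    σ (moore F x).det = (moore F fun i => σ (x i)).det := by
  refine (AlgEquiv.map_det σ _).trans (congrArg Matrix.det ?_)
  ext i j
  exact map_pow σ _ _

variable {V : Type*} [AddCommGroup V] [Module F V]

/-- The Moore determinant is semi-invariant: it is multiplied by the determinant of `g`. -/
lemma det_moore_comp (φ : V →ₗ[F] K) (b : Module.Basis (Fin n) F V) (g : V →ₗ[F] V) :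
    (moore F fun i => φ (g (b i))).det =
      algebraMap F K (LinearMap.det g) * (moore F fun i => φ (b i)).det := by
  have h : (moore F fun i => φ (g (b i))) =
      ((algebraMap F K).mapMatrix (LinearMap.toMatrix b b g)).transpose *
        moore F fun i => φ (b i) := by
    ext i j
    rw [Matrix.mul_apply]
    simp only [moore, Matrix.of_apply, Matrix.transpose_apply, RingHom.mapMatrix_apply,
      Matrix.map_apply]
    rw [← b.sum_repr (g (b i)), map_sum, ← frobenius_pow_apply, map_sum]
    refine Finset.sum_congr rfl fun k _ => ?_
    rw [map_smul, map_smul, frobenius_pow_apply, LinearMap.toMatrix_apply, Algebra.smul_def]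
  rw [h, Matrix.det_mul, Matrix.det_transpose, ← RingHom.map_det, LinearMap.det_toMatrix]

variable [Fintype V]

lemma moorePoly_eq_dickson (b : Module.Basis (Fin n) F V) {φ : V →ₗ[F] K}
    (hφ : Function.Injective φ) :
    moorePoly F (fun i => φ (b i)) = C (moore F fun i => φ (b i)).det * dicksonPoly φ := by
  rw [moorePoly_eq (linearIndependent_comp b hφ), dicksonPoly]
  congr 1
  refine Fintype.prod_equiv b.equivFun.symm.toEquiv _ _ fun c => ?_
  simp [Module.Basis.equivFun_symm_apply]

/-- The Dickson polynomial is additive: only powers of the order of `F` occur as exponents. -/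
lemma coeff_dickson_eq_zero (b : Module.Basis (Fin n) F V) {φ : V →ₗ[F] K}
    (hφ : Function.Injective φ) {k : ℕ} (hk : ∀ j : Fin (n + 1), k ≠ Fintype.card F ^ (j : ℕ)) :
    (dicksonPoly φ).coeff k = 0 := by
  have h := coeff_moorePoly_eq_zero (fun i => φ (b i)) hk
  rw [moorePoly_eq_dickson b hφ, coeff_C_mul] at h
  exact (mul_eq_zero.mp h).resolve_left (det_moore_ne_zero (linearIndependent_comp b hφ))

/-- The lowest coefficient of the Dickson polynomial is a power of the Moore determinant, up to
sign. -/
lemma coeff_one_dickson (b : Module.Basis (Fin n) F V) {φ : V →ₗ[F] K}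
    (hφ : Function.Injective φ) :
    (dicksonPoly φ).coeff 1 = (-1) ^ n * (moore F fun i => φ (b i)).det ^ (Fintype.card F - 1) := by
  have h := coeff_moorePoly (F := F) (fun i => φ (b i)) 0
  rw [moorePoly_eq_dickson b hφ, coeff_C_mul, mooreCoeff_zero, Fin.val_zero, pow_zero] at h
  refine mul_left_cancel₀ (det_moore_ne_zero (linearIndependent_comp b hφ)) (h.trans ?_)
  conv_lhs => rw [← Nat.sub_add_cancel (Fintype.card_pos (α := F)), pow_succ]
  ring

end Moore

/-! ### Invariant rings that are polynomial rings -/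

section PolynomialInvariants

open scoped IntermediateField.algebraAdjoinAdjoin

variable {F A K : Type u} [Field F] [CommRing A] [Algebra F A] [Field K] [Algebra F K]
  [Algebra A K] [IsScalarTower F A K] [IsFractionRing A K] {r : ℕ} {y : Fin r → A}

lemma trdeg_eq_of_isFractionRing [IsDomain A] : Algebra.trdeg F A = Algebra.trdeg F K := by
  have : Algebra.IsAlgebraic A K := IsLocalization.isAlgebraic K (nonZeroDivisors A)
  have : FaithfulSMul F A := (faithfulSMul_iff_algebraMap_injective F A).mpr
    (algebraMap F A).injective
  rw [← trdeg_add_eq F A (A := K), trdeg_eq_zero (R := A) (A := K), add_zero]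

/-- Elements over which `A` is integral are algebraically independent if their number is the
transcendence degree. -/
lemma algebraicIndependent_of_isIntegral [IsDomain A] (hr : Algebra.trdeg F A = r)
    (hint : Algebra.IsIntegral (Algebra.adjoin F (Set.range y)) A) :
    AlgebraicIndependent F y := by
  have : FaithfulSMul F A := (faithfulSMul_iff_algebraMap_injective F A).mpr
    (algebraMap F A).injective
  exact (Algebra.IsAlgebraic.isTranscendenceBasis_of_lift_le_trdeg_of_finite (R := F) (x := y)
    (by simp [hr])).1

/-- A polynomial ring is integrally closed, so elements of `A` which are rational functions of `y`
are polynomials in `y`. -/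
lemma exists_aeval_eq (hy : AlgebraicIndependent F y)
    (hint : Algebra.IsIntegral (Algebra.adjoin F (Set.range y)) A) {a : A}
    (ha : algebraMap A K a ∈ IntermediateField.adjoin F (Set.range fun i => algebraMap A K (y i))) :
    ∃ p : MvPolynomial (Fin r) F, MvPolynomial.aeval y p = a := by
  let z : Fin r → K := fun i => algebraMap A K (y i)
  let ψ : A →ₐ[F] K := IsScalarTower.toAlgHom F A K
  have hψ : Function.Injective ψ := IsFractionRing.injective A K
  have hz : AlgebraicIndependent F z := (ψ.algebraicIndependent_iff (x := y) hψ).mpr hy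
  have : IsIntegrallyClosed (Algebra.adjoin F (Set.range z)) :=
    .of_equiv hz.aevalEquiv.toRingEquiv
  have hmap (b : Algebra.adjoin F (Set.range y)) : ψ b ∈ Algebra.adjoin F (Set.range z) := by
    have h1 : (Algebra.adjoin F (Set.range y)).map ψ = Algebra.adjoin F (Set.range z) := by
      rw [AlgHom.map_adjoin, ← Set.range_comp]
      rfl
    rw [← h1]
    exact Subalgebra.mem_map.mpr ⟨b, b.2, rfl⟩
  let φ : Algebra.adjoin F (Set.range y) →+* Algebra.adjoin F (Set.range z) :=
    (AlgHom.codRestrict (ψ.comp (Algebra.adjoin F (Set.range y)).val) _ hmap).toRingHom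
  have h2 : IsIntegral (Algebra.adjoin F (Set.range z)) (ψ a) :=
    (hint.isIntegral a).map_of_comp_eq φ (ψ : A →+* K) rfl
  let x : IntermediateField.adjoin F (Set.range z) := ⟨ψ a, ha⟩
  have h3 : IsIntegral (Algebra.adjoin F (Set.range z)) x := by
    rw [← isIntegral_algebraMap_iff (B := K)
      (algebraMap (IntermediateField.adjoin F (Set.range z)) K).injective]
    exact h2
  obtain ⟨⟨c, hc⟩, hcx⟩ := IsIntegrallyClosed.isIntegral_iff.mp h3
  have h4 : c = ψ a := congrArg Subtype.val hcx
  rw [Algebra.adjoin_range_eq_range_aeval] at hc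
  obtain ⟨p, hp⟩ := hc
  refine ⟨p, hψ ?_⟩
  rw [← h4, ← hp]
  exact DFunLike.congr_fun (MvPolynomial.comp_aeval (f := y) ψ) p

end PolynomialInvariants

namespace Moore

open Polynomial

variable {F V K : Type*} [Field F] [AddCommGroup V] [Module F V] [Fintype V] [Field K] [Algebra F K]
  {φ : V →ₗ[F] K} {L : IntermediateField F K}

lemma exists_map_eq_dickson (hL : ∀ k, (dicksonPoly φ).coeff k ∈ L) :
    ∃ p : L[X], p.map (algebraMap L K) = dicksonPoly φ := by
  have h := (lifts_iff_coeff_lifts (f := algebraMap L K) (dicksonPoly φ)).mpr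
    fun n => ⟨⟨_, hL n⟩, rfl⟩
  exact (mem_lifts _).mp h

lemma eval_dickson_eq_zero_iff {x : K} : (dicksonPoly φ).eval x = 0 ↔ x ∈ Set.range φ := by
  rw [dicksonPoly, eval_prod, Finset.prod_eq_zero_iff]
  simp only [Finset.mem_univ, true_and, eval_sub, eval_X, eval_C, sub_eq_zero, Set.mem_range]
  exact exists_congr fun v => eq_comm

/-- The field `K` generated by `V` is the splitting field of the Dickson polynomial over any
subfield that contains its coefficients. -/
lemma isGalois_of_coeff_dickson_mem (hφ : Function.Injective φ)
    (hgen : IntermediateField.adjoin F (Set.range φ) = ⊤) (hL : ∀ k, (dicksonPoly φ).coeff k ∈ L) :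
    FiniteDimensional L K ∧ IsGalois L K := by
  obtain ⟨p, hp⟩ := exists_map_eq_dickson hL
  have hsplit : IsSplittingField L K p := by
    refine isSplittingField_iff_intermediateField.mpr ⟨?_, ?_⟩
    · rw [hp]
      exact Splits.prod fun v _ => Splits.X_sub_C _
    · have hroot : Set.range φ ⊆ p.rootSet K := by
        intro x hx
        have hp0 : p ≠ 0 := by
          rintro rfl
          exact (dickson_monic φ).ne_zero (by rw [← hp, Polynomial.map_zero])
        rw [mem_rootSet_of_ne hp0, aeval_def, ← Polynomial.eval_map, hp]
        exact eval_dickson_eq_zero_iff.mpr hx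
      rw [← IntermediateField.restrictScalars_eq_top_iff (K := F), eq_top_iff, ← hgen]
      exact IntermediateField.adjoin_le_iff.mpr fun x hx =>
        IntermediateField.subset_adjoin L _ (hroot hx)
  have hsep : p.Separable := by
    rw [← separable_map (algebraMap L K), hp]
    exact separable_prod_X_sub_C_iff.mpr hφ
  exact ⟨IsSplittingField.finiteDimensional K p, IsGalois.of_separable_splitting_field hsep⟩

/-- A field automorphism fixing the coefficients of the Dickson polynomial permutes its roots, so it
comes from an automorphism of the vector space `V`. -/
lemma exists_linearEquiv_of_algEquiv (hφ : Function.Injective φ)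
    (hL : ∀ k, (dicksonPoly φ).coeff k ∈ L) (σ : K ≃ₐ[L] K) :
    ∃ g : V ≃ₗ[F] V, ∀ v, σ (φ v) = φ (g v) := by
  obtain ⟨p, hp⟩ := exists_map_eq_dickson hL
  have hmem (v : V) : σ (φ v) ∈ Set.range φ := by
    rw [← eval_dickson_eq_zero_iff, ← hp, Polynomial.eval_map, ← aeval_def, aeval_algEquiv,
      AlgHom.comp_apply, aeval_def, ← Polynomial.eval_map, hp,
      eval_dickson_eq_zero_iff.mpr ⟨v, rfl⟩]
    exact map_zero _
  let ψ : V →ₗ[F] LinearMap.range φ := LinearMap.codRestrict _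
    (((σ.restrictScalars F : K ≃ₐ[F] K).toLinearMap) ∘ₗ φ) hmem
  let g : V →ₗ[F] V := (LinearEquiv.ofInjective φ hφ).symm.toLinearMap ∘ₗ ψ
  have hg (v) : φ (g v) = σ (φ v) := by
    have h := (LinearEquiv.ofInjective φ hφ).apply_symm_apply (ψ v)
    exact congrArg Subtype.val h
  have hginj : Function.Injective g := fun v w h => hφ (σ.injective (by rw [← hg, ← hg, h]))
  exact ⟨LinearEquiv.ofBijective g (Finite.injective_iff_bijective.mp hginj), fun v => (hg v).symm⟩

/-- Galois correspondence: an element of `K` that is fixed by all automorphisms of `V` that fix a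
field `L` containing the coefficients of the Dickson polynomial lies in `L`. -/
theorem mem_of_forall_fixed (hφ : Function.Injective φ)
    (hgen : IntermediateField.adjoin F (Set.range φ) = ⊤) (hL : ∀ k, (dicksonPoly φ).coeff k ∈ L)
    {E : (V ≃ₗ[F] V) → (K ≃ₐ[F] K)} (hE : ∀ g v, E g (φ v) = φ (g v)) {x : K}
    (hx : ∀ g, (∀ y ∈ L, E g y = y) → E g x = x) : x ∈ L := by
  obtain ⟨hfin, hgal⟩ := isGalois_of_coeff_dickson_mem hφ hgen hL
  have h : x ∈ (⊥ : IntermediateField L K) := by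
    rw [IsGalois.mem_bot_iff_fixed]
    intro σ
    obtain ⟨g, hg⟩ := exists_linearEquiv_of_algEquiv hφ hL σ
    have h1 : E g = σ.restrictScalars F := by
      ext z
      have hz : z ∈ IntermediateField.adjoin F (Set.range φ) := hgen ▸ IntermediateField.mem_top
      induction hz using IntermediateField.adjoin_induction with
      | mem z hz =>
        obtain ⟨v, rfl⟩ := hz
        exact (hE g v).trans (hg v).symm
      | algebraMap c => rw [AlgEquiv.commutes, AlgEquiv.commutes]
      | add z w _ _ hz hw => rw [map_add, map_add, hz, hw]
      | inv z _ hz => rw [map_inv₀, map_inv₀, hz]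
      | mul z w _ _ hz hw => rw [map_mul, map_mul, hz, hw]
    have h2 := hx g fun y hy => by
      rw [h1]
      exact σ.commutes ⟨y, hy⟩
    rw [h1] at h2
    exact h2
  obtain ⟨y, rfl⟩ := IntermediateField.mem_bot.mp h
  exact y.2

end Moore

/-! ### Counting ranks and automorphisms -/

section Counting

open scoped Pointwise

/-- If each step of a filtration of `A` by subalgebras is generated, as a module over the previous
step, by a finite family, then the products of these families span `A`. -/
lemma span_range_prod_eq_top {B A : Type*} [CommRing B] [CommRing A] [Algebra B A] {r : ℕ}
    {κ : Fin r → Type*} (e : ∀ i, κ i → A) (M : Fin (r + 1) → Subalgebra B A)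
    (h0 : M 0 = ⊥) (hr : M (Fin.last r) = ⊤)
    (hM : ∀ i : Fin r, Subalgebra.toSubmodule (M i.succ) ≤
      Submodule.span B (Set.range (e i)) * Subalgebra.toSubmodule (M i.castSucc)) :
    Submodule.span B (Set.range fun c : ∀ i, κ i => ∏ i, e i (c i)) = ⊤ := by
  have key (k : Fin (r + 1)) : Subalgebra.toSubmodule (M k) ≤
      ∏ i : Fin r with i.castSucc < k, Submodule.span B (Set.range (e i)) := by
    induction k using Fin.induction with
    | zero => simp [h0, Algebra.toSubmodule_bot]
    | succ k ih =>
      refine (hM k).trans ?_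
      have h1 : (Finset.univ.filter fun i : Fin r => i.castSucc < k.succ) =
          insert k (Finset.univ.filter fun i : Fin r => i.castSucc < k.castSucc) := by
        ext i
        simp [Fin.castSucc_lt_succ_iff, le_iff_eq_or_lt]
      rw [h1, Finset.prod_insert (by simp)]
      exact mul_le_mul_right ih _
  have h2 := key (Fin.last r)
  rw [hr, Algebra.top_toSubmodule, Finset.filter_true_of_mem fun i _ => i.castSucc_lt_last,
    Submodule.prod_span] at h2
  refine eq_top_iff.mpr (h2.trans (Submodule.span_mono fun x hx => ?_))
  obtain ⟨g, hg, rfl⟩ := (Set.mem_finsetProd _ _ _).mp hx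
  choose c hc using fun i => hg (Finset.mem_univ i)
  exact ⟨c, Finset.prod_congr rfl fun i _ => hc i⟩

/-- An automorphism that fixes `S` fixes the field generated by `S`. -/
lemma apply_eq_of_mem_adjoin {F K : Type*} [Field F] [Field K] [Algebra F K] {σ : K ≃ₐ[F] K}
    {S : Set K} (h : ∀ x ∈ S, σ x = x) {x : K} (hx : x ∈ IntermediateField.adjoin F S) :
    σ x = x := by
  induction hx using IntermediateField.adjoin_induction with
  | mem x hx => exact h x hx
  | algebraMap c => exact σ.commutes c
  | add x y _ _ hx hy => rw [map_add, hx, hy]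
  | inv x _ hx => rw [map_inv₀, hx]
  | mul x y _ _ hx hy => rw [map_mul, hx, hy]

variable {F A K : Type u} [Field F] [CommRing A] [Algebra F A] [Field K] [Algebra F K]
  [Algebra A K] [IsScalarTower F A K] {r : ℕ} {y : Fin r → A}

lemma algebraMap_mem_adjoin_of_mem_adjoin {a : A} (ha : a ∈ Algebra.adjoin F (Set.range y)) :
    algebraMap A K a ∈
      IntermediateField.adjoin F (Set.range fun i => algebraMap A K (y i)) := by
  induction ha using Algebra.adjoin_induction with
  | mem a ha =>
    obtain ⟨i, rfl⟩ := ha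
    exact IntermediateField.subset_adjoin _ _ ⟨i, rfl⟩
  | algebraMap c =>
    rw [← IsScalarTower.algebraMap_apply]
    exact IntermediateField.algebraMap_mem _ c
  | add a b _ _ ha hb => rw [map_add]; exact add_mem ha hb
  | mul a b _ _ ha hb => rw [map_mul]; exact mul_mem ha hb

variable [IsDomain A] [IsFractionRing A K] {ι : Type*} [Finite ι] {e : ι → A}

/-- If `e` spans `A` over the subring generated by `y`, it spans the field of fractions of `A` over
the subfield generated by `y`. -/
lemma span_fractionField_eq_top
    (hspan : Submodule.span (Algebra.adjoin F (Set.range y)) (Set.range e) = ⊤) :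
    Submodule.span (IntermediateField.adjoin F (Set.range fun i => algebraMap A K (y i)))
      (Set.range fun i => algebraMap A K (e i)) = ⊤ := by
  set L := IntermediateField.adjoin F (Set.range fun i => algebraMap A K (y i))
  have hA (a : A) : algebraMap A K a ∈
      Submodule.span L (Set.range fun i => algebraMap A K (e i)) := by
    have ha : a ∈ Submodule.span (Algebra.adjoin F (Set.range y)) (Set.range e) :=
      hspan ▸ Submodule.mem_top
    induction ha using Submodule.span_induction with
    | mem a ha =>
      obtain ⟨i, rfl⟩ := ha
      exact Submodule.subset_span ⟨i, rfl⟩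
    | zero => rw [map_zero]; exact zero_mem _
    | add a b _ _ ha hb => rw [map_add]; exact add_mem ha hb
    | smul c a _ ha =>
      rw [Algebra.smul_def, map_mul]
      exact Submodule.smul_mem _ (⟨_, algebraMap_mem_adjoin_of_mem_adjoin c.2⟩ : L) ha
  have : Module.Finite (Algebra.adjoin F (Set.range y)) A :=
    ⟨⟨(Set.finite_range e).toFinset, by simpa using hspan⟩⟩
  refine eq_top_iff.mpr fun z _ => ?_
  obtain ⟨a, b, hb, rfl⟩ := IsFractionRing.div_surjective (A := A) z
  obtain ⟨c, d, hd, h⟩ := Algebra.IsAlgebraic.exists_smul_eq_mul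
    (Algebra.adjoin F (Set.range y)) a
    (nonZeroDivisors.ne_zero hb)
  have hb0 : algebraMap A K b ≠ 0 :=
    IsFractionRing.to_map_ne_zero_of_mem_nonZeroDivisors hb
  have hd0 : algebraMap A K d ≠ 0 := by
    rw [Ne, FaithfulSMul.algebraMap_eq_zero_iff]
    exact fun h => hd (Subtype.ext h)
  have h1 : algebraMap A K d * algebraMap A K a = algebraMap A K b * algebraMap A K c := by
    rw [← map_mul, ← map_mul, ← h, Algebra.smul_def]
    rfl
  have h2 : algebraMap A K a / algebraMap A K b = (algebraMap A K d)⁻¹ * algebraMap A K c := by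
    field_simp
    rw [mul_comm, h1, mul_comm]
  rw [h2]
  exact Submodule.smul_mem _
    (⟨_, inv_mem (algebraMap_mem_adjoin_of_mem_adjoin d.2)⟩ : L) (hA c)

variable {G : Type*} [Group G] {H : Subgroup G} {E : G → (K ≃ₐ[F] K)}

/-- If the group `H` fixes `y` and has at least as many elements as a family `e` spanning `A` over
the subring generated by `y`, then comparing both with the degree of the field extension shows
that `e` is linearly independent, and that only elements of the field generated by `y` are fixed
by `H`. -/
theorem linearIndependent_and_mem_of_card_le (hE : Function.Injective E)
    (hy : ∀ g ∈ H, ∀ i, E g (algebraMap A K (y i)) = algebraMap A K (y i))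
    (hspan : Submodule.span (Algebra.adjoin F (Set.range y)) (Set.range e) = ⊤)
    (hcard : Nat.card ι ≤ Nat.card H) :
    LinearIndependent (IntermediateField.adjoin F (Set.range fun i => algebraMap A K (y i)))
      (fun i => algebraMap A K (e i)) ∧
    ∀ x : K, (∀ g ∈ H, E g x = x) →
      x ∈ IntermediateField.adjoin F (Set.range fun i => algebraMap A K (y i)) := by
  have htop := span_fractionField_eq_top (K := K) hspan
  set L := IntermediateField.adjoin F (Set.range fun i => algebraMap A K (y i))
  have hfin : Module.Finite L K := ⟨⟨(Set.finite_range _).toFinset, by simpa using htop⟩⟩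
  have hfix (g : H) : E g ∈ L.fixingSubgroup := by
    rw [IntermediateField.mem_fixingSubgroup_iff]
    refine fun x hx => apply_eq_of_mem_adjoin ?_ hx
    rintro _ ⟨i, rfl⟩
    exact hy g g.2 i
  let τ (g : H) : K ≃ₐ[L] K := IntermediateField.fixingSubgroupEquiv L ⟨E g, hfix g⟩
  have hτ (g : H) (x : K) : τ g x = E g x := rfl
  have hτinj : Function.Injective τ := fun g h hgh =>
    Subtype.ext (hE (AlgEquiv.ext fun x => DFunLike.congr_fun hgh x))
  have := Fintype.ofFinite ι
  -- The chain `[K : L] ≤ |ι| ≤ |H| ≤ |Aut(K / L)| ≤ [K : L]` consists of equalities.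
  have h1 : Module.finrank L K ≤ Nat.card ι := by
    rw [Nat.card_eq_fintype_card, ← finrank_top L K, ← htop]
    exact finrank_range_le_card _
  have h2 : Nat.card H ≤ Nat.card (K ≃ₐ[L] K) := Nat.card_le_card_of_injective τ hτinj
  have h3 : Nat.card (K ≃ₐ[L] K) ≤ Module.finrank L K := by
    rw [Nat.card_eq_fintype_card]
    exact AlgEquiv.card_le
  have hτsurj : Function.Surjective τ :=
    (hτinj.bijective_of_nat_card_le (by omega)).2
  have := IsGalois.of_card_aut_eq_finrank L K (by omega)
  refine ⟨linearIndependent_of_top_le_span_of_card_eq_finrank htop.ge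
    (by rw [← Nat.card_eq_fintype_card]; omega), fun x hx => ?_⟩
  have h : x ∈ (⊥ : IntermediateField L K) := by
    rw [IsGalois.mem_bot_iff_fixed]
    intro σ
    obtain ⟨g, rfl⟩ := hτsurj σ
    exact hx g g.2
  obtain ⟨z, rfl⟩ := IntermediateField.mem_bot.mp h
  exact z.2

end Counting

/-! ### The rings `S_V` and `R_V` and their field of fractions -/

section Rings

variable {F V : Type u} [Field F] [AddCommGroup V] [Module F V]

variable (F V) in
/-- The embedding of `V` into `K_V`. -/
noncomputable def vecHom : V →ₗ[F] SymField F V :=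
  (IsScalarTower.toAlgHom F (SymRing F V) (SymField F V)).toLinearMap ∘ₗ SymmetricAlgebra.ι F V

lemma vecHom_apply (v : V) : vecHom F V v = vec v := rfl

lemma ι_injective : Function.Injective (SymmetricAlgebra.ι F V) := by
  obtain ⟨⟨κ, b⟩⟩ := Module.Free.exists_basis (R := F) (M := V)
  have h1 : LinearIndependent F (MvPolynomial.X : κ → MvPolynomial κ F) :=
    (MvPolynomial.algebraicIndependent_X κ F).linearIndependent
  have h2 : Function.Injective (b.constr F (MvPolynomial.X : κ → MvPolynomial κ F)) :=
    fun v w h => b.repr.injective (h1 (by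
      simpa [Finsupp.linearCombination_apply, Module.Basis.constr_apply] using h))
  have h3 (v : V) : SymmetricAlgebra.lift (b.constr F (MvPolynomial.X : κ → MvPolynomial κ F))
      (SymmetricAlgebra.ι F V v) = b.constr F (MvPolynomial.X : κ → MvPolynomial κ F) v := by
    simp
  exact fun v w h => h2 (by rw [← h3, ← h3, h])

lemma vecHom_injective : Function.Injective (vecHom F V) :=
  (injective_toSymField F V).comp ι_injective

lemma vec_ne_zero {v : V} (hv : v ≠ 0) : vec (F := F) v ≠ 0 :=
  fun h => hv (vecHom_injective (h.trans (map_zero _).symm))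

lemma mem_adjoin_ι (a : SymRing F V) :
    a ∈ Algebra.adjoin F (Set.range (SymmetricAlgebra.ι F V)) := by
  rw [← LinearMap.coe_range, adjoin_range_ι]
  exact Algebra.mem_top

lemma adjoin_range_vecHom : IntermediateField.adjoin F (Set.range (vecHom F V)) = ⊤ := by
  refine eq_top_iff.mpr fun z _ => ?_
  obtain ⟨a, b, -, rfl⟩ := IsFractionRing.div_surjective (A := SymRing F V) z
  have h (a : SymRing F V) : algebraMap (SymRing F V) (SymField F V) a ∈
      IntermediateField.adjoin F (Set.range (vecHom F V)) := by
    induction mem_adjoin_ι a using Algebra.adjoin_induction with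
    | mem a ha =>
      obtain ⟨v, rfl⟩ := ha
      exact IntermediateField.subset_adjoin _ _ ⟨v, rfl⟩
    | algebraMap c =>
      rw [← IsScalarTower.algebraMap_apply]
      exact IntermediateField.algebraMap_mem _ c
    | add a b _ _ ha hb => rw [map_add]; exact add_mem ha hb
    | mul a b _ _ ha hb => rw [map_mul]; exact mul_mem ha hb
  exact div_mem (h a) (h b)

/-- The reciprocal of a vector, as an element of `R_V`, with the convention `1/0 = 0`. -/
noncomputable def recip (v : V) : RecipRing F V :=
  ⟨(vec v)⁻¹, by
    by_cases hv : v = 0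
    · rw [hv, ← vecHom_apply, map_zero, inv_zero]
      exact zero_mem _
    · exact Algebra.subset_adjoin ⟨v, hv, rfl⟩⟩

lemma coe_recip (v : V) : (recip (F := F) v : SymField F V) = (vec v)⁻¹ := rfl

lemma mem_adjoin_recip (a : RecipRing F V) :
    a ∈ Algebra.adjoin F (recip '' {v : V | v ≠ 0} : Set (RecipRing F V)) := by
  have h : (recip '' {v : V | v ≠ 0} : Set (RecipRing F V)) = (↑) ⁻¹' recipSet F V := by
    ext x
    constructor
    · rintro ⟨v, hv, rfl⟩
      exact ⟨v, hv, rfl⟩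
    · rintro ⟨v, hv, hx⟩
      exact ⟨v, hv, Subtype.ext hx.symm⟩
  have h2 : Algebra.adjoin F ((↑) ⁻¹' recipSet F V : Set (RecipRing F V)) = ⊤ :=
    Algebra.adjoin_adjoin_coe_preimage
  rw [h, h2]
  exact Algebra.mem_top

instance : IsFractionRing (RecipRing F V) (SymField F V) := by
  refine IsFractionRing.of_field _ _ fun z => ?_
  have hz : z ∈ IntermediateField.adjoin F (recipSet F V) := by
    have h : (⊤ : IntermediateField F (SymField F V)) ≤
        IntermediateField.adjoin F (recipSet F V) := by
      rw [← adjoin_range_vecHom]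
      refine IntermediateField.adjoin_le_iff.mpr ?_
      rintro _ ⟨v, rfl⟩
      by_cases hv : v = 0
      · rw [hv, map_zero]
        exact zero_mem _
      · rw [← inv_inv (vecHom F V v)]
        exact inv_mem (IntermediateField.subset_adjoin _ _ ⟨v, hv, rfl⟩)
    exact h IntermediateField.mem_top
  obtain ⟨a, ha, b, hb, rfl⟩ := IntermediateField.mem_adjoin_iff_div.mp hz
  exact ⟨⟨a, ha⟩, ⟨b, hb⟩, rfl⟩

lemma trdeg_symRing {r : ℕ} (b : Module.Basis (Fin r) F V) : Algebra.trdeg F (SymRing F V) = r := by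
  have h := (SymmetricAlgebra.equivMvPolynomial b).lift_trdeg_eq
  simpa using h

/-- `R_V` has the same field of fractions as `S_V`. -/
lemma trdeg_recipRing {r : ℕ} (b : Module.Basis (Fin r) F V) :
    Algebra.trdeg F (RecipRing F V) = r := by
  rw [trdeg_eq_of_isFractionRing (K := SymField F V),
    ← trdeg_eq_of_isFractionRing (A := SymRing F V), trdeg_symRing b]

lemma ι_mem_symGrading (v : V) : SymmetricAlgebra.ι F V v ∈ symGrading F V 1 := by
  rw [symGrading, pow_one]
  exact LinearMap.mem_range_self _ v

lemma recip_mem_recipGrading (v : V) : recip v ∈ recipGrading F V 1 := by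
  rw [recipGrading, pow_one]
  by_cases hv : v = 0
  · have h : recip (F := F) v = 0 := by
      refine Subtype.ext ?_
      rw [coe_recip, hv, ← vecHom_apply, map_zero, inv_zero]
      rfl
    rw [h]
    exact zero_mem _
  · exact Submodule.subset_span ⟨v, hv, rfl⟩

lemma fieldEquiv_algebraMap (g : V ≃ₗ[F] V) (a : SymRing F V) :
    fieldEquiv g (algebraMap _ (SymField F V) a) = algebraMap _ (SymField F V) (symEquiv g a) := by
  simp [fieldEquiv]

lemma fieldEquiv_vecHom (g : V ≃ₗ[F] V) (v : V) :
    fieldEquiv g (vecHom F V v) = vecHom F V (g v) := by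
  rw [vecHom_apply, vec, fieldEquiv_algebraMap, symEquiv_ι]
  rfl

lemma fieldEquiv_injective : Function.Injective (fieldEquiv : (V ≃ₗ[F] V) → _) :=
  fun g h hgh => LinearEquiv.ext fun v => vecHom_injective (F := F)
    (by rw [← fieldEquiv_vecHom, hgh, fieldEquiv_vecHom])

lemma recipEquiv_recip (g : V ≃ₗ[F] V) (v : V) : recipEquiv g (recip v) = recip (g v) :=
  Subtype.ext (fieldEquiv_inv_vec g v)

variable (F V) in
/-- The action of `Aut(V)` on `S_V`. -/
noncomputable def symAction : (V ≃ₗ[F] V) →* (SymRing F V ≃ₐ[F] SymRing F V) where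
  toFun := symEquiv
  map_one' := by
    have h : (symEquiv (1 : V ≃ₗ[F] V)).toAlgHom = AlgHom.id F _ :=
      SymmetricAlgebra.algHom_ext (LinearMap.ext fun v => symEquiv_ι 1 v)
    exact AlgEquiv.ext fun a => DFunLike.congr_fun h a
  map_mul' g h := by
    have h : (symEquiv (g * h)).toAlgHom = (symEquiv g).toAlgHom.comp (symEquiv h).toAlgHom := by
      refine SymmetricAlgebra.algHom_ext (LinearMap.ext fun v => ?_)
      change symEquiv (g * h) _ = symEquiv g (symEquiv h _)
      rw [symEquiv_ι, symEquiv_ι, symEquiv_ι]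
      rfl
    exact AlgEquiv.ext fun a => DFunLike.congr_fun h a

lemma fieldEquiv_one : fieldEquiv (1 : V ≃ₗ[F] V) = 1 := by
  ext z
  obtain ⟨a, b, -, rfl⟩ := IsFractionRing.div_surjective (A := SymRing F V) z
  have h (a) : symEquiv (1 : V ≃ₗ[F] V) a = a := DFunLike.congr_fun (symAction F V).map_one a
  rw [map_div₀, fieldEquiv_algebraMap, fieldEquiv_algebraMap, h, h]
  rfl

lemma fieldEquiv_mul (g h : V ≃ₗ[F] V) : fieldEquiv (g * h) = fieldEquiv g * fieldEquiv h := by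
  ext z
  obtain ⟨a, b, -, rfl⟩ := IsFractionRing.div_surjective (A := SymRing F V) z
  have h (a) : symEquiv (g * h) a = symEquiv g (symEquiv h a) :=
    DFunLike.congr_fun ((symAction F V).map_mul g h) a
  rw [AlgEquiv.mul_apply, map_div₀, map_div₀, map_div₀, fieldEquiv_algebraMap,
    fieldEquiv_algebraMap, fieldEquiv_algebraMap, fieldEquiv_algebraMap, fieldEquiv_algebraMap,
    fieldEquiv_algebraMap, h, h]

variable (F V) in
/-- The action of `Aut(V)` on `R_V`. -/
noncomputable def recipAction : (V ≃ₗ[F] V) →* (RecipRing F V ≃ₐ[F] RecipRing F V) where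
  toFun := recipEquiv
  map_one' := AlgEquiv.ext fun a => Subtype.ext (DFunLike.congr_fun fieldEquiv_one a.1)
  map_mul' g h := AlgEquiv.ext fun a => Subtype.ext (DFunLike.congr_fun (fieldEquiv_mul g h) a.1)

end Rings

/-! ### Quotients whose invariant ring is a weighted polynomial ring -/

section Quotient

variable {F A : Type u} [Field F] [CommRing A] [Algebra F A] {r : ℕ} {y : Fin r → A}
  {𝒜 : ℕ → Submodule F A} [GradedAlgebra 𝒜] {w : Fin r → ℕ}

lemma aeval_mem_graded (hy : ∀ i, y i ∈ 𝒜 (w i)) {n : ℕ} {p : MvPolynomial (Fin r) F}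
    (hp : p ∈ MvPolynomial.weightedHomogeneousSubmodule F w n) : MvPolynomial.aeval y p ∈ 𝒜 n := by
  rw [MvPolynomial.aeval_def, MvPolynomial.eval₂_eq']
  refine sum_mem fun d hd => ?_
  rw [← Algebra.smul_def]
  refine Submodule.smul_mem _ _ ?_
  have h := hp (MvPolynomial.mem_support_iff.mp hd)
  rw [← h, Finsupp.weight_apply, Finsupp.sum_fintype _ _ (by simp)]
  exact SetLike.prod_mem_graded 𝒜 _ _ fun i _ => SetLike.pow_mem_graded _ (hy i)

/-- The graded homomorphism from a polynomial ring given by homogeneous elements `y`. -/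
noncomputable def aevalGraded {ℬ : ℕ → Submodule F (MvPolynomial (Fin r) F)}
    (hℬ : ∀ n, ∀ p ∈ ℬ n, p ∈ MvPolynomial.weightedHomogeneousSubmodule F w n)
    (hy : ∀ i, y i ∈ 𝒜 (w i)) : ℬ →+*ᵍ 𝒜 :=
  { (MvPolynomial.aeval y : MvPolynomial (Fin r) F →ₐ[F] A).toRingHom with
    map_mem := fun {n p} hp => aeval_mem_graded hy (hℬ n p hp) }

variable [IsDomain A] {K : Type u} [Field K] [Algebra F K] [Algebra A K] [IsScalarTower F A K]
  [IsFractionRing A K] {G : Type u} [Group G] {E : G →* (A ≃ₐ[F] A)} {H : Subgroup G}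
  {Ek : G → (K ≃ₐ[F] K)}

variable (𝒜 E H Ek w y) in
/-- Homogeneous elements `y` of `A` of degrees `w` which are invariant under `H`, over which `A` is
integral, and which generate the field of invariants of `H` in the field of fractions `K`. -/
structure GeneratesInvariants : Prop where
  mem_graded : ∀ i, y i ∈ 𝒜 (w i)
  isIntegral : Algebra.IsIntegral (Algebra.adjoin F (Set.range y)) A
  invariant : ∀ g ∈ H, ∀ i, E g (y i) = y i
  mem_adjoin : ∀ x : K, (∀ g ∈ H, Ek g x = x) →
    x ∈ IntermediateField.adjoin F (Set.range fun i => algebraMap A K (y i))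

/-- If the number of the elements `y` is the transcendence degree, then the ring of invariants is
the polynomial ring in `y`. -/
theorem GeneratesInvariants.isInvariantRing (hy : GeneratesInvariants y 𝒜 w E H Ek)
    {ℬ : ℕ → Submodule F (MvPolynomial (Fin r) F)}
    (hℬ : ∀ n, ∀ p ∈ ℬ n, p ∈ MvPolynomial.weightedHomogeneousSubmodule F w n)
    (hr : Algebra.trdeg F A = r)
    (hE : ∀ g a, Ek g (algebraMap A K a) = algebraMap A K (E g a)) :
    Function.Injective (aevalGraded hℬ hy.mem_graded) ∧
      ProjQuotient.IsInvariantRing (aevalGraded hℬ hy.mem_graded) E H := by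
  have halg := algebraicIndependent_of_isIntegral hr hy.isIntegral
  refine ⟨halg, fun a => ⟨fun ha => ?_, ?_⟩⟩
  · exact exists_aeval_eq (K := K) halg hy.isIntegral
      (hy.mem_adjoin _ fun g hg => by rw [hE, ha g hg])
  · rintro ⟨p, rfl⟩ g hg
    have h := DFunLike.congr_fun (MvPolynomial.comp_aeval (f := y) (E g : A →ₐ[F] A)) p
    refine h.trans ?_
    change MvPolynomial.aeval (fun i => E g (y i)) p = _
    rw [funext (hy.invariant g hg)]
    rfl

/-- The morphism to weighted projective space given by `y` is the quotient by `H`. -/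
theorem GeneratesInvariants.isQuotientBy [Finite H] (hy : GeneratesInvariants y 𝒜 w E H Ek)
    {ℬ : ℕ → Submodule F (MvPolynomial (Fin r) F)} [GradedAlgebra ℬ]
    (hℬ : ∀ n, ∀ p ∈ ℬ n, p ∈ MvPolynomial.weightedHomogeneousSubmodule F w n)
    (hr : Algebra.trdeg F A = r)
    (hE : ∀ g a, Ek g (algebraMap A K a) = algebraMap A K (E g a))
    (he : ∀ g n, ∀ a ∈ 𝒜 n, E g a ∈ 𝒜 n) (he' : ∀ g n, ∀ a ∈ 𝒜 n, (E g).symm a ∈ 𝒜 n) :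
    ∃ hf : ProjFunctor.PreservesRelevant (aevalGraded hℬ hy.mem_graded),
      ProjFunctor.projMap (aevalGraded hℬ hy.mem_graded) hf ≫ projToSpec ℬ = projToSpec 𝒜 ∧
      IsQuotientBy (fun g => projOfEquiv 𝒜 (E g) (he g) (he' g)) H
        (ProjFunctor.projMap (aevalGraded hℬ hy.mem_graded) hf) := by
  obtain ⟨hinj, hinvar⟩ := hy.isInvariantRing hℬ hr hE
  have hf := ProjQuotient.preservesRelevant hinj he hinvar
  exact ⟨hf, ProjQuotient.projMap_comp_projToSpec hf fun c => MvPolynomial.aeval_C y c,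
    ProjQuotient.isQuotientBy hf hinj hinvar he he'⟩

end Quotient

/-! ### Invariants of the general and special linear groups -/

namespace DicksonInvariants

open Polynomial Moore

variable {F V : Type u} [Field F] [AddCommGroup V] [Module F V] [Fintype V] {r : ℕ}

lemma isIntegral_of_adjoin_eq_top {A : Type*} [CommRing A] [Algebra F A] {B : Subalgebra F A}
    {S : Set A} (hS : ∀ a, a ∈ Algebra.adjoin F S) (h : ∀ a ∈ S, IsIntegral B a) :
    Algebra.IsIntegral B A := by
  refine ⟨fun a => ?_⟩
  induction hS a using Algebra.adjoin_induction with
  | mem a ha => exact h a ha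
  | algebraMap c =>
    rw [IsScalarTower.algebraMap_apply F B A]
    exact isIntegral_algebraMap
  | add a b _ _ ha hb => exact ha.add hb
  | mul a b _ _ ha hb => exact ha.mul hb

lemma isIntegral_of_coeff_mem {A : Type*} [CommRing A] [Nontrivial A] [Algebra F A]
    {B : Subalgebra F A} {p : A[X]} (hp : p.Monic) (hB : ∀ k, p.coeff k ∈ B) {a : A}
    (ha : p.eval a = 0) :
    IsIntegral B a := by
  have h := (lifts_iff_coeff_lifts (f := algebraMap B A) p).mpr fun n => ⟨⟨_, hB n⟩, rfl⟩
  obtain ⟨p', hp', -, hm⟩ := lifts_and_degree_eq_and_monic h hp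
  exact ⟨p', hm, by rw [← Polynomial.eval_map, hp', ha]⟩

section Sym

variable (F V) in
/-- The monic polynomial over `S_V` whose roots are the vectors of `V`. -/
noncomputable def symPoly : (SymRing F V)[X] := ∏ v : V, (X - C (SymmetricAlgebra.ι F V v))

lemma symPoly_monic : (symPoly F V).Monic := monic_prod_of_monic _ _ fun _ _ => monic_X_sub_C _

lemma map_symPoly : (symPoly F V).map (algebraMap _ (SymField F V)) = dicksonPoly (vecHom F V) := by
  rw [symPoly, dicksonPoly, Polynomial.map_prod]
  refine Finset.prod_congr rfl fun v _ => ?_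
  rw [Polynomial.map_sub, map_X, map_C]
  rfl

lemma algebraMap_coeff_symPoly (k : ℕ) :
    algebraMap _ (SymField F V) ((symPoly F V).coeff k) = (dicksonPoly (vecHom F V)).coeff k := by
  rw [← map_symPoly, coeff_map]

lemma coeff_symPoly_mem {k : ℕ} (hk : k ≤ Fintype.card V) :
    (symPoly F V).coeff k ∈ symGrading F V (Fintype.card V - k) := by
  have h := coeff_prod_X_sub_C_mem (𝒜 := symGrading F V) Finset.univ (SymmetricAlgebra.ι F V)
    (fun v _ => ι_mem_symGrading v) hk
  rwa [mul_one] at h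

lemma symEquiv_coeff_symPoly (g : V ≃ₗ[F] V) (k : ℕ) :
    symEquiv g ((symPoly F V).coeff k) = (symPoly F V).coeff k := by
  have h : (symPoly F V).map (symEquiv g : SymRing F V →+* SymRing F V) = symPoly F V := by
    rw [symPoly, Polynomial.map_prod]
    refine Fintype.prod_equiv g.toEquiv _ _ fun v => ?_
    rw [Polynomial.map_sub, map_X, map_C]
    congr 2
    exact symEquiv_ι g v
  conv_rhs => rw [← h, coeff_map]
  rfl

/-- Invariants `y` which generate the coefficients of the Dickson polynomial, and which are fixed by
no automorphisms of `V` outside `H`. -/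
lemma generatesInvariants_sym {H : Subgroup (V ≃ₗ[F] V)} {w : Fin r → ℕ} {y : Fin r → SymRing F V}
    (hw : ∀ i, y i ∈ symGrading F V (w i))
    (hcoeff : ∀ k, (symPoly F V).coeff k ∈ Algebra.adjoin F (Set.range y))
    (hinv : ∀ g ∈ H, ∀ i, symEquiv g (y i) = y i)
    (hH : ∀ g, (∀ i, symEquiv g (y i) = y i) → g ∈ H) :
    GeneratesInvariants y (symGrading F V) w (symAction F V) H
      (fieldEquiv : _ → (SymField F V ≃ₐ[F] SymField F V)) where
  mem_graded := hw
  invariant := hinv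
  isIntegral := by
    refine isIntegral_of_adjoin_eq_top mem_adjoin_ι ?_
    rintro _ ⟨v, rfl⟩
    refine isIntegral_of_coeff_mem symPoly_monic hcoeff ?_
    rw [symPoly, eval_prod, Finset.prod_eq_zero (Finset.mem_univ v)]
    rw [eval_sub, eval_X, eval_C, sub_self]
  mem_adjoin x hx := by
    refine mem_of_forall_fixed vecHom_injective adjoin_range_vecHom (fun k => ?_)
      fieldEquiv_vecHom fun g hg => hx g (hH g fun i => ?_)
    · rw [← algebraMap_coeff_symPoly]
      exact algebraMap_mem_adjoin_of_mem_adjoin (hcoeff k)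
    · refine injective_toSymField F V ?_
      exact (fieldEquiv_algebraMap g (y i)).symm.trans
        (hg _ (IntermediateField.subset_adjoin _ _ ⟨i, rfl⟩))

end Sym

section Recip

variable (F V) in
/-- The monic polynomial over `R_V` whose roots are the reciprocals of the nonzero vectors. -/
noncomputable def recipPoly [DecidableEq V] : (RecipRing F V)[X] :=
  ∏ v ∈ (Finset.univ : Finset V).erase 0, (X - C (recip v))

variable [DecidableEq V]

lemma recipPoly_monic : (recipPoly F V).Monic := monic_prod_of_monic _ _ fun _ _ => monic_X_sub_C _

lemma coeff_recipPoly_mem {k : ℕ} (hk : k ≤ Fintype.card V - 1) :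
    (recipPoly F V).coeff k ∈ recipGrading F V (Fintype.card V - 1 - k) := by
  have hc : ((Finset.univ : Finset V).erase 0).card = Fintype.card V - 1 :=
    Finset.card_erase_of_mem (Finset.mem_univ _)
  have h := coeff_prod_X_sub_C_mem (𝒜 := recipGrading F V) ((Finset.univ : Finset V).erase 0) recip
    (fun v _ => recip_mem_recipGrading v) (hc ▸ hk)
  rwa [mul_one, hc] at h

lemma recipEquiv_coeff_recipPoly (g : V ≃ₗ[F] V) (k : ℕ) :
    recipEquiv g ((recipPoly F V).coeff k) = (recipPoly F V).coeff k := by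
  have h : (recipPoly F V).map (recipEquiv g : RecipRing F V →+* RecipRing F V) =
      recipPoly F V := by
    rw [recipPoly, Polynomial.map_prod]
    refine Finset.prod_equiv g.toEquiv (fun v => by simp) fun v _ => ?_
    rw [Polynomial.map_sub, map_X, map_C]
    congr 2
    exact recipEquiv_recip g v
  conv_rhs => rw [← h, coeff_map]
  rfl

/-- The coefficients of the polynomial with roots `1/v` are those of the Dickson polynomial in
reverse order, divided by the product of all nonzero vectors. -/
lemma coeff_recipPoly_mul {k : ℕ} (hk : k ≤ Fintype.card V - 1) :
    ((recipPoly F V).coeff k : SymField F V) * (dicksonPoly (vecHom F V)).coeff 1 =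
      (dicksonPoly (vecHom F V)).coeff (Fintype.card V - k) := by
  have hc : ((Finset.univ : Finset V).erase 0).card = Fintype.card V - 1 :=
    Finset.card_erase_of_mem (Finset.mem_univ _)
  have hpos : 0 < Fintype.card V := Fintype.card_pos
  have hd : dicksonPoly (vecHom F V) =
      (∏ v ∈ (Finset.univ : Finset V).erase 0, (X - C (vecHom F V v))) * X := by
    rw [dicksonPoly, ← Finset.prod_erase_mul _ _ (Finset.mem_univ 0), map_zero, C_0, sub_zero]
  have hr : (recipPoly F V).map (algebraMap _ (SymField F V)) =
      ∏ v ∈ (Finset.univ : Finset V).erase 0, (X - C (vecHom F V v)⁻¹) := by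
    rw [recipPoly, Polynomial.map_prod]
    refine Finset.prod_congr rfl fun v _ => ?_
    rw [Polynomial.map_sub, map_X, map_C]
    rfl
  have h := coeff_prod_X_sub_C_inv ((Finset.univ : Finset V).erase 0) (vecHom F V)
    (fun v hv => vec_ne_zero (Finset.ne_of_mem_erase hv)) (hc ▸ hk)
  rw [← hr, coeff_map, hc] at h
  rw [hd, coeff_mul_X, show Fintype.card V - k = Fintype.card V - 1 - k + 1 by omega, coeff_mul_X,
    ← h, mul_comm]
  rfl

lemma coeff_one_ne_zero : (dicksonPoly (vecHom F V)).coeff 1 ≠ 0 := by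
  have h := coeff_recipPoly_mul (F := F) (V := V) (Nat.zero_le _)
  rw [Nat.sub_zero, coeff_card_dickson] at h
  exact right_ne_zero_of_mul_eq_one h

/-- Invariants `y` which generate the coefficients of the polynomial with roots `1/v`, and which are
fixed by no automorphisms of `V` outside `H`. -/
lemma generatesInvariants_recip {H : Subgroup (V ≃ₗ[F] V)} {w : Fin r → ℕ}
    {y : Fin r → RecipRing F V} (hw : ∀ i, y i ∈ recipGrading F V (w i))
    (hcoeff : ∀ k, (recipPoly F V).coeff k ∈ Algebra.adjoin F (Set.range y))
    (hinv : ∀ g ∈ H, ∀ i, recipEquiv g (y i) = y i)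
    (hH : ∀ g, (∀ i, recipEquiv g (y i) = y i) → g ∈ H) :
    GeneratesInvariants y (recipGrading F V) w (recipAction F V) H
      (fieldEquiv : _ → (SymField F V ≃ₐ[F] SymField F V)) where
  mem_graded := hw
  invariant := hinv
  isIntegral := by
    refine isIntegral_of_adjoin_eq_top mem_adjoin_recip ?_
    rintro _ ⟨v, hv, rfl⟩
    refine isIntegral_of_coeff_mem recipPoly_monic hcoeff ?_
    rw [recipPoly, eval_prod, Finset.prod_eq_zero (Finset.mem_erase.mpr ⟨hv, Finset.mem_univ v⟩)]
    rw [eval_sub, eval_X, eval_C, sub_self]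
  mem_adjoin x hx := by
    set L := IntermediateField.adjoin F (Set.range fun i => algebraMap _ (SymField F V) (y i))
    have hL (k : ℕ) : algebraMap _ (SymField F V) ((recipPoly F V).coeff k) ∈ L :=
      algebraMap_mem_adjoin_of_mem_adjoin (hcoeff k)
    have h1 : (dicksonPoly (vecHom F V)).coeff 1 ∈ L := by
      have h := coeff_recipPoly_mul (F := F) (V := V) (Nat.zero_le _)
      rw [Nat.sub_zero, coeff_card_dickson] at h
      rw [eq_inv_of_mul_eq_one_right h]
      exact inv_mem (hL 0)
    refine mem_of_forall_fixed vecHom_injective adjoin_range_vecHom (fun k => ?_)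
      fieldEquiv_vecHom fun g hg => hx g (hH g fun i => ?_)
    · obtain hk | hk := lt_or_ge (Fintype.card V) k
      · rw [coeff_eq_zero_of_natDegree_lt (by rwa [natDegree_dickson])]
        exact zero_mem _
      · obtain rfl | hk0 := Nat.eq_zero_or_pos k
        · have h0 : (dicksonPoly (vecHom F V)).coeff 0 = 0 := by
            rw [coeff_zero_eq_eval_zero]
            exact eval_dickson_eq_zero_iff.mpr ⟨0, map_zero _⟩
          rw [h0]
          exact zero_mem _
        · have h := coeff_recipPoly_mul (F := F) (V := V) (k := Fintype.card V - k) (by omega)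
          rw [Nat.sub_sub_self hk] at h
          rw [← h]
          exact mul_mem (hL _) h1
    · exact Subtype.ext (hg _ (IntermediateField.subset_adjoin _ _ ⟨i, rfl⟩))

end Recip

end DicksonInvariants

/-! ### Dickson invariants and determinants -/

namespace DicksonInvariants

open Polynomial Moore

variable {F V : Type u} [Field F] [Fintype F] [AddCommGroup V] [Module F V] {r : ℕ}

section Det

/-- One nonzero vector from each line in `V`: the vectors with last nonzero coordinate one. -/
noncomputable def lineVec (b : Module.Basis (Fin r) F V) (i : Fin r) (c : Fin i → F) : V :=
  b i - ∑ j, c j • b (j.castLE i.is_lt.le)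

/-- The product of the vectors `lineVec`, in `S_V`. In `K_V`, it is a Moore determinant. -/
noncomputable def symDet (b : Module.Basis (Fin r) F V) : SymRing F V :=
  ∏ i : Fin r, ∏ c : Fin i → F, SymmetricAlgebra.ι F V (lineVec b i c)

/-- The product of the reciprocals of the vectors `lineVec`, in `R_V`. -/
noncomputable def recipDet (b : Module.Basis (Fin r) F V) : RecipRing F V :=
  ∏ i : Fin r, ∏ c : Fin i → F, recip (lineVec b i c)

variable (b : Module.Basis (Fin r) F V)

lemma det_eq_prod_vec : (moore F fun i => vecHom F V (b i)).det =
    ∏ i : Fin r, ∏ c : Fin i → F, vec (lineVec b i c) := by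
  rw [det_moore_eq_prod (linearIndependent_comp b vecHom_injective)]
  refine Finset.prod_congr rfl fun i _ => Finset.prod_congr rfl fun c _ => ?_
  rw [← vecHom_apply, lineVec, map_sub, map_sum]
  simp only [map_smul]

lemma det_ne_zero : (moore F fun i => vecHom F V (b i)).det ≠ 0 :=
  det_moore_ne_zero (linearIndependent_comp b vecHom_injective)

lemma algebraMap_symDet : algebraMap _ (SymField F V) (symDet b) =
    (moore F fun i => vecHom F V (b i)).det := by
  simp only [det_eq_prod_vec, symDet, map_prod, vec]

lemma algebraMap_recipDet : algebraMap _ (SymField F V) (recipDet b) =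
    (moore F fun i => vecHom F V (b i)).det⁻¹ := by
  simp only [det_eq_prod_vec, recipDet, map_prod, ← Finset.prod_inv_distrib]
  rfl

lemma sum_card_fun : ∑ i : Fin r, ∑ _c : Fin i → F, 1 =
    (Fintype.card F ^ r - 1) / (Fintype.card F - 1) := by
  simp only [Finset.sum_const, Finset.card_univ, Fintype.card_fun, Fintype.card_fin, smul_eq_mul,
    mul_one]
  rw [Fin.sum_univ_eq_sum_range (fun i => Fintype.card F ^ i)]
  exact Nat.geomSum_eq Fintype.one_lt_card r

lemma symDet_mem :
    symDet b ∈ symGrading F V ((Fintype.card F ^ r - 1) / (Fintype.card F - 1)) := by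
  rw [← sum_card_fun]
  exact SetLike.prod_mem_graded _ _ _ fun i _ => SetLike.prod_mem_graded _ _ _ fun c _ =>
    ι_mem_symGrading _

lemma recipDet_mem :
    recipDet b ∈ recipGrading F V ((Fintype.card F ^ r - 1) / (Fintype.card F - 1)) := by
  rw [← sum_card_fun]
  exact SetLike.prod_mem_graded _ _ _ fun i _ => SetLike.prod_mem_graded _ _ _ fun c _ =>
    recip_mem_recipGrading _

lemma fieldEquiv_det (g : V ≃ₗ[F] V) :
    fieldEquiv g (moore F fun i => vecHom F V (b i)).det =
      algebraMap F _ (LinearEquiv.det g : F) * (moore F fun i => vecHom F V (b i)).det := by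
  rw [LinearEquiv.coe_det, ← det_moore_comp, map_det_moore]
  simp only [fieldEquiv_vecHom, LinearEquiv.coe_coe]

lemma fieldEquiv_det_eq_iff (g : V ≃ₗ[F] V) :
    fieldEquiv g (moore F fun i => vecHom F V (b i)).det =
        (moore F fun i => vecHom F V (b i)).det ↔
      g ∈ detOneSubgroup F V := by
  rw [fieldEquiv_det, mul_eq_right₀ (det_ne_zero b), FaithfulSMul.algebraMap_eq_one_iff,
    detOneSubgroup, MonoidHom.mem_ker, Units.val_eq_one]

lemma symEquiv_symDet_eq_iff (g : V ≃ₗ[F] V) :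
    symEquiv g (symDet b) = symDet b ↔ g ∈ detOneSubgroup F V := by
  rw [← fieldEquiv_det_eq_iff b, ← algebraMap_symDet, fieldEquiv_algebraMap]
  exact (injective_toSymField F V).eq_iff.symm

lemma recipEquiv_recipDet_eq_iff (g : V ≃ₗ[F] V) :
    recipEquiv g (recipDet b) = recipDet b ↔ g ∈ detOneSubgroup F V := by
  have h : ((recipDet b : RecipRing F V) : SymField F V) = _ := algebraMap_recipDet b
  rw [← fieldEquiv_det_eq_iff b, Subtype.ext_iff, recipEquiv_coe, h, map_inv₀, inv_inj]

end Det

variable [Fintype V]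

lemma card_eq_pow (b : Module.Basis (Fin r) F V) : Fintype.card V = Fintype.card F ^ r := by
  rw [Module.card_fintype b, Fintype.card_fin]

section Sym

/-- The coefficients of `symPoly` other than the Dickson invariants are `0` or `1`. -/
lemma coeff_symPoly_mem_of_forall (b : Module.Basis (Fin r) F V) {B : Subalgebra F (SymRing F V)}
    (h : ∀ j : Fin r, (symPoly F V).coeff (Fintype.card F ^ (j : ℕ)) ∈ B) (k : ℕ) :
    (symPoly F V).coeff k ∈ B := by
  have hinj := injective_toSymField F V
  by_cases hk : ∃ j : Fin (r + 1), k = Fintype.card F ^ (j : ℕ)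
  · obtain ⟨j, rfl⟩ := hk
    induction j using Fin.lastCases with
    | last =>
      have h1 : (symPoly F V).coeff (Fintype.card F ^ r) = 1 := by
        refine hinj ((algebraMap_coeff_symPoly _).trans ?_)
        rw [← card_eq_pow b, coeff_card_dickson, map_one]
      rw [Fin.val_last, h1]
      exact one_mem _
    | cast j => exact h j
  · have h0 : (symPoly F V).coeff k = 0 := by
      refine hinj ((algebraMap_coeff_symPoly _).trans ?_)
      rw [coeff_dickson_eq_zero b vecHom_injective (not_exists.mp hk), map_zero]
    rw [h0]
    exact zero_mem _

lemma coeff_symPoly_one (b : Module.Basis (Fin r) F V) :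
    (symPoly F V).coeff 1 = (-1) ^ r * symDet b ^ (Fintype.card F - 1) := by
  refine injective_toSymField F V ((algebraMap_coeff_symPoly _).trans ?_)
  rw [coeff_one_dickson b vecHom_injective, ← algebraMap_symDet]
  simp

lemma coeff_symPoly_pow_mem (b : Module.Basis (Fin r) F V) (i : Fin r) :
    (symPoly F V).coeff (Fintype.card F ^ (i : ℕ)) ∈
      symGrading F V (Fintype.card F ^ r - Fintype.card F ^ (i : ℕ)) := by
  rw [← card_eq_pow b]
  refine coeff_symPoly_mem ?_
  rw [card_eq_pow b]
  exact Nat.pow_le_pow_right Fintype.card_pos i.is_lt.le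

/-- Dickson's theorem on the invariants of the general linear group. -/
theorem generatesInvariants_sym_top (b : Module.Basis (Fin r) F V) : GeneratesInvariants
    (fun i : Fin r => (symPoly F V).coeff (Fintype.card F ^ (i : ℕ))) (symGrading F V)
    (fun i => Fintype.card F ^ r - Fintype.card F ^ (i : ℕ)) (symAction F V) ⊤
    (fieldEquiv : _ → (SymField F V ≃ₐ[F] SymField F V)) :=
  generatesInvariants_sym (coeff_symPoly_pow_mem b)
    (coeff_symPoly_mem_of_forall b fun j => Algebra.subset_adjoin ⟨j, rfl⟩)
    (fun g _ _ => symEquiv_coeff_symPoly g _) fun g _ => Subgroup.mem_top g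

/-- Dickson's theorem on the invariants of the special linear group. -/
theorem generatesInvariants_sym_detOne (b : Module.Basis (Fin r) F V) (hr : 1 ≤ r) :
    GeneratesInvariants
    (fun i : Fin r => if (i : ℕ) = 0 then symDet b else
      (symPoly F V).coeff (Fintype.card F ^ (i : ℕ))) (symGrading F V)
    (fun i => if (i : ℕ) = 0 then (Fintype.card F ^ r - 1) / (Fintype.card F - 1) else
      Fintype.card F ^ r - Fintype.card F ^ (i : ℕ)) (symAction F V) (detOneSubgroup F V)
    (fieldEquiv : _ → (SymField F V ≃ₐ[F] SymField F V)) := by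
  refine generatesInvariants_sym (fun i => ?_) (coeff_symPoly_mem_of_forall b fun j => ?_)
    (fun g hg i => ?_) fun g hg => ?_
  · split_ifs with h
    · exact symDet_mem b
    · exact coeff_symPoly_pow_mem b i
  · by_cases hj : (j : ℕ) = 0
    · rw [hj, pow_zero, coeff_symPoly_one b]
      refine mul_mem (pow_mem (neg_mem (one_mem _)) _) (pow_mem ?_ _)
      exact Algebra.subset_adjoin ⟨j, if_pos hj⟩
    · exact Algebra.subset_adjoin ⟨j, if_neg hj⟩
  · split_ifs with h
    · exact (symEquiv_symDet_eq_iff b g).mpr hg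
    · exact symEquiv_coeff_symPoly g _
  · have h := hg ⟨0, hr⟩
    rw [if_pos rfl] at h
    exact (symEquiv_symDet_eq_iff b g).mp h

end Sym

section Recip

variable [DecidableEq V]

/-- The coefficients of `recipPoly` other than the reciprocal Dickson invariants are `0` or `1`. -/
lemma coeff_recipPoly_mem_of_forall (b : Module.Basis (Fin r) F V)
    {B : Subalgebra F (RecipRing F V)}
    (h : ∀ i : Fin r, (recipPoly F V).coeff
      (Fintype.card F ^ r - Fintype.card F ^ ((i : ℕ) + 1)) ∈ B) (k : ℕ) :
    (recipPoly F V).coeff k ∈ B := by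
  have hcard := card_eq_pow b
  have hdeg : (recipPoly F V).natDegree = Fintype.card V - 1 := by
    rw [recipPoly, natDegree_prod_of_monic _ _ fun c _ => monic_X_sub_C _]
    simp
  obtain hk | hk := lt_or_ge (Fintype.card V - 1) k
  · rw [coeff_eq_zero_of_natDegree_lt (hdeg.trans_lt hk)]
    exact zero_mem _
  by_cases hj : ∃ j : Fin (r + 1), Fintype.card V - k = Fintype.card F ^ (j : ℕ)
  · have hpos : 0 < Fintype.card V := Fintype.card_pos
    obtain ⟨j, hj⟩ := hj
    induction j using Fin.cases with
    | zero =>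
      rw [Fin.val_zero, pow_zero] at hj
      rw [show k = Fintype.card V - 1 by omega, ← hdeg, recipPoly_monic.coeff_natDegree]
      exact one_mem _
    | succ i =>
      rw [Fin.val_succ] at hj
      rw [show k = Fintype.card F ^ r - Fintype.card F ^ ((i : ℕ) + 1) by omega]
      exact h i
  · have h0 := coeff_recipPoly_mul (F := F) hk
    rw [coeff_dickson_eq_zero b vecHom_injective (not_exists.mp hj)] at h0
    rw [show (recipPoly F V).coeff k = 0 from
      Subtype.ext ((mul_eq_zero.mp h0).resolve_right coeff_one_ne_zero)]
    exact zero_mem _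

lemma coeff_recipPoly_zero (b : Module.Basis (Fin r) F V) :
    (recipPoly F V).coeff 0 = (-1) ^ r * recipDet b ^ (Fintype.card F - 1) := by
  have h := coeff_recipPoly_mul (F := F) (V := V) (Nat.zero_le _)
  rw [Nat.sub_zero, coeff_card_dickson, coeff_one_dickson b vecHom_injective] at h
  refine Subtype.ext ?_
  rw [eq_inv_of_mul_eq_one_left h]
  have h1 : ((recipDet b : RecipRing F V) : SymField F V) = _ := algebraMap_recipDet b
  rw [Subalgebra.coe_mul, Subalgebra.coe_pow, Subalgebra.coe_pow, h1, mul_inv, inv_pow, ← inv_pow,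
    inv_neg, inv_one]
  rfl

lemma coeff_recipPoly_pow_mem (b : Module.Basis (Fin r) F V) (i : Fin r) : (recipPoly F V).coeff
    (Fintype.card F ^ r - Fintype.card F ^ ((i : ℕ) + 1)) ∈
      recipGrading F V (Fintype.card F ^ ((i : ℕ) + 1) - 1) := by
  have hcard := card_eq_pow b
  have h1 : Fintype.card F ^ ((i : ℕ) + 1) ≤ Fintype.card F ^ r :=
    Nat.pow_le_pow_right Fintype.card_pos i.is_lt
  have h2 : 0 < Fintype.card F ^ ((i : ℕ) + 1) := pow_pos Fintype.card_pos _
  have h := coeff_recipPoly_mem (F := F) (V := V)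
    (k := Fintype.card F ^ r - Fintype.card F ^ ((i : ℕ) + 1)) (by omega)
  rwa [show Fintype.card V - 1 - (Fintype.card F ^ r - Fintype.card F ^ ((i : ℕ) + 1)) =
    Fintype.card F ^ ((i : ℕ) + 1) - 1 by omega] at h

/-- The analogue of Dickson's theorem for `R_V` and the general linear group. -/
theorem generatesInvariants_recip_top (b : Module.Basis (Fin r) F V) : GeneratesInvariants
    (fun i : Fin r => (recipPoly F V).coeff
      (Fintype.card F ^ r - Fintype.card F ^ ((i : ℕ) + 1))) (recipGrading F V)
    (fun i => Fintype.card F ^ ((i : ℕ) + 1) - 1) (recipAction F V) ⊤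
    (fieldEquiv : _ → (SymField F V ≃ₐ[F] SymField F V)) :=
  generatesInvariants_recip (coeff_recipPoly_pow_mem b)
    (coeff_recipPoly_mem_of_forall b fun j => Algebra.subset_adjoin ⟨j, rfl⟩)
    (fun g _ _ => recipEquiv_coeff_recipPoly g _) fun g _ => Subgroup.mem_top g

/-- The analogue of Dickson's theorem for `R_V` and the special linear group. -/
theorem generatesInvariants_recip_detOne (b : Module.Basis (Fin r) F V) (hr : 1 ≤ r) :
    GeneratesInvariants
    (fun i : Fin r => if (i : ℕ) + 1 = r then recipDet b else (recipPoly F V).coeff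
      (Fintype.card F ^ r - Fintype.card F ^ ((i : ℕ) + 1))) (recipGrading F V)
    (fun i => if (i : ℕ) + 1 = r then (Fintype.card F ^ r - 1) / (Fintype.card F - 1) else
      Fintype.card F ^ ((i : ℕ) + 1) - 1) (recipAction F V) (detOneSubgroup F V)
    (fieldEquiv : _ → (SymField F V ≃ₐ[F] SymField F V)) := by
  refine generatesInvariants_recip (fun i => ?_) (coeff_recipPoly_mem_of_forall b fun j => ?_)
    (fun g hg i => ?_) fun g hg => ?_
  · split_ifs with h
    · exact recipDet_mem b
    · exact coeff_recipPoly_pow_mem b i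
  · by_cases hj : (j : ℕ) + 1 = r
    · rw [hj, Nat.sub_self, coeff_recipPoly_zero b]
      refine mul_mem (pow_mem (neg_mem (one_mem _)) _) (pow_mem ?_ _)
      exact Algebra.subset_adjoin ⟨j, if_pos hj⟩
    · exact Algebra.subset_adjoin ⟨j, if_neg hj⟩
  · split_ifs with h
    · exact (recipEquiv_recipDet_eq_iff b g).mpr hg
    · exact recipEquiv_coeff_recipPoly g _
  · have h := hg ⟨r - 1, by omega⟩
    rw [if_pos (Nat.sub_add_cancel hr)] at h
    exact (recipEquiv_recipDet_eq_iff b g).mp h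

end Recip

end DicksonInvariants

/-! ### Invariants of the unitriangular group -/

namespace UnipotentInvariants

open Flag

section Span

variable {B A : Type*} [CommRing B] [CommRing A] [Algebra B A] {κ : Type*} {e : κ → A}
  {N : Subalgebra B A}

lemma mul_mem_span_mul {x t : A} (hx : x ∈ N)
    (ht : t ∈ Submodule.span B (Set.range e) * Subalgebra.toSubmodule N) :
    x * t ∈ Submodule.span B (Set.range e) * Subalgebra.toSubmodule N := by
  induction ht using Submodule.mul_induction_on' with
  | mem_mul_mem m hm n hn =>
    rw [mul_left_comm]
    exact Submodule.mul_mem_mul hm (N.mul_mem hx hn)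
  | add a _ b _ ha hb =>
    rw [mul_add]
    exact add_mem ha hb

lemma apply_mem_span_mul (k : κ) :
    e k ∈ Submodule.span B (Set.range e) * Subalgebra.toSubmodule N := by
  rw [← mul_one (e k)]
  exact Submodule.mul_mem_mul (Submodule.subset_span ⟨k, rfl⟩) (one_mem N)

/-- A subalgebra generated by `S` lies in the `N`-module spanned by a family `e` if this module
contains `1` and is stable under multiplication by `S`. -/
lemma adjoin_le_span_mul {S : Set A}
    (h1 : 1 ∈ Submodule.span B (Set.range e) * Subalgebra.toSubmodule N)
    (hS : ∀ s ∈ S, ∀ k, s * e k ∈ Submodule.span B (Set.range e) * Subalgebra.toSubmodule N) :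
    Subalgebra.toSubmodule (Algebra.adjoin B S) ≤
      Submodule.span B (Set.range e) * Subalgebra.toSubmodule N := by
  set T := Submodule.span B (Set.range e) * Subalgebra.toSubmodule N with hT
  have hs (s : A) (hs : s ∈ S) (t : A) (ht : t ∈ T) : s * t ∈ T := by
    induction ht using Submodule.mul_induction_on' with
    | mem_mul_mem m hm n hn =>
      have h2 : s * m ∈ T := by
        induction hm using Submodule.span_induction with
        | mem m hm =>
          obtain ⟨k, rfl⟩ := hm
          exact hS s hs k
        | zero => rw [mul_zero]; exact zero_mem _
        | add a b _ _ ha hb => rw [mul_add]; exact add_mem ha hb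
        | smul c a _ ha => rw [mul_smul_comm]; exact Submodule.smul_mem _ c ha
      rw [← mul_assoc, mul_comm]
      exact mul_mem_span_mul hn h2
    | add a _ b _ ha hb =>
      rw [mul_add]
      exact add_mem ha hb
  intro x hx
  have key : ∀ t ∈ T, x * t ∈ T := by
    induction (hx : x ∈ Algebra.adjoin B S) using Algebra.adjoin_induction with
    | mem x hx => exact hs x hx
    | algebraMap c =>
      intro t ht
      rw [← Algebra.smul_def]
      exact Submodule.smul_mem _ c ht
    | add x y _ _ ihx ihy =>
      intro t ht
      rw [add_mul]
      exact add_mem (ihx t ht) (ihy t ht)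
    | mul x y _ _ ihx ihy =>
      intro t ht
      rw [mul_assoc]
      exact ihx _ (ihy t ht)
  rw [← mul_one x]
  exact key 1 h1

lemma one_mem_span_pow_mul (x : A) {n : ℕ} (hn : 0 < n) :
    1 ∈ Submodule.span B (Set.range fun k : Fin n => x ^ (k : ℕ)) * Subalgebra.toSubmodule N := by
  simpa using apply_mem_span_mul (N := N) (e := fun k : Fin n => x ^ (k : ℕ)) ⟨0, hn⟩

open Polynomial in
/-- If the product of the `x + u i`, for finitely many elements `u i` of `N`, is a scalar, then it
is a monic equation for `x` with coefficients in `N`. -/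
lemma pow_card_mem_span_pow_mul {ι : Type*} {s : Finset ι} (hs : s.Nonempty) {x : A} {u : ι → A}
    (hu : ∀ i ∈ s, u i ∈ N) {c : B} (hc : ∏ i ∈ s, (x + u i) = algebraMap B A c) :
    x ^ s.card ∈ Submodule.span B (Set.range fun k : Fin s.card => x ^ (k : ℕ)) *
      Subalgebra.toSubmodule N := by
  let p : N[X] := ∏ i : s, (X + C ⟨u i, hu i i.2⟩)
  have hp : p.Monic := monic_prod_of_monic _ _ fun w _ => monic_X_add_C _
  have hev : p.eval₂ N.val.toRingHom x = algebraMap B A c := by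
    rw [eval₂_finsetProd, ← hc, ← Finset.prod_coe_sort s fun i => x + u i]
    refine Finset.prod_congr rfl fun i _ => ?_
    rw [eval₂_add, eval₂_X, eval₂_C]
    rfl
  nontriviality A
  have : Nontrivial N := inferInstance
  have hd : p.natDegree = s.card := by
    rw [natDegree_prod_of_monic _ _ fun w _ => monic_X_add_C _]
    simp
  have hsum := congrArg (Polynomial.eval₂ N.val.toRingHom x) hp.as_sum
  rw [hev, eval₂_add, eval₂_finsetSum, eval₂_pow, eval₂_X, hd] at hsum
  rw [← sub_eq_iff_eq_add.mpr hsum]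
  refine sub_mem ?_ (sum_mem fun k hk => ?_)
  · rw [Algebra.algebraMap_eq_smul_one]
    exact Submodule.smul_mem _ c (one_mem_span_pow_mul x hs.card_pos)
  · rw [eval₂_mul, eval₂_C, eval₂_pow, eval₂_X]
    exact mul_mem_span_mul (p.coeff k).2 (apply_mem_span_mul
      (e := fun k : Fin s.card => x ^ (k : ℕ)) ⟨k, Finset.mem_range.mp hk⟩)

/-- A subalgebra generated by elements of `B x + N` is spanned over `N` by the powers of `x` below
`n`, if `x ^ n` is. -/
lemma adjoin_le_span_pow_mul {S : Set A} {x : A} {n : ℕ} (hn : 0 < n)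
    (hx : x ^ n ∈ Submodule.span B (Set.range fun k : Fin n => x ^ (k : ℕ)) *
      Subalgebra.toSubmodule N)
    (hS : ∀ a ∈ S, ∃ c : B, ∃ u ∈ N, a = c • x + u) :
    Subalgebra.toSubmodule (Algebra.adjoin B S) ≤
      Submodule.span B (Set.range fun k : Fin n => x ^ (k : ℕ)) * Subalgebra.toSubmodule N := by
  refine adjoin_le_span_mul (one_mem_span_pow_mul x hn) fun a ha k => ?_
  obtain ⟨c, u, hu, rfl⟩ := hS a ha
  rw [add_mul, smul_mul_assoc, ← pow_succ']
  refine add_mem (Submodule.smul_mem _ c ?_) (mul_mem_span_mul hu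
    (apply_mem_span_mul (e := fun k : Fin n => x ^ (k : ℕ)) k))
  obtain hk | hk := (Nat.succ_le_of_lt k.2).eq_or_lt
  · rwa [show (k : ℕ) + 1 = n from hk]
  · exact apply_mem_span_mul (e := fun k : Fin n => x ^ (k : ℕ)) ⟨k + 1, hk⟩

end Span

variable {F V : Type u} [Field F] [AddCommGroup V] [Module F V] {r : ℕ}

lemma exists_eq_smul_add (b : Module.Basis (Fin r) F V) {i : Fin r} {v : V}
    (hv : v ∈ b.flag i.succ) : ∃ (c : F) (u : V), u ∈ b.flag i.castSucc ∧ v = c • b i + u := by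
  rw [b.flag_succ, Submodule.mem_sup] at hv
  obtain ⟨x, hx, u, hu, rfl⟩ := hv
  obtain ⟨c, rfl⟩ := Submodule.mem_span_singleton.mp hx
  exact ⟨c, u, hu, rfl⟩

lemma adjoin_eq_top_of_subalgebra {A : Type*} [CommRing A] [Algebra F A] (B : Subalgebra F A)
    {S : Set A} (hS : ∀ a, a ∈ Algebra.adjoin F S) : Algebra.adjoin B S = ⊤ := by
  refine eq_top_iff.mpr fun a _ => ?_
  have h : Algebra.adjoin F S ≤ (Algebra.adjoin B S).restrictScalars F :=
    Algebra.adjoin_le Algebra.subset_adjoin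
  exact h (hS a)

lemma recip_zero : recip (0 : V) = (0 : RecipRing F V) := by
  refine Subtype.ext ?_
  rw [coe_recip, ← vecHom_apply, map_zero, inv_zero]
  rfl

lemma recip_smul (c : F) (v : V) : recip (c • v) = c⁻¹ • recip (F := F) v := by
  refine Subtype.ext ?_
  rw [coe_recip, ← vecHom_apply, map_smul, Algebra.smul_def, mul_inv, ← map_inv₀,
    ← Algebra.smul_def]
  rfl

/-- The relation `1/v * 1/w = (1/w - 1/v) * 1/(v - w)` in `R_V`. -/
lemma recip_mul_recip {v w : V} (hv : v ≠ 0) (hw : w ≠ 0) (hvw : v ≠ w) :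
    (recip v * recip w : RecipRing F V) = recip (v - w) * (recip w - recip v) := by
  refine Subtype.ext ?_
  have h1 := vec_ne_zero (F := F) hv
  have h2 := vec_ne_zero (F := F) hw
  have h3 := vec_ne_zero (F := F) (sub_ne_zero.mpr hvw)
  rw [Subalgebra.coe_mul, Subalgebra.coe_mul, Subalgebra.coe_sub, coe_recip, coe_recip, coe_recip]
  have h4 : vec (F := F) (v - w) = vec v - vec w := map_sub (vecHom F V) v w
  rw [h4] at h3 ⊢
  field_simp

variable [Finite V] (b : Module.Basis (Fin r) F V)

section Sym

/-- The product of the vectors in a coset of a step of the flag. -/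
noncomputable def cosetProd (i : Fin r) : SymRing F V := ∏ w ∈ coset b i, SymmetricAlgebra.ι F V w

/-- The subalgebras generated by the steps of the flag, over the invariants `cosetProd`. -/
noncomputable def symFiltration (k : Fin (r + 1)) :
    Subalgebra (Algebra.adjoin F (Set.range (cosetProd b))) (SymRing F V) :=
  Algebra.adjoin _ (SymmetricAlgebra.ι F V '' b.flag k)

lemma cosetProd_mem (i : Fin r) : cosetProd b i ∈ symGrading F V (Nat.card F ^ (i : ℕ)) := by
  have h := prod_mem_graded_card (𝒜 := symGrading F V) (coset b i) (SymmetricAlgebra.ι F V)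
    fun w _ => ι_mem_symGrading w
  rwa [mul_one, card_coset] at h

lemma symEquiv_cosetProd [Module.Finite F V] {g : V ≃ₗ[F] V} (hg : g ∈ unitriangular b)
    (i : Fin r) : symEquiv g (cosetProd b i) = cosetProd b i := by
  rw [cosetProd, map_prod]
  refine Finset.prod_nbij' g g.symm (fun w hw => apply_mem_coset hg hw)
    (fun w hw => apply_mem_coset (inv_mem hg) hw) (fun w _ => g.symm_apply_apply w)
    (fun w _ => g.apply_symm_apply w) fun w _ => symEquiv_ι g w

lemma symFiltration_succ_le (i : Fin r) :
    Subalgebra.toSubmodule (symFiltration b i.succ) ≤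
      Submodule.span (Algebra.adjoin F (Set.range (cosetProd b)))
        (Set.range fun k : Fin (coset b i).card => SymmetricAlgebra.ι F V (b i) ^ (k : ℕ)) *
      Subalgebra.toSubmodule (symFiltration b i.castSucc) := by
  have hne : (coset b i).Nonempty := ⟨_, self_mem_coset b i⟩
  refine adjoin_le_span_pow_mul hne.card_pos
    (pow_card_mem_span_pow_mul (u := fun w => SymmetricAlgebra.ι F V (w - b i))
      (c := ⟨_, Algebra.subset_adjoin ⟨i, rfl⟩⟩) hne
      (fun w hw => Algebra.subset_adjoin ⟨_, mem_coset.mp hw, rfl⟩) ?_) ?_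
  · refine Finset.prod_congr rfl fun w _ => ?_
    rw [← map_add, add_sub_cancel]
  · rintro _ ⟨v, hv, rfl⟩
    obtain ⟨c, u, hu, rfl⟩ := exists_eq_smul_add b hv
    refine ⟨algebraMap F _ c, _, Algebra.subset_adjoin ⟨u, hu, rfl⟩, ?_⟩
    rw [map_add, map_smul]
    rfl

/-- `S_V` is spanned over the subring generated by the `cosetProd` by `q ^ (r * (r - 1) / 2)`
monomials. -/
lemma symSpan_eq_top : Submodule.span (Algebra.adjoin F (Set.range (cosetProd b)))
    (Set.range fun c : ∀ i : Fin r, Fin (coset b i).card =>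
      ∏ i, SymmetricAlgebra.ι F V (b i) ^ (c i : ℕ)) = ⊤ := by
  refine span_range_prod_eq_top
    (fun i (k : Fin (coset b i).card) => SymmetricAlgebra.ι F V (b i) ^ (k : ℕ))
    (symFiltration b) ?_ ?_ (symFiltration_succ_le b)
  · rw [symFiltration, b.flag_zero, Submodule.bot_coe, Set.image_singleton, map_zero,
      Algebra.adjoin_singleton_zero]
  · refine adjoin_eq_top_of_subalgebra _ fun a => ?_
    rw [b.flag_last, Submodule.top_coe, Set.image_univ]
    exact mem_adjoin_ι a

/-- The invariants of the unitriangular group in `S_V`: the number of spanning monomials is at most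
the order of the group. -/
theorem generatesInvariants_sym [Module.Finite F V] : GeneratesInvariants (cosetProd b)
    (symGrading F V) (fun i => Nat.card F ^ (i : ℕ)) (symAction F V) (unitriangular b)
    (fieldEquiv : _ → (SymField F V ≃ₐ[F] SymField F V)) where
  mem_graded := cosetProd_mem b
  invariant g hg i := symEquiv_cosetProd b hg i
  isIntegral := by
    have : Module.Finite (Algebra.adjoin F (Set.range (cosetProd b))) (SymRing F V) :=
      ⟨⟨(Set.finite_range _).toFinset, by rw [Set.Finite.coe_toFinset, symSpan_eq_top b]⟩⟩
    infer_instance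
  mem_adjoin := by
    refine (linearIndependent_and_mem_of_card_le fieldEquiv_injective (fun g hg i => ?_)
      (symSpan_eq_top b) ?_).2
    · rw [fieldEquiv_algebraMap, symEquiv_cosetProd b hg]
    · refine le_trans (Eq.le ?_) (card_pi_coset_le_card_unitriangular b)
      simp only [Nat.card_eq_fintype_card, Fintype.card_pi, Fintype.card_fin,
        Fintype.card_coe]

end Sym

section Recip

/-- The sum of the reciprocals of the vectors in a coset of a step of the flag. -/
noncomputable def cosetSum (i : Fin r) : RecipRing F V := ∑ w ∈ coset b i, recip w

/-- The subalgebras generated by the reciprocals in the steps of the flag, over the invariants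
`cosetSum`. -/
noncomputable def recipFiltration (k : Fin (r + 1)) :
    Subalgebra (Algebra.adjoin F (Set.range (cosetSum b))) (RecipRing F V) :=
  Algebra.adjoin _ (recip '' (b.flag k : Set V))

open Classical in
/-- The reciprocals in a coset of a step of the flag, with `1 / b i` replaced by `1`. -/
noncomputable def cosetRecip (i : Fin r) (w : coset b i) : RecipRing F V :=
  if (w : V) = b i then 1 else recip (w : V)

lemma cosetSum_mem (i : Fin r) : cosetSum b i ∈ recipGrading F V 1 :=
  sum_mem fun w _ => recip_mem_recipGrading w

lemma recipEquiv_cosetSum [Module.Finite F V] {g : V ≃ₗ[F] V} (hg : g ∈ unitriangular b)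
    (i : Fin r) : recipEquiv g (cosetSum b i) = cosetSum b i := by
  rw [cosetSum, map_sum]
  refine Finset.sum_nbij' g g.symm (fun w hw => apply_mem_coset hg hw)
    (fun w hw => apply_mem_coset (inv_mem hg) hw) (fun w _ => g.symm_apply_apply w)
    (fun w _ => g.apply_symm_apply w) fun w _ => recipEquiv_recip g w

lemma one_mem_recipSpan (i : Fin r) : (1 : RecipRing F V) ∈
    Submodule.span (Algebra.adjoin F (Set.range (cosetSum b))) (Set.range (cosetRecip b i)) *
      Subalgebra.toSubmodule (recipFiltration b i.castSucc) := by
  have h := apply_mem_span_mul (N := recipFiltration b i.castSucc) (e := cosetRecip b i)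
    ⟨b i, self_mem_coset b i⟩
  rwa [cosetRecip, if_pos rfl] at h

lemma cosetSum_mul_mem {i : Fin r} {t : RecipRing F V} (ht : t ∈
    Submodule.span (Algebra.adjoin F (Set.range (cosetSum b))) (Set.range (cosetRecip b i)) *
      Subalgebra.toSubmodule (recipFiltration b i.castSucc)) : cosetSum b i * t ∈
    Submodule.span (Algebra.adjoin F (Set.range (cosetSum b))) (Set.range (cosetRecip b i)) *
      Subalgebra.toSubmodule (recipFiltration b i.castSucc) :=
  Submodule.smul_mem _ (⟨_, Algebra.subset_adjoin ⟨i, rfl⟩⟩ :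
    Algebra.adjoin F (Set.range (cosetSum b))) ht

/-- The reciprocals in a coset lie in the span, although `1 / b i` is not in the spanning family: it
is `cosetSum` minus the others. -/
lemma recip_mem_recipSpan {i : Fin r} {w : V} (hw : w ∈ coset b i) : recip w ∈
    Submodule.span (Algebra.adjoin F (Set.range (cosetSum b))) (Set.range (cosetRecip b i)) *
      Subalgebra.toSubmodule (recipFiltration b i.castSucc) := by
  classical
  have hne {w : V} (hw : w ∈ coset b i) (h : w ≠ b i) : recip w ∈
      Submodule.span (Algebra.adjoin F (Set.range (cosetSum b))) (Set.range (cosetRecip b i)) *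
        Subalgebra.toSubmodule (recipFiltration b i.castSucc) := by
    have h1 := apply_mem_span_mul (N := recipFiltration b i.castSucc) (e := cosetRecip b i) ⟨w, hw⟩
    rwa [cosetRecip, if_neg h] at h1
  by_cases h : w = b i
  · have h1 : recip w = cosetSum b i * 1 - ∑ w' ∈ (coset b i).erase w, recip w' := by
      rw [mul_one, cosetSum, ← Finset.add_sum_erase _ _ hw, add_sub_cancel_right]
    rw [h1]
    refine sub_mem (cosetSum_mul_mem b (one_mem_recipSpan b i)) (sum_mem fun w' hw' => ?_)
    exact hne (Finset.mem_of_mem_erase hw') (h ▸ Finset.ne_of_mem_erase hw')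
  · exact hne hw h

/-- Products of two reciprocals in a coset reduce to linear terms, by `recip_mul_recip` if they are
distinct, and via multiplication with `cosetSum` for squares. -/
lemma recip_mul_recip_mem_recipSpan {i : Fin r} {w w' : V} (hw : w ∈ coset b i)
    (hw' : w' ∈ coset b i) : recip w * recip w' ∈
    Submodule.span (Algebra.adjoin F (Set.range (cosetSum b))) (Set.range (cosetRecip b i)) *
      Subalgebra.toSubmodule (recipFiltration b i.castSucc) := by
  classical
  have hne {w w' : V} (hw : w ∈ coset b i) (hw' : w' ∈ coset b i) (h : w ≠ w') :
      recip w * recip w' ∈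
      Submodule.span (Algebra.adjoin F (Set.range (cosetSum b))) (Set.range (cosetRecip b i)) *
        Subalgebra.toSubmodule (recipFiltration b i.castSucc) := by
    rw [recip_mul_recip (ne_zero_of_mem_coset hw) (ne_zero_of_mem_coset hw') h]
    refine mul_mem_span_mul (Algebra.subset_adjoin ⟨w - w', ?_, rfl⟩)
      (sub_mem (recip_mem_recipSpan b hw') (recip_mem_recipSpan b hw))
    simpa using sub_mem (mem_coset.mp hw) (mem_coset.mp hw')
  by_cases h : w = w'
  · subst h
    have h1 : recip w * recip w =
        cosetSum b i * recip w - ∑ w' ∈ (coset b i).erase w, recip w' * recip w := by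
      rw [cosetSum, ← Finset.add_sum_erase _ _ hw, add_mul, Finset.sum_mul, add_sub_cancel_right]
    rw [h1]
    exact sub_mem (cosetSum_mul_mem b (recip_mem_recipSpan b hw)) (sum_mem fun w' hw'' =>
      hne (Finset.mem_of_mem_erase hw'') hw (Finset.ne_of_mem_erase hw''))
  · exact hne hw hw' h

lemma recipFiltration_succ_le (i : Fin r) :
    Subalgebra.toSubmodule (recipFiltration b i.succ) ≤
      Submodule.span (Algebra.adjoin F (Set.range (cosetSum b))) (Set.range (cosetRecip b i)) *
        Subalgebra.toSubmodule (recipFiltration b i.castSucc) := by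
  refine adjoin_le_span_mul (one_mem_recipSpan b i) ?_
  rintro _ ⟨v, hv, rfl⟩ k
  obtain ⟨c, u, hu, rfl⟩ := exists_eq_smul_add b hv
  by_cases hc : c = 0
  · rw [hc, zero_smul, zero_add]
    exact mul_mem_span_mul (Algebra.subset_adjoin ⟨u, hu, rfl⟩) (apply_mem_span_mul k)
  · have h1 : c • b i + u = c • (b i + c⁻¹ • u) := by
      rw [smul_add, smul_smul, mul_inv_cancel₀ hc, one_smul]
    have h2 : b i + c⁻¹ • u ∈ coset b i := by
      rw [mem_coset, add_sub_cancel_left]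
      exact Submodule.smul_mem _ _ hu
    rw [h1, recip_smul, smul_mul_assoc,
      ← algebraMap_smul (Algebra.adjoin F (Set.range (cosetSum b))) c⁻¹]
    refine Submodule.smul_mem _ _ ?_
    rw [cosetRecip]
    split_ifs
    · rw [mul_one]
      exact recip_mem_recipSpan b h2
    · exact recip_mul_recip_mem_recipSpan b h2 k.2

/-- `R_V` is spanned over the subring generated by the `cosetSum` by products of reciprocals, one
factor from each coset. -/
lemma recipSpan_eq_top : Submodule.span (Algebra.adjoin F (Set.range (cosetSum b)))
    (Set.range fun c : ∀ i, coset b i => ∏ i, cosetRecip b i (c i)) = ⊤ := by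
  refine span_range_prod_eq_top _ (recipFiltration b) ?_ ?_ (recipFiltration_succ_le b)
  · rw [recipFiltration, b.flag_zero, Submodule.bot_coe, Set.image_singleton, recip_zero,
      Algebra.adjoin_singleton_zero]
  · refine adjoin_eq_top_of_subalgebra _ fun a => ?_
    rw [b.flag_last, Submodule.top_coe, Set.image_univ]
    exact Algebra.adjoin_mono (Set.image_subset_range _ _) (mem_adjoin_recip a)

/-- The spanning family is independent, as the number of its elements is at most the order of the
unitriangular group. -/
lemma recip_linearIndependent_and_mem [Module.Finite F V] :
    LinearIndependent (IntermediateField.adjoin F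
        (Set.range fun i => algebraMap _ (SymField F V) (cosetSum b i)))
      (fun c : ∀ i, coset b i => algebraMap _ (SymField F V) (∏ i, cosetRecip b i (c i))) ∧
    ∀ x : SymField F V, (∀ g ∈ unitriangular b, fieldEquiv g x = x) →
      x ∈ IntermediateField.adjoin F
        (Set.range fun i => algebraMap _ (SymField F V) (cosetSum b i)) := by
  refine linearIndependent_and_mem_of_card_le fieldEquiv_injective (fun g hg i => ?_)
    (recipSpan_eq_top b) (card_pi_coset_le_card_unitriangular b)
  exact congrArg Subtype.val (recipEquiv_cosetSum b hg i)

/-- The invariants of the unitriangular group in `R_V`. -/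
theorem generatesInvariants_recip [Module.Finite F V] : GeneratesInvariants (cosetSum b)
    (recipGrading F V) (fun _ => 1) (recipAction F V) (unitriangular b)
    (fieldEquiv : _ → (SymField F V ≃ₐ[F] SymField F V)) where
  mem_graded := cosetSum_mem b
  invariant g hg i := recipEquiv_cosetSum b hg i
  isIntegral := by
    have : Module.Finite (Algebra.adjoin F (Set.range (cosetSum b))) (RecipRing F V) :=
      ⟨⟨(Set.finite_range _).toFinset, by rw [Set.Finite.coe_toFinset, recipSpan_eq_top b]⟩⟩
    infer_instance
  mem_adjoin := (recip_linearIndependent_and_mem b).2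

open Classical in
lemma cosetRecip_mem (i : Fin r) (w : coset b i) :
    cosetRecip b i w ∈ recipGrading F V (if (w : V) = b i then 0 else 1) := by
  rw [cosetRecip]
  split_ifs
  · exact SetLike.one_mem_graded _
  · exact recip_mem_recipGrading _

end Recip

end UnipotentInvariants

/-! ### The quotient of `Q_V` by the unitriangular group -/

/-- The irrelevant ideal of a polynomial ring is generated by the variables, indexed by a type in
the universe of the field. -/
lemma irrelevant_homogeneousSubmodule_le (F : Type u) [Field F] (r : ℕ) :
    (HomogeneousIdeal.irrelevant (MvPolynomial.homogeneousSubmodule (Fin r) F)).toIdeal ≤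
      Ideal.span (Set.range fun k : ULift.{u} (Fin r) => MvPolynomial.X k.down) := by
  refine (HomogeneousIdeal.toIdeal_irrelevant_le
    (𝒜 := MvPolynomial.homogeneousSubmodule (Fin r) F)).mpr fun n hn p hp => ?_
  have h1 : (Set.range fun k : ULift.{u} (Fin r) => (MvPolynomial.X k.down : MvPolynomial _ F)) =
      MvPolynomial.X '' Set.univ := by
    rw [Set.image_univ]
    exact ULift.down_surjective.range_comp fun k : Fin r => MvPolynomial.X (R := F) k
  change p ∈ Ideal.span _
  rw [h1, MvPolynomial.mem_ideal_span_X_image]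
  intro m hm
  by_contra! hm0
  have hm1 : m = 0 := Finsupp.ext fun i => hm0 i (Set.mem_univ i)
  have h2 := hp (MvPolynomial.mem_support_iff.mp hm)
  rw [hm1, map_zero] at h2
  omega

namespace UnipotentInvariants

open Flag

variable {F V : Type u} [Field F] [AddCommGroup V] [Module F V] {r : ℕ}
  [Finite V] [Module.Finite F V] (b : Module.Basis (Fin r) F V)

/-- `Q_V ⟶ Q_V / U` is finite flat: the products of the `cosetRecip` are a homogeneous basis of
`R_V` over the ring of invariants. -/
theorem isFinite_flat_finrank {hℬ : ∀ n, ∀ p ∈ MvPolynomial.homogeneousSubmodule (Fin r) F n,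
      p ∈ MvPolynomial.weightedHomogeneousSubmodule F (fun _ => 1) n}
    (hinj : Function.Injective (MvPolynomial.aeval (R := F) (cosetSum b)))
    (hf : ProjFunctor.PreservesRelevant
      (aevalGraded (𝒜 := recipGrading F V) hℬ (cosetSum_mem b))) :
    IsFinite (ProjFunctor.projMap _ hf) ∧ Flat (ProjFunctor.projMap _ hf) ∧
      ∀ y, (ProjFunctor.projMap _ hf).finrank y = Nat.card F ^ (r * (r - 1) / 2) := by
  classical
  have happ (p) : aevalGraded (𝒜 := recipGrading F V) hℬ (cosetSum_mem b) p =
      MvPolynomial.aeval (cosetSum b) p := rfl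
  have h := ProjQuotient.isFinite_flat_finrank hf hinj
    (e := fun c : ∀ i, coset b i => ∏ i, cosetRecip b i (c i))
    (fun c => SetLike.prod_mem_graded _ _ _ fun i _ => cosetRecip_mem b i (c i))
    (fun a => ?_) (fun p hp => ?_)
    (fun k : ULift.{u} (Fin r) => (MvPolynomial.X k.down : MvPolynomial (Fin r) F))
    (fun k => MvPolynomial.isHomogeneous_X F k.down) (fun k => MvPolynomial.X_ne_zero _)
    (irrelevant_homogeneousSubmodule_le F r)
  · rwa [← Nat.card_eq_fintype_card, card_pi_coset] at h
  · have ha : a ∈ Submodule.span (Algebra.adjoin F (Set.range (cosetSum b)))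
        (Set.range fun c : ∀ i, coset b i => ∏ i, cosetRecip b i (c i)) :=
      recipSpan_eq_top b ▸ Submodule.mem_top
    obtain ⟨s, rfl⟩ := (Submodule.mem_span_range_iff_exists_fun _).mp ha
    have hs (c : ∀ i, coset b i) : ∃ p, MvPolynomial.aeval (R := F) (cosetSum b) p =
        (s c : RecipRing F V) := by
      obtain ⟨t, ht⟩ := s c
      rwa [Algebra.adjoin_range_eq_range_aeval] at ht
    choose p hp using hs
    refine ⟨p, Finset.sum_congr rfl fun c _ => ?_⟩
    rw [happ, hp]
    rfl
  · have hmem (c : ∀ i, coset b i) : MvPolynomial.aeval (cosetSum b) (p c) ∈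
        Algebra.adjoin F (Set.range (cosetSum b)) := by
      rw [Algebra.adjoin_range_eq_range_aeval]
      exact ⟨p c, rfl⟩
    have h1 := Fintype.linearIndependent_iff.mp (recip_linearIndependent_and_mem b).1
      (fun c => ⟨_, algebraMap_mem_adjoin_of_mem_adjoin (hmem c)⟩) ?_
    · intro c
      have h2 := congrArg Subtype.val (h1 c)
      refine hinj ?_
      rw [map_zero]
      exact Subtype.val_injective h2
    · have h2 := congrArg (algebraMap (RecipRing F V) (SymField F V)) hp
      rw [map_zero, map_sum] at h2
      rw [← h2]
      refine Finset.sum_congr rfl fun c _ => ?_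
      rw [map_mul]
      rfl

end UnipotentInvariants

/-! ### The quotients of `P_V` and `Q_V` -/

theorem theorem2p2 {F V : Type u} [Field F] [Finite F] [AddCommGroup V] [Module F V]
    [Module.Finite F V] (q r : ℕ) (hq : Nat.card F = q) (hr : Module.finrank F V = r)
    (hr1 : 1 ≤ r) (U : Subgroup (V ≃ₗ[F] V)) (hU : Maximal IsUnipotentSubgroup U) :
    -- (a) `Q_V/U`
    (∃ π : QVar F V ⟶ ProjSpace F r,
      π ≫ projToSpec (MvPolynomial.homogeneousSubmodule (Fin r) F) =
        projToSpec (recipGrading F V) ∧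
      IsQuotientBy QVarAct U π ∧ IsFinite π ∧ Flat π ∧
      ∀ y : ProjSpace F r, π.finrank y = q ^ (r * (r - 1) / 2)) ∧
    -- (b) `P_V/U`
    (∃ π : PVar F V ⟶ WeightedProj F (fun i : Fin r => q ^ (i : ℕ)),
      π ≫ projToSpec (MvPolynomial.weightedHomogeneousSubmodule F _) =
        projToSpec (symGrading F V) ∧
      IsQuotientBy PVarAct U π) ∧
    -- (c) `Q_V/G`
    (∃ π : QVar F V ⟶ WeightedProj F (fun i : Fin r => q ^ ((i : ℕ) + 1) - 1),
      π ≫ projToSpec (MvPolynomial.weightedHomogeneousSubmodule F _) =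
        projToSpec (recipGrading F V) ∧
      IsQuotientBy QVarAct ⊤ π) ∧
    -- (d) `P_V/G`
    (∃ π : PVar F V ⟶ WeightedProj F (fun i : Fin r => q ^ r - q ^ (i : ℕ)),
      π ≫ projToSpec (MvPolynomial.weightedHomogeneousSubmodule F _) =
        projToSpec (symGrading F V) ∧
      IsQuotientBy PVarAct ⊤ π) ∧
    -- (e) `Q_V/G'`
    (∃ π : QVar F V ⟶ WeightedProj F (fun i : Fin r =>
        if (i : ℕ) + 1 = r then (q ^ r - 1) / (q - 1) else q ^ ((i : ℕ) + 1) - 1),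
      π ≫ projToSpec (MvPolynomial.weightedHomogeneousSubmodule F _) =
        projToSpec (recipGrading F V) ∧
      IsQuotientBy QVarAct (detOneSubgroup F V) π) ∧
    -- (f) `P_V/G'`
    (∃ π : PVar F V ⟶ WeightedProj F (fun i : Fin r =>
        if (i : ℕ) = 0 then (q ^ r - 1) / (q - 1) else q ^ r - q ^ (i : ℕ)),
      π ≫ projToSpec (MvPolynomial.weightedHomogeneousSubmodule F _) =
        projToSpec (symGrading F V) ∧
      IsQuotientBy PVarAct (detOneSubgroup F V) π) := by
  have : Finite V := Module.finite_of_finite F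
  have : Finite (V ≃ₗ[F] V) := Finite.of_injective _ DFunLike.coe_injective
  obtain ⟨b, rfl⟩ := Flag.exists_eq_unitriangular hr hr1 hU
  have hE (g : V ≃ₗ[F] V) (a : RecipRing F V) : fieldEquiv g (algebraMap _ (SymField F V) a) =
      algebraMap _ (SymField F V) (recipAction F V g a) := rfl
  have hP {w : Fin r → ℕ} {y : Fin r → SymRing F V} {H : Subgroup (V ≃ₗ[F] V)}
      (hy : GeneratesInvariants y (symGrading F V) w (symAction F V) H
        (fieldEquiv : _ → (SymField F V ≃ₐ[F] SymField F V))) :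
      ∃ π : PVar F V ⟶ WeightedProj F w,
        π ≫ projToSpec (MvPolynomial.weightedHomogeneousSubmodule F w) =
          projToSpec (symGrading F V) ∧ IsQuotientBy PVarAct H π := by
    obtain ⟨hf, h⟩ := hy.isQuotientBy (fun _ _ hp => hp) (trdeg_symRing b) fieldEquiv_algebraMap
      (fun g => symEquiv_mem g) fun g => symEquiv_mem g.symm
    exact ⟨_, h⟩
  have hQ {w : Fin r → ℕ} {y : Fin r → RecipRing F V} {H : Subgroup (V ≃ₗ[F] V)}
      (hy : GeneratesInvariants y (recipGrading F V) w (recipAction F V) H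
        (fieldEquiv : _ → (SymField F V ≃ₐ[F] SymField F V))) :
      ∃ π : QVar F V ⟶ WeightedProj F w,
        π ≫ projToSpec (MvPolynomial.weightedHomogeneousSubmodule F w) =
          projToSpec (recipGrading F V) ∧ IsQuotientBy QVarAct H π := by
    obtain ⟨hf, h⟩ := hy.isQuotientBy (fun _ _ hp => hp) (trdeg_recipRing b) hE
      (fun g => recipEquiv_mem g) fun g => recipEquiv_mem g.symm
    exact ⟨_, h⟩
  classical
  have := Fintype.ofFinite F
  have := Fintype.ofFinite V
  refine ⟨?_, ?_, ?_, ?_, ?_, ?_⟩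
  · have hy := UnipotentInvariants.generatesInvariants_recip b
    have hℬ (n : ℕ) (p) (hp : p ∈ MvPolynomial.homogeneousSubmodule (Fin r) F n) :
        p ∈ MvPolynomial.weightedHomogeneousSubmodule F (fun _ => 1) n := hp
    obtain ⟨hf, h1, h2⟩ := hy.isQuotientBy hℬ (trdeg_recipRing b) hE
      (fun g => recipEquiv_mem g) fun g => recipEquiv_mem g.symm
    subst hq
    exact ⟨_, h1, h2, UnipotentInvariants.isFinite_flat_finrank b
      (hy.isInvariantRing hℬ (trdeg_recipRing b) hE).1 hf⟩
  · subst hq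
    exact hP (UnipotentInvariants.generatesInvariants_sym b)
  all_goals rw [Nat.card_eq_fintype_card] at hq; subst hq
  · exact hQ (DicksonInvariants.generatesInvariants_recip_top b)
  · exact hP (DicksonInvariants.generatesInvariants_sym_top b)
  · exact hQ (DicksonInvariants.generatesInvariants_recip_detOne b hr1)
  · exact hP (DicksonInvariants.generatesInvariants_sym_detOne b hr1)
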